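/- Let $B$ be a scheme over $\mathbb{C}$; all curves have genus zero. A prestable curve $c\colon C\to B$ is a flat, proper, finitely presented morphism whose geometric fibres are connected nodal curves of arithmetic genus $0$. For a finite tree $\tau$ with vertices $V_\tau$, edges $E_\tau$ and tails $T_\tau$, the curve has constant tree type $\tau$ if it has sections $p_t\colon B\to C$ ($t\in T_\tau$) and $p_e\colon B\to C$ ($e\in E_\tau$) such that in every geometric fibre the irreducible components correspond to $V_\tau$, the $p_e$ are exactly the nodes (the two ends of $e$ being the components that meet there), and the $p_t$ are distinct smooth points, $p_t$ lying on the component to which $t$ is attached. It is stable if every vertex has valence at least $3$. A spin structure consists of the normalization $\nu\colon\tilde C\to C$ relative to $B$ (finite, $\tilde C\to B$ smooth of relative dimension $1$, $\nu$ an isomorphism over the smooth locus) and a line bundle $L$ on $\tilde C$ with an isomorphism $L\cong \mathcal{H}om(L,T_{\tilde C/B})$; the spinor bundle is $S_C=\nu_*L$ and we write $S_C^\vee=\nu_*(L^\vee)$. The SUSY normal bundle $N_C$ is the cokernel of $$c_*S_C\to\bigoplus_{t\in T_\tau}p_t^*S_C\oplus\bigoplus_{e\in E_\tau}p_e^*S_C,\qquad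 s\mapsto (p_t^*s,\,p_e^*s).$$ Let $X$ be a smooth projective scheme over $\mathbb{C}$. A stable spin map of constant tree type $(\tau,\beta)$, where $\beta$ assigns to each vertex a curve class on $X$ (given by its intersection numbers with line bundles), is a prestable spin curve of constant tree type $\tau$ with a morphism $\phi\colon C\to X$ over $\mathbb{C}$ such that in every geometric fibre $\phi$ sends the component of $v$ to the class $\beta(v)$, and every $v$ with $\beta(v)=0$ has valence at least $3$. Put $S_C^\vee\otimes\phi^*T_X=\nu_*(L^\vee\otimes(\phi\nu)^*T_X)$. The SUSY normal bundle $N_{(C,\phi)}$ is the cokernel of $$c_*S_C\to\bigoplus_{t\in T_\tau}p_t^*S_C\oplus\bigoplus_{e\in E_\tau}p_e^*S_C\oplus c_*(S_C^\vee\otimes\phi^*T_X),\qquad s\mapsto(p_t^*s,\,p_e^*s,\,-\langle s,d\phi\rangle),$$ where $\langle s,d\phi\rangle$ is the homomorphism $s'\mapsto d\phi(s\otimes s')$, the tensor $s\otimes s'$ being viewed as a vector field through $L\otimes L\cong T_{\tilde C/B}$. Let $t_1\in T_{\tau_1}$ and $t_2\in T_{\tau_2}$ be tails and let $\sigma$ be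 the tree obtained from $\tau_1$ and $\tau_2$ by grafting $t_1$ and $t_2$ to a new edge. 1. Let $c_1\colon C_1\to B$ and $c_2\colon C_2\to B$ be stable spin curves of constant tree types $\tau_1$ and $\tau_2$, and let $c\colon C\to B$ be the prestable spin curve obtained by gluing $C_1$ and $C_2$ along $p_{t_1}$ and $p_{t_2}$: the curve $C$ is the union of the closed subschemes $C_1$ and $C_2$ meeting exactly in $B$, functions on $C$ are pairs of functions agreeing on $B$, the normalization of $C$ is the disjoint union of those of $C_1$ and $C_2$, the spin structure of $C$ restricts to the given ones, and the remaining tails, the old edges and the new edge give the sections of $C$. Then $C$ is stable of constant tree type $\sigma$ and $$N_C\cong N_{C_1}\oplus N_{C_2}.$$ 2. Let $\phi_1\colon C_1\to X$ and $\phi_2\colon C_2\to X$ be stable spin maps of constant tree types $(\tau_1,\beta_1)$ and $(\tau_2,\beta_2)$ with $\phi_1\circ p_{t_1}=\phi_2\circ p_{t_2}$, and let $C$ be the prestable spin curve obtained by gluing $C_1$ and $C_2$ along $p_{t_1}$ and $p_{t_2}$ as in 1. Then there is exactly one morphism $\phi\colon C\to X$ which restricts to $\phi_1$ and $\phi_2$,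 it is a stable spin map of constant tree type $(\sigma,\beta_1\sqcup\beta_2)$, and $$N_{(C,\phi)}\cong N_{(C_1,\phi_1)}\oplus N_{(C_2,\phi_2)}.$$ -/

import Mathlib

open CategoryTheory Limits AlgebraicGeometry TopologicalSpace Opposite

noncomputable section
namespace SUSY

/-- Restriction of sections of an `𝒪_Y`-module to a smaller open subset. -/
def res {Y : Scheme.{0}} (N : Y.Modules) {U V : Y.Opens} (h : V ≤ U) : Γ(N, U) →+ Γ(N, V) :=
  (N.presheaf.map (homOfLE h).op).hom

/-- Restriction of functions on a scheme to a smaller open subset. -/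
def resO (Y : Scheme.{0}) {U V : Y.Opens} (h : V ≤ U) : Γ(Y, U) →+* Γ(Y, V) :=
  (Y.presheaf.map (homOfLE h).op).hom

section Basic
variable {Y : Scheme.{0}} (N : Y.Modules)

lemma res_smul {U V : Y.Opens} (h : V ≤ U) (r : Γ(Y, U)) (x : Γ(N, U)) :
    res N h (r • x) = resO Y h r • res N h x := N.map_smul (homOfLE h) r x

lemma res_self {U : Y.Opens} (h : U ≤ U) (x : Γ(N, U)) : res N h x = x := by
  simp [res]

lemma res_res {U V W : Y.Opens} (h : V ≤ U) (h' : W ≤ V) (x : Γ(N, U)) :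
    res N h' (res N h x) = res N (h'.trans h) x := by
  have : (homOfLE (h'.trans h)).op = (homOfLE h).op ≫ (homOfLE h').op := rfl
  simp [res, this]

lemma resO_self {U : Y.Opens} (h : U ≤ U) (x : Γ(Y, U)) : resO Y h x = x := by
  simp [resO]

lemma resO_resO {U V W : Y.Opens} (h : V ≤ U) (h' : W ≤ V) (x : Γ(Y, U)) :
    resO Y h' (resO Y h x) = resO Y (h'.trans h) x := by
  have : (homOfLE (h'.trans h)).op = (homOfLE h).op ≫ (homOfLE h').op := rfl
  simp [resO, this]

lemma res_ext {ι : Type*} {U : Y.Opens} (V : ι → Y.Opens) (hV : ∀ i, V i ≤ U) (hc : U ≤ ⨆ i, V i)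
    (s t : Γ(N, U)) (h : ∀ i, res N (hV i) s = res N (hV i) t) : s = t :=
  TopCat.Sheaf.eq_of_locally_eq' ⟨N.presheaf, N.isSheaf⟩ V U (fun i => homOfLE (hV i)) hc s t h

lemma res_glue {ι : Type*} {U : Y.Opens} (V : ι → Y.Opens) (hV : ∀ i, V i ≤ U) (hc : U ≤ ⨆ i, V i)
    (s : ∀ i, Γ(N, V i))
    (h : ∀ i j, res N (inf_le_left : V i ⊓ V j ≤ V i) (s i) =
      res N (inf_le_right : V i ⊓ V j ≤ V j) (s j)) :
    ∃ t : Γ(N, U), ∀ i, res N (hV i) t = s i :=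
  (TopCat.Sheaf.existsUnique_gluing' ⟨N.presheaf, N.isSheaf⟩ V U
    (fun i => homOfLE (hV i)) hc s h).exists

end Basic

section Operators
variable {Y : Scheme.{0}} (N : Y.Modules) {κ : Type} (D : κ → Y.Opens)

/-- Families of sections `f k` of `N` over `U ∩ D k`, where `k` runs through an index type. -/
def Fam (U : Y.Opens) : Type := ∀ k, Γ(N, U ⊓ D k)

instance (U : Y.Opens) : AddCommGroup (Fam N D U) := inferInstanceAs (AddCommGroup (∀ k, Γ(N, U ⊓ D k)))

/-- Restriction of functions from `U` to `U ∩ D k`. -/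
def resInf (U : Y.Opens) (k : κ) : Γ(Y, U) →+* Γ(Y, U ⊓ D k) :=
  resO Y inf_le_left

instance (U : Y.Opens) : Module Γ(Y, U) (Fam N D U) where
  smul r f := fun k => resInf D U k r • f k
  one_smul f := by
    funext k; change resInf D U k 1 • f k = f k; rw [map_one, one_smul]
  mul_smul r s f := by
    funext k
    change resInf D U k (r * s) • f k = resInf D U k r • resInf D U k s • f k
    rw [map_mul, mul_smul]
  smul_zero r := by
    funext k; change resInf D U k r • (0 : Γ(N, U ⊓ D k)) = 0; rw [smul_zero]
  smul_add r f g := by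
    funext k
    change resInf D U k r • (f k + g k) = resInf D U k r • f k + resInf D U k r • g k
    rw [smul_add]
  add_smul r s f := by
    funext k
    change resInf D U k (r + s) • f k = resInf D U k r • f k + resInf D U k s • f k
    rw [map_add, add_smul]
  zero_smul f := by
    funext k; change resInf D U k 0 • f k = 0; rw [map_zero, zero_smul]

variable {N D}
lemma Fam.smul_apply {U : Y.Opens} (r : Γ(Y, U)) (f : Fam N D U) (k : κ) :
    (r • f) k = resInf D U k r • f k := rfl
lemma Fam.add_apply {U : Y.Opens} (f g : Fam N D U) (k : κ) : (f + g) k = f k + g k := rfl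
lemma Fam.zero_apply {U : Y.Opens} (k : κ) : (0 : Fam N D U) k = 0 := rfl
variable (N D)

/-- Restriction of families. -/
def Fam.restrict {U V : Y.Opens} (h : V ≤ U) : Fam N D U →+ Fam N D V where
  toFun f := fun k => res N (inf_le_inf_right (D k) h) (f k)
  map_zero' := by funext k; exact map_zero _
  map_add' f g := by funext k; exact map_add _ _ _

lemma Fam.restrict_smul {U V : Y.Opens} (h : V ≤ U) (r : Γ(Y, U)) (f : Fam N D U) :
    Fam.restrict N D h (r • f) = resO Y h r • Fam.restrict N D h f := by
  funext k
  change res N (inf_le_inf_right (D k) h) (resInf D U k r • f k) =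
    resInf D V k (resO Y h r) • res N (inf_le_inf_right (D k) h) (f k)
  rw [res_smul, resInf, resInf, resO_resO, resO_resO]

/-- A subsheaf of the sheaf of families, given by submodules that are stable under restriction and
defined by a local condition. -/
structure FamSub where
  carrier : ∀ U : Y.Opens, Submodule Γ(Y, U) (Fam N D U)
  restrict_mem : ∀ {U V : Y.Opens} (h : V ≤ U) (f : Fam N D U), f ∈ carrier U →
    Fam.restrict N D h f ∈ carrier V
  mem_of_local : ∀ {ι : Type} {U : Y.Opens} (V : ι → Y.Opens) (hV : ∀ i, V i ≤ U), U ≤ ⨆ i, V i →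
    ∀ f : Fam N D U, (∀ i, Fam.restrict N D (hV i) f ∈ carrier (V i)) → f ∈ carrier U

variable {N D} (S : FamSub N D)

/-- The family of sections underlying an element of `S.carrier U`. -/
def FamSub.coe {U : Y.Opens} (f : S.carrier U) : Fam N D U := f.1

/-- Restriction of sections of the subsheaf. -/
def FamSub.restrict {U V : Y.Opens} (h : V ≤ U) : S.carrier U →+ S.carrier V where
  toFun f := ⟨Fam.restrict N D h f.1, S.restrict_mem h f.1 f.2⟩
  map_zero' := Subtype.ext (map_zero _)
  map_add' f g := Subtype.ext (map_add _ f.1 g.1)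

/-- The underlying presheaf of abelian groups. -/
def FamSub.presheaf : Y.Opensᵒᵖ ⥤ Ab.{0} where
  obj U := AddCommGrpCat.of (S.carrier U.unop)
  map {U V} i := AddCommGrpCat.ofHom (S.restrict (leOfHom i.unop))
  map_id U := by
    ext f : 2
    apply Subtype.ext
    funext k
    exact res_self N _ _
  map_comp i j := by
    ext f : 2
    apply Subtype.ext
    funext k
    exact (res_res N _ _ _).symm

instance (U : Y.Opensᵒᵖ) : Module (Y.ringCatSheaf.obj.obj U) (S.presheaf.obj U) :=
  inferInstanceAs (Module Γ(Y, U.unop) (S.carrier U.unop))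

lemma FamSub.presheaf_map_apply {U V : Y.Opensᵒᵖ} (i : U ⟶ V) (f : S.presheaf.obj U) (k : κ) :
    S.coe (U := V.unop) (S.presheaf.map i f) k =
      res N (inf_le_inf_right (D k) (leOfHom i.unop)) (S.coe (U := U.unop) f k) :=
  rfl

lemma FamSub.isSheaf : TopCat.Presheaf.IsSheaf (X := Y) S.presheaf := by
  refine (TopCat.Presheaf.isSheaf_iff_isSheafUniqueGluing _).2 fun ι U sf hsf => ?_
  have hc : ∀ k, (iSup U) ⊓ D k ≤ ⨆ i, U i ⊓ D k := fun k => (iSup_inf_eq U (D k)).le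
  have hle : ∀ i, U i ≤ iSup U := le_iSup U
  have key : ∀ k, ∃ t : Γ(N, iSup U ⊓ D k), ∀ i, res N (inf_le_inf_right (D k) (hle i)) t =
      S.coe (U := U i) (sf i) k := by
    intro k
    refine res_glue N (fun i => U i ⊓ D k) _ (hc k) _ fun i j => ?_
    have h := congrArg (fun f => S.coe (U := U i ⊓ U j) f k) (hsf i j)
    have h2 := congrArg (res N (show (U i ⊓ D k) ⊓ (U j ⊓ D k) ≤ (U i ⊓ U j) ⊓ D k from
      le_inf (inf_le_inf inf_le_left inf_le_left) (inf_le_left.trans inf_le_right))) h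
    refine Eq.trans ?_ (h2.trans ?_)
    · exact (res_res N _ _ _).symm
    · exact res_res N _ _ _
  choose t ht using key
  have hmem : (show Fam N D (iSup U) from t) ∈ S.carrier (iSup U) := by
    refine S.mem_of_local U hle le_rfl _ fun i => ?_
    have : Fam.restrict N D (hle i) t = S.coe (U := U i) (sf i) := by
      funext k; exact ht k i
    rw [this]
    exact Subtype.property (p := fun f => f ∈ S.carrier (U i)) (sf i)
  refine ⟨(⟨t, hmem⟩ : S.carrier (iSup U)), fun i => ?_, fun g hg => ?_⟩
  · apply Subtype.ext
    funext k
    exact ht k i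
  · apply Subtype.ext
    funext k
    refine res_ext N (fun i => U i ⊓ D k) (fun i => inf_le_inf_right _ (hle i)) (hc k) _ _ fun i => ?_
    refine Eq.trans ?_ (ht k i).symm
    exact congrArg (fun f => S.coe (U := U i) f k) (hg i)

/-- The `𝒪_Y`-module whose sections over `U` are the families in `S.carrier U`. -/
def FamSub.toModules : Y.Modules :=
  (⟨PresheafOfModules.ofPresheaf S.presheaf (fun {U V} i r f => by
    apply Subtype.ext
    exact Fam.restrict_smul N D (leOfHom i.unop) (r : Γ(Y, U.unop)) (S.coe (U := U.unop) f)),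
    S.isSheaf⟩ : SheafOfModules Y.ringCatSheaf)

/-- A morphism between two such modules, given by compatible linear maps on sections. -/
def FamSub.homMk {N' : Y.Modules} {κ' : Type} {D' : κ' → Y.Opens} (S : FamSub N D)
    (S' : FamSub N' D') (F : ∀ U, S.carrier U →ₗ[Γ(Y, U)] S'.carrier U)
    (hF : ∀ {U V : Y.Opens} (h : V ≤ U) (f : S.carrier U),
      F V (S.restrict h f) = S'.restrict h (F U f)) :
    S.toModules ⟶ S'.toModules :=
  (⟨PresheafOfModules.homMk
    { app := fun U => AddCommGrpCat.ofHom (F U.unop).toAddMonoidHom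
      naturality := fun U V i => by
        ext f
        exact hF (leOfHom i.unop) f }
    (fun U r f => (F U.unop).map_smul (r : Γ(Y, U.unop)) f)⟩ :
    SheafOfModules.Hom _ _)

/-- Sections of `S.toModules` are, by definition, the elements of `S.carrier`. -/
def FamSub.ofSection {U : Y.Opens} (s : Γ(S.toModules, U)) : Fam N D U := S.coe (U := U) s

end Operators

section InternalHom
variable {Y : Scheme.{0}} (M N : Y.Modules)

/-- The condition that a family of maps `f V : M(V) → N(U ∩ V)` is a morphism `M|_U → N|_U`. -/
structure IsHomFam (U : Y.Opens) (f : ∀ V : Y.Opens, Γ(M, V) → Γ(N, U ⊓ V)) : Prop where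
  add : ∀ V (m m' : Γ(M, V)), f V (m + m') = f V m + f V m'
  smul : ∀ V (r : Γ(Y, V)) (m : Γ(M, V)), f V (r • m) = resO Y (inf_le_right : U ⊓ V ≤ V) r • f V m
  res : ∀ {V V' : Y.Opens} (h : V' ≤ V) (m : Γ(M, V)),
    f V' (res M h m) = res N (inf_le_inf_left U h) (f V m)

namespace IsHomFam
variable {M N} {U : Y.Opens} {f g : ∀ V : Y.Opens, Γ(M, V) → Γ(N, U ⊓ V)}

lemma zero : IsHomFam M N U (fun _ _ => 0) :=
  ⟨fun _ _ _ => (add_zero _).symm, fun _ _ _ => (smul_zero _).symm, fun _ _ => (map_zero _).symm⟩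

lemma add_fam (hf : IsHomFam M N U f) (hg : IsHomFam M N U g) :
    IsHomFam M N U (fun V m => f V m + g V m) where
  add V m m' := by rw [hf.add, hg.add, add_add_add_comm]
  smul V r m := by rw [hf.smul, hg.smul, smul_add]
  res h m := by rw [hf.res, hg.res, map_add]

lemma smul_fam (c : Γ(Y, U)) (hf : IsHomFam M N U f) :
    IsHomFam M N U (fun V m => resO Y (inf_le_left : U ⊓ V ≤ U) c • f V m) where
  add V m m' := by rw [hf.add, smul_add]
  smul V r m := by rw [hf.smul, smul_comm]
  res h m := by rw [hf.res, res_smul, resO_resO]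

lemma restrict_fam {U' : Y.Opens} (h : U' ≤ U) (hf : IsHomFam M N U f) :
    IsHomFam M N U' (fun V m => SUSY.res N (inf_le_inf_right V h) (f V m)) where
  add V m m' := by rw [hf.add, map_add]
  smul V r m := by rw [hf.smul, res_smul, resO_resO]
  res h m := by rw [hf.res, res_res, res_res]

lemma of_local {ι : Type} (W : ι → Y.Opens) (hW : ∀ i, W i ≤ U) (hc : U ≤ ⨆ i, W i)
    (hf : ∀ i, IsHomFam M N (W i)
      (fun V m => SUSY.res N (inf_le_inf_right V (hW i)) (f V m))) : IsHomFam M N U f :=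
  have hc' : ∀ V : Y.Opens, U ⊓ V ≤ ⨆ i, W i ⊓ V := fun V =>
    (inf_le_inf_right V hc).trans (iSup_inf_eq W V).le
  { add := fun V m m' => by
      refine res_ext N (fun i => W i ⊓ V) (fun i => inf_le_inf_right V (hW i)) (hc' V) _ _ fun i => ?_
      rw [(hf i).add, map_add]
    smul := fun V r m => by
      refine res_ext N (fun i => W i ⊓ V) (fun i => inf_le_inf_right V (hW i)) (hc' V) _ _ fun i => ?_
      rw [(hf i).smul, res_smul, resO_resO]
    res := fun {V V'} h m => by
      refine res_ext N (fun i => W i ⊓ V') (fun i => inf_le_inf_right V' (hW i)) (hc' V') _ _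
        fun i => ?_
      rw [(hf i).res, res_res, res_res] }

end IsHomFam

/-- The sheaf of homomorphisms from `M` to `N`, as a sheaf of families indexed by the sections of
`M` over all open subsets. -/
def homFam : FamSub N (fun k : (Σ V : Y.Opens, Γ(M, V)) => k.1) where
  carrier U :=
    { carrier := {f | IsHomFam M N U (fun V m => f ⟨V, m⟩)}
      zero_mem' := IsHomFam.zero
      add_mem' := fun hf hg => IsHomFam.add_fam hf hg
      smul_mem' := fun c _ hf => IsHomFam.smul_fam c hf }
  restrict_mem h _ hf := IsHomFam.restrict_fam h hf
  mem_of_local W hW hc _ hf := IsHomFam.of_local W hW hc hf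

/-- The internal Hom `ℋom(M, N)` of two `𝒪_Y`-modules. -/
def internalHom : Y.Modules := (homFam M N).toModules

/-- The morphism `ℋom(M, N) ⟶ ℋom(M, N')` given by composition with `N ⟶ N'`. -/
def internalHomMap (M : Y.Modules) {N N' : Y.Modules} (φ : N ⟶ N') :
    internalHom M N ⟶ internalHom M N' :=
  FamSub.homMk (homFam M N) (homFam M N')
    (fun U =>
      { toFun := fun f => ⟨fun k => φ.app (U ⊓ k.1) (f.1 k),
          { add := fun V m m' => by
              refine (congrArg (φ.app (U ⊓ V)) (f.2.add V m m')).trans ?_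
              exact map_add _ _ _
            smul := fun V r m => by
              refine (congrArg (φ.app (U ⊓ V)) (f.2.smul V r m)).trans ?_
              exact φ.app_smul _ _
            res := fun {V V'} h m => by
              refine (congrArg (φ.app (U ⊓ V')) (f.2.res h m)).trans ?_
              exact ConcreteCategory.congr_hom
                (φ.mapPresheaf.naturality (homOfLE (inf_le_inf_left U h)).op) (f.1 ⟨V, m⟩) }⟩
        map_add' := fun f g => Subtype.ext (by funext k; exact map_add _ _ _)
        map_smul' := fun r f => Subtype.ext (by funext k; exact φ.app_smul _ _) })
    (fun {U V} h f => Subtype.ext (by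
      funext k
      exact ConcreteCategory.congr_hom
        (φ.mapPresheaf.naturality (homOfLE (inf_le_inf_right k.1 h)).op) (f.1 k)))

end InternalHom

section Derivations
variable {Y X S : Scheme.{0}} (g : Y ⟶ X) (x : X ⟶ S) (N : Y.Modules)

/-- The condition that a family of maps `d W : 𝒪_X(W) → N(U ∩ g⁻¹ W)` is a derivation
`g⁻¹ 𝒪_X → N` on `U` which vanishes on functions coming from `S`. -/
structure IsDerFam (U : Y.Opens) (d : ∀ W : X.Opens, Γ(X, W) → Γ(N, U ⊓ g ⁻¹ᵁ W)) : Prop where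
  add : ∀ W (a a' : Γ(X, W)), d W (a + a') = d W a + d W a'
  leibniz : ∀ W (a a' : Γ(X, W)), d W (a * a') =
    resO Y (inf_le_right : U ⊓ g ⁻¹ᵁ W ≤ g ⁻¹ᵁ W) (g.app W a) • d W a' +
      resO Y (inf_le_right : U ⊓ g ⁻¹ᵁ W ≤ g ⁻¹ᵁ W) (g.app W a') • d W a
  res : ∀ {W W' : X.Opens} (h : W' ≤ W) (a : Γ(X, W)),
    d W' (resO X h a) = res N (inf_le_inf_left U (g.preimage_mono h)) (d W a)
  const : ∀ (Z : S.Opens) (a : Γ(S, Z)), d (x ⁻¹ᵁ Z) (x.app Z a) = 0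

lemma resO_app {U V : X.Opens} (h : V ≤ U) (a : Γ(X, U)) :
    g.app V (resO X h a) = resO Y (g.preimage_mono h) (g.app U a) :=
  ConcreteCategory.congr_hom (g.naturality (homOfLE h).op) a

namespace IsDerFam
variable {g x N} {U : Y.Opens} {d e : ∀ W : X.Opens, Γ(X, W) → Γ(N, U ⊓ g ⁻¹ᵁ W)}

lemma zero : IsDerFam g x N U (fun _ _ => 0) :=
  ⟨fun _ _ _ => (add_zero _).symm, fun _ _ _ => by rw [smul_zero, smul_zero, add_zero],
    fun _ _ => (map_zero _).symm, fun _ _ => rfl⟩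

lemma add_fam (hd : IsDerFam g x N U d) (he : IsDerFam g x N U e) :
    IsDerFam g x N U (fun W a => d W a + e W a) where
  add W a a' := by rw [hd.add, he.add, add_add_add_comm]
  leibniz W a a' := by rw [hd.leibniz, he.leibniz, smul_add, smul_add, add_add_add_comm]
  res h a := by rw [hd.res, he.res, map_add]
  const Z a := by rw [hd.const, he.const, add_zero]

lemma smul_fam (c : Γ(Y, U)) (hd : IsDerFam g x N U d) :
    IsDerFam g x N U (fun W a => resO Y (inf_le_left : U ⊓ g ⁻¹ᵁ W ≤ U) c • d W a) where
  add W a a' := by rw [hd.add, smul_add]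
  leibniz W a a' := by
    rw [hd.leibniz, smul_add, smul_comm, smul_comm (resO Y _ c) (resO Y _ (g.app W a'))]
  res h a := by rw [hd.res, res_smul, resO_resO]
  const Z a := by rw [hd.const, smul_zero]

lemma restrict_fam {U' : Y.Opens} (h : U' ≤ U) (hd : IsDerFam g x N U d) :
    IsDerFam g x N U' (fun W a => SUSY.res N (inf_le_inf_right (g ⁻¹ᵁ W) h) (d W a)) where
  add W a a' := by rw [hd.add, map_add]
  leibniz W a a' := by rw [hd.leibniz, map_add, res_smul, res_smul, resO_resO, resO_resO]
  res h a := by rw [hd.res, res_res, res_res]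
  const Z a := by rw [hd.const, map_zero]

lemma of_local {ι : Type} (V : ι → Y.Opens) (hV : ∀ i, V i ≤ U) (hc : U ≤ ⨆ i, V i)
    (hd : ∀ i, IsDerFam g x N (V i)
      (fun W a => SUSY.res N (inf_le_inf_right (g ⁻¹ᵁ W) (hV i)) (d W a))) :
    IsDerFam g x N U d :=
  have hc' : ∀ W : Y.Opens, U ⊓ W ≤ ⨆ i, V i ⊓ W := fun W =>
    (inf_le_inf_right W hc).trans (iSup_inf_eq V W).le
  { add := fun W a a' => by
      refine res_ext N _ (fun i => inf_le_inf_right (g ⁻¹ᵁ W) (hV i)) (hc' _) _ _ fun i => ?_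
      rw [(hd i).add, map_add]
    leibniz := fun W a a' => by
      refine res_ext N _ (fun i => inf_le_inf_right (g ⁻¹ᵁ W) (hV i)) (hc' _) _ _ fun i => ?_
      rw [(hd i).leibniz, map_add, res_smul, res_smul, resO_resO, resO_resO]
    res := fun {W W'} h a => by
      refine res_ext N _ (fun i => inf_le_inf_right (g ⁻¹ᵁ W') (hV i)) (hc' _) _ _ fun i => ?_
      rw [(hd i).res, res_res, res_res]
    const := fun Z a => by
      refine res_ext N _ (fun i => inf_le_inf_right (g ⁻¹ᵁ (x ⁻¹ᵁ Z)) (hV i)) (hc' _) _ _ fun i => ?_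
      rw [(hd i).const, map_zero] }

end IsDerFam

/-- The sheaf of derivations `g⁻¹ 𝒪_X → N` over `S`, as a sheaf of families indexed by the functions
on all open subsets of `X`. -/
def derFam : FamSub N (fun k : (Σ W : X.Opens, Γ(X, W)) => g ⁻¹ᵁ k.1) where
  carrier U :=
    { carrier := {d | IsDerFam g x N U (fun W a => d ⟨W, a⟩)}
      zero_mem' := IsDerFam.zero
      add_mem' := fun hf hg => IsDerFam.add_fam hf hg
      smul_mem' := fun c _ hf => IsDerFam.smul_fam c hf }
  restrict_mem h _ hf := IsDerFam.restrict_fam h hf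
  mem_of_local W hW hc _ hf := IsDerFam.of_local W hW hc hf

/-- The structure sheaf as a module over itself. -/
def structureModule (Y : Scheme.{0}) : Y.Modules := SheafOfModules.unit Y.ringCatSheaf

/-- For `g : Y ⟶ X` and `X` over `S`, the `𝒪_Y`-module `Der_S(g⁻¹ 𝒪_X, 𝒪_Y) = ℋom(g^* Ω_{X/S}, 𝒪_Y)`
of vector fields along `g`. If `X` is smooth over `S`, then `Ω_{X/S}` is locally free of finite rank
and this is the pullback `g^* T_{X/S}` of the tangent bundle. -/
def tangentAlong : Y.Modules := (derFam g x (structureModule Y)).toModules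

/-- The relative tangent sheaf `T_{Y/S} = Der_S(𝒪_Y, 𝒪_Y)`. -/
def tangentSheaf (y : Y ⟶ S) : Y.Modules := tangentAlong (𝟙 Y) y

lemma IsDerFam.comp {N : Y.Modules} {B : Scheme.{0}} {y : Y ⟶ B} {U : Y.Opens}
    {d : ∀ W : Y.Opens, Γ(Y, W) → Γ(N, U ⊓ W)} (hd : IsDerFam (𝟙 Y) y N U d) (b : B ⟶ S)
    (h : g ≫ x = y ≫ b) : IsDerFam g x N U (fun W a => d (g ⁻¹ᵁ W) (g.app W a)) where
  add W a a' := by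
    rw [map_add]
    exact hd.add _ _ _
  leibniz W a a' := by
    rw [map_mul, hd.leibniz]
    rfl
  res {W W'} hW a := by
    rw [resO_app]
    exact hd.res (g.preimage_mono hW) (g.app W a)
  const Z a := by
    have hle : g ⁻¹ᵁ (x ⁻¹ᵁ Z) ≤ y ⁻¹ᵁ (b ⁻¹ᵁ Z) := by
      rw [← Scheme.Hom.comp_preimage, h, Scheme.Hom.comp_preimage]
    have e : g.app (x ⁻¹ᵁ Z) (x.app Z a) = resO Y hle (y.app (b ⁻¹ᵁ Z) (b.app Z a)) := by
      have h1 := ConcreteCategory.congr_hom (Scheme.Hom.congr_app h Z) a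
      rw [Scheme.Hom.comp_app, Scheme.Hom.comp_app] at h1
      exact h1
    rw [e]
    refine (hd.res hle (y.app (b ⁻¹ᵁ Z) (b.app Z a))).trans ?_
    refine (congrArg _ (hd.const (b ⁻¹ᵁ Z) (b.app Z a))).trans ?_
    exact map_zero _

/-- The differential `T_{Y/B} ⟶ g^* T_{X/S}` of a morphism `g : Y ⟶ X` that is compatible with
`b : B ⟶ S`; it sends a vector field `D` to the derivation `a ↦ D (g^♯ a)`. -/
def differential {B : Scheme.{0}} (y : Y ⟶ B) (b : B ⟶ S) (h : g ≫ x = y ≫ b) :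
    tangentSheaf y ⟶ tangentAlong g x :=
  FamSub.homMk (derFam (𝟙 Y) y (structureModule Y)) (derFam g x (structureModule Y))
    (fun _ =>
      { toFun := fun D => ⟨fun k => D.1 ⟨g ⁻¹ᵁ k.1, g.app k.1 k.2⟩, D.2.comp g x b h⟩
        map_add' := fun _ _ => rfl
        map_smul' := fun _ _ => rfl })
    (fun _ _ => rfl)

end Derivations

section Cohomology
variable {K : Type} [Field K] {Y : Scheme.{0}} (f : Y ⟶ Spec (CommRingCat.of K)) (M : Y.Modules)

/-- The abelian sheaf underlying an `𝒪_Y`-module. -/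
def abSheaf (M : Y.Modules) : Sheaf (Opens.grothendieckTopology Y) AddCommGrpCat.{0} :=
  ⟨M.presheaf, M.isSheaf⟩

/-- The constants on a scheme over a field. -/
def constants : K →+* Γ(Y, ⊤) :=
  ((Scheme.ΓSpecIso (CommRingCat.of K)).inv ≫ f.appTop).hom

/-- Multiplication by a global function, on the sections over `U`. -/
def mulSection (M : Y.Modules) (r : Γ(Y, ⊤)) (U : Y.Opens) : Γ(M, U) →+ Γ(M, U) where
  toFun m := resO Y (le_top : U ≤ ⊤) r • m
  map_zero' := smul_zero _
  map_add' := smul_add _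

/-- Multiplication by a global function, as an endomorphism of the underlying abelian sheaf. -/
def mulGlobal (M : Y.Modules) (r : Γ(Y, ⊤)) : abSheaf M ⟶ abSheaf M :=
  ⟨{ app := fun U => AddCommGrpCat.ofHom (mulSection M r U.unop)
     naturality := fun U V i => by
      ext m
      change resO Y (le_top : V.unop ≤ ⊤) r • res M (leOfHom i.unop) (show Γ(M, U.unop) from m) =
        res M (leOfHom i.unop) (resO Y (le_top : U.unop ≤ ⊤) r • (show Γ(M, U.unop) from m))
      rw [res_smul, resO_resO] }⟩

lemma mulGlobal_ext {r : Γ(Y, ⊤)} {φ : abSheaf M ⟶ abSheaf M}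
    (h : ∀ (U : Y.Opens) (m : Γ(M, U)),
      resO Y (le_top : U ≤ ⊤) r • m = (φ.hom.app (op U)).hom (show (abSheaf M).obj.obj (op U) from m)) :
    mulGlobal M r = φ := by
  apply CategoryTheory.Sheaf.hom_ext
  ext U m
  exact h U.unop m

/-- The action of global functions on sheaf cohomology. -/
def cohomologyAction (M : Y.Modules) (n : ℕ) : Γ(Y, ⊤) →+* AddMonoid.End (Sheaf.H (abSheaf M) n) where
  toFun r := Sheaf.H.map (mulGlobal M r) n
  map_one' := by
    have h : mulGlobal M 1 = 𝟙 _ := mulGlobal_ext M fun U m => by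
      rw [map_one, one_smul]; rfl
    ext a
    rw [h]
    exact Sheaf.H.map_id_apply a
  map_mul' r s := by
    have h : mulGlobal M (r * s) = mulGlobal M s ≫ mulGlobal M r := mulGlobal_ext M fun U m => by
      rw [map_mul, mul_smul]; rfl
    ext a
    rw [h]
    exact Sheaf.H.map_comp_apply _ _ a
  map_zero' := by
    have h : mulGlobal M 0 = mulGlobal M 0 + mulGlobal M 0 := mulGlobal_ext M fun U m => by
      change _ = resO Y (le_top : U ≤ ⊤) 0 • m + resO Y (le_top : U ≤ ⊤) 0 • m
      rw [map_zero, zero_smul, add_zero]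
    ext a
    have h1 := Sheaf.H.map_add_apply (mulGlobal M 0) (mulGlobal M 0) a
    rw [← h] at h1
    exact left_eq_add.1 h1
  map_add' r s := by
    have h : mulGlobal M (r + s) = mulGlobal M r + mulGlobal M s := mulGlobal_ext M fun U m => by
      rw [map_add, add_smul]; rfl
    ext a
    rw [h]
    exact Sheaf.H.map_add_apply _ _ a

/-- The dimension over `K` of the cohomology `Hⁿ(Y, M)` of a module on a scheme over `K`. -/
def cohomologyDim (n : ℕ) : ℕ :=
  letI : Module K (Sheaf.H (abSheaf M) n) :=
    Module.compHom _ ((cohomologyAction M n).comp (constants f))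
  Module.finrank K (Sheaf.H (abSheaf M) n)

/-- The Euler characteristic `dim H⁰ - dim H¹` of a module on a curve over `K`. -/
def eulerChar : ℤ := (cohomologyDim f M 0 : ℤ) - cohomologyDim f M 1

/-- The arithmetic genus `1 - χ(𝒪)` of a curve. -/
def arithmeticGenus : ℤ := 1 - eulerChar f (structureModule Y)

/-- The degree `χ(M) - χ(𝒪)` of a line bundle on a proper curve over `K`. -/
def degree : ℤ := eulerChar f M - eulerChar f (structureModule Y)

end Cohomology

section Curves

/-- A line bundle: an `𝒪_Y`-module which is locally isomorphic to `𝒪_Y`. -/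
def IsLineBundle {Y : Scheme.{0}} (M : Y.Modules) : Prop :=
  ∀ y : Y, ∃ U : Y.Opens, y ∈ U ∧ Nonempty (M.restrict U.ι ≅ structureModule (U : Scheme.{0}))

/-- A node of a curve over `K`: the completed local ring is `K⟦x, y⟧ / (x y)`. -/
def IsNode (K : Type) [Field K] {Y : Scheme.{0}} (y : Y) : Prop :=
  Nonempty (AdicCompletion (IsLocalRing.maximalIdeal (Y.presheaf.stalk y)) (Y.presheaf.stalk y) ≃+*
    MvPowerSeries (Fin 2) K ⧸
      Ideal.span {(MvPowerSeries.X 0 * MvPowerSeries.X 1 : MvPowerSeries (Fin 2) K)})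

/-- A connected reduced one-dimensional scheme over `K` of arithmetic genus zero, whose
singularities are nodes. -/
structure IsNodalCurve {K : Type} [Field K] {Y : Scheme.{0}} (f : Y ⟶ Spec (CommRingCat.of K))
    [LocallyOfFinitePresentation f] : Prop where
  reduced : IsReduced Y
  connected : ConnectedSpace Y
  one_dimensional : SmoothOfRelativeDimension 1 (f.smoothLocus.ι ≫ f)
  node : ∀ y : Y, y ∉ f.smoothLocus → IsNode K y
  genus_zero : arithmeticGenus f = 0

/-- A prestable curve of genus zero: a flat and proper morphism whose geometric fibres are connected
nodal curves of arithmetic genus zero. -/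
class IsPrestable {C B : Scheme.{0}} (c : C ⟶ B) : Prop extends
    Flat c, IsProper c, LocallyOfFinitePresentation c where
  geometric_fibre : ∀ (K : Type) [Field K] [IsAlgClosed K] (s : Spec (CommRingCat.of K) ⟶ B),
    IsNodalCurve (pullback.snd c s)

/-- The point of the geometric fibre `C_s` that is cut out by a section `p` of `c`. -/
def fibrePoint {C B : Scheme.{0}} {c : C ⟶ B} {p : B ⟶ C} (hp : p ≫ c = 𝟙 B)
    {K : Type} [Field K] (s : Spec (CommRingCat.of K) ⟶ B) : ↥(pullback c s) :=
  (pullback.lift (s ≫ p) (𝟙 _) (by simp [hp]) : Spec (CommRingCat.of K) ⟶ pullback c s)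
    (IsLocalRing.closedPoint K)

/-- A prestable spin curve of genus zero over `B`, together with sections `tail t` and `node e`.

The spinor bundle is given as follows. `ν : Cn ⟶ C` is the normalization relative to `B` (a finite
morphism from a smooth family, which is an isomorphism over the smooth locus of `C`), and `L` is a
line bundle on `Cn` with an isomorphism `L = ℋom(L, T_{Cn/B})`, that is, `L ⊗ L = T_{Cn/B}`. The
spinor bundle is `S_C = ν_* L`, and its dual is `ν_* (L^∨)`. -/
structure SpinCurve (B : Scheme.{0}) (T E : Type) where
  C : Scheme.{0}
  c : C ⟶ B
  prestable : IsPrestable c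
  tail : T → (B ⟶ C)
  tail_section : ∀ t, tail t ≫ c = 𝟙 B
  node : E → (B ⟶ C)
  node_section : ∀ e, node e ≫ c = 𝟙 B
  Cn : Scheme.{0}
  ν : Cn ⟶ C
  finite_ν : IsFinite ν
  smooth_ν : SmoothOfRelativeDimension 1 (ν ≫ c)
  iso_ν : IsIso (ν ∣_ c.smoothLocus)
  L : Cn.Modules
  isLineBundle : IsLineBundle L
  spin : L ≅ internalHom L (tangentSheaf (ν ≫ c))

attribute [instance] SpinCurve.prestable

end Curves

section Trees

/-- A finite tree with set of vertices `V`, set of edges `E` and set of tails `T`; the tail `t` is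
attached to the vertex `root t`. -/
structure MarkedTree where
  V : Type
  E : Type
  T : Type
  [finite_V : Finite V]
  [finite_E : Finite E]
  [finite_T : Finite T]
  ends : E → Sym2 V
  root : T → V
  connected : (SimpleGraph.fromRel fun v w => ∃ e, ends e = s(v, w)).Connected
  card_V : Nat.card V = Nat.card E + 1

attribute [instance] MarkedTree.finite_V MarkedTree.finite_E MarkedTree.finite_T

/-- The number of flags (tails and edges) at a vertex. -/
def MarkedTree.valence (τ : MarkedTree) (v : τ.V) : ℕ :=
  Nat.card {t : τ.T // τ.root t = v} + Nat.card {e : τ.E // v ∈ τ.ends e}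

/-- The tree obtained by grafting: the tails `t₁` and `t₂` are joined to a new edge. -/
def MarkedTree.graft (τ₁ : MarkedTree) (t₁ : τ₁.T) (τ₂ : MarkedTree) (t₂ : τ₂.T) : MarkedTree where
  V := τ₁.V ⊕ τ₂.V
  E := (τ₁.E ⊕ τ₂.E) ⊕ Unit
  T := {t : τ₁.T // t ≠ t₁} ⊕ {t : τ₂.T // t ≠ t₂}
  ends := Sum.elim (Sum.elim (fun e => (τ₁.ends e).map Sum.inl) (fun e => (τ₂.ends e).map Sum.inr))
    (fun _ => s(Sum.inl (τ₁.root t₁), Sum.inr (τ₂.root t₂)))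
  root := Sum.elim (fun t => Sum.inl (τ₁.root t)) (fun t => Sum.inr (τ₂.root t))
  connected := by
    set G := SimpleGraph.fromRel fun v w : τ₁.V ⊕ τ₂.V => ∃ e, Sum.elim
      (Sum.elim (fun e => (τ₁.ends e).map Sum.inl) (fun e => (τ₂.ends e).map Sum.inr))
      (fun _ : Unit => s(Sum.inl (τ₁.root t₁), Sum.inr (τ₂.root t₂))) e = s(v, w) with hG
    let f₁ : (SimpleGraph.fromRel fun v w => ∃ e, τ₁.ends e = s(v, w)) →g G :=
      { toFun := Sum.inl
        map_rel' := by
          rintro v w ⟨hne, h⟩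
          refine ⟨fun h' => hne (Sum.inl_injective h'), ?_⟩
          rcases h with ⟨e, he⟩ | ⟨e, he⟩
          · exact Or.inl ⟨Sum.inl (Sum.inl e), by simp [he]⟩
          · exact Or.inr ⟨Sum.inl (Sum.inl e), by simp [he]⟩ }
    let f₂ : (SimpleGraph.fromRel fun v w => ∃ e, τ₂.ends e = s(v, w)) →g G :=
      { toFun := Sum.inr
        map_rel' := by
          rintro v w ⟨hne, h⟩
          refine ⟨fun h' => hne (Sum.inr_injective h'), ?_⟩
          rcases h with ⟨e, he⟩ | ⟨e, he⟩
          · exact Or.inl ⟨Sum.inl (Sum.inr e), by simp [he]⟩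
          · exact Or.inr ⟨Sum.inl (Sum.inr e), by simp [he]⟩ }
    have key : ∀ z, G.Reachable z (Sum.inl (τ₁.root t₁)) := by
      rintro (v | v)
      · exact (τ₁.connected.preconnected v (τ₁.root t₁)).map f₁
      · refine ((τ₂.connected.preconnected v (τ₂.root t₂)).map f₂).trans ?_
        refine SimpleGraph.Adj.reachable ⟨by rintro ⟨⟩, Or.inr ⟨Sum.inr (), rfl⟩⟩
    have : Nonempty (τ₁.V ⊕ τ₂.V) := ⟨Sum.inl (τ₁.root t₁)⟩
    exact SimpleGraph.Connected.mk fun z z' => (key z).trans (key z').symm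
  card_V := by
    have h : Nat.card Unit = 1 := Nat.card_unique
    rw [Nat.card_sum, Nat.card_sum, Nat.card_sum, τ₁.card_V, τ₂.card_V, h]
    omega


/-- A stable tree: at least three flags at every vertex. -/
def MarkedTree.IsStable (τ : MarkedTree) : Prop := ∀ v, 3 ≤ τ.valence v

/-- The tree `τ` is the dual tree of the geometric fibre of `D` at `s`, where the vertices correspond
to the irreducible components via `Φ`, the edges to the nodes, and the tails to the marked points
(distinct points of the smooth locus). -/
structure IsDualTree {B : Scheme.{0}} (τ : MarkedTree) (D : SpinCurve B τ.T τ.E) {K : Type} [Field K]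
    (s : Spec (CommRingCat.of K) ⟶ B)
    (Φ : τ.V ≃ irreducibleComponents ↥(pullback D.c s)) : Prop where
  tail_smooth : ∀ t, fibrePoint (D.tail_section t) s ∈ (pullback.snd D.c s).smoothLocus
  tail_injective : Function.Injective fun t => fibrePoint (D.tail_section t) s
  node_injective : Function.Injective fun e => fibrePoint (D.node_section e) s
  node_range : ∀ z : ↥(pullback D.c s), z ∉ (pullback.snd D.c s).smoothLocus ↔
    ∃ e, fibrePoint (D.node_section e) s = z
  tail_mem : ∀ t v, fibrePoint (D.tail_section t) s ∈ (Φ v : Set ↥(pullback D.c s)) ↔ τ.root t = v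
  node_mem : ∀ e v, fibrePoint (D.node_section e) s ∈ (Φ v : Set ↥(pullback D.c s)) ↔ v ∈ τ.ends e

/-- A stable spin curve of constant tree type `τ`: the tree `τ` is stable and every geometric fibre
has dual tree `τ`. -/
def SpinCurve.IsStableOfType {B : Scheme.{0}} {τ : MarkedTree} (D : SpinCurve B τ.T τ.E) : Prop :=
  τ.IsStable ∧ ∀ (K : Type) [Field K] [IsAlgClosed K] (s : Spec (CommRingCat.of K) ⟶ B),
    ∃ Φ : τ.V ≃ irreducibleComponents ↥(pullback D.c s), IsDualTree τ D s Φ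

end Trees

section SpinMaps

/-- The classes of curves in `X`: a class is given by its intersection numbers with line bundles. -/
def CurveClass (X : Scheme.{0}) : Type 1 := {M : X.Modules // IsLineBundle M} → ℤ

instance (X : Scheme.{0}) : Zero (CurveClass X) := ⟨fun _ => 0⟩

/-- For a scheme `Y` over `K` with a morphism `ψ : Y ⟶ X` and a closed subset `Z` of `Y`, which is
considered as a reduced closed subscheme, `ψ_* [Z] = β`. -/
def HasClass {K : Type} [Field K] {X Y : Scheme.{0}} (f : Y ⟶ Spec (CommRingCat.of K)) (ψ : Y ⟶ X)
    (Z : Set Y) (β : CurveClass X) : Prop :=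
  ∃ (Z' : Scheme.{0}) (ι : Z' ⟶ Y), IsReduced Z' ∧ IsClosedImmersion ι ∧ Set.range ι = Z ∧
    ∀ M, degree (ι ≫ f) ((Scheme.Modules.pullback (ι ≫ ψ)).obj M.1) = β M

/-- A prestable spin curve over `B` with a morphism to `X`; all schemes live over `S`. -/
structure SpinMap {B X S : Scheme.{0}} (b : B ⟶ S) (x : X ⟶ S) (T E : Type) extends
    SpinCurve B T E where
  φ : C ⟶ X
  φ_comp : φ ≫ x = c ≫ b

/-- A stable spin map of constant tree type `(τ, β)`: there are at least three flags at every vertex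
of class zero, and every geometric fibre has dual tree `τ` and components of classes `β v`. -/
def SpinMap.IsStableOfType {B X S : Scheme.{0}} {b : B ⟶ S} {x : X ⟶ S} {τ : MarkedTree}
    (D : SpinMap b x τ.T τ.E) (β : τ.V → CurveClass X) : Prop :=
  (∀ v, β v = 0 → 3 ≤ τ.valence v) ∧
  ∀ (K : Type) [Field K] [IsAlgClosed K] (s : Spec (CommRingCat.of K) ⟶ B),
    ∃ Φ : τ.V ≃ irreducibleComponents ↥(pullback D.c s), IsDualTree τ D.toSpinCurve s Φ ∧
      ∀ v, HasClass (pullback.snd D.c s) (pullback.fst D.c s ≫ D.φ) (Φ v) (β v)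

attribute [local instance] MvPolynomial.gradedAlgebra in
/-- A smooth projective scheme over `ℂ`. -/
structure IsSmoothProjective {X : Scheme.{0}} (x : X ⟶ Spec (CommRingCat.of ℂ)) : Prop where
  smooth : Smooth x
  projective : ∃ (n : ℕ)
    (i : X ⟶ Proj (MvPolynomial.homogeneousSubmodule (Fin (n + 1)) ℂ)), IsClosedImmersion i ∧
      i ≫ Proj.toSpecZero (MvPolynomial.homogeneousSubmodule (Fin (n + 1)) ℂ) ≫
        Spec.map (CommRingCat.ofHom
          (algebraMap ℂ (MvPolynomial.homogeneousSubmodule (Fin (n + 1)) ℂ 0))) = x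

end SpinMaps

section NormalBundle

instance (X : Scheme.{0}) : HasFiniteBiproducts X.Modules := Abelian.hasFiniteBiproducts

/-- Restriction along a section: the morphism `c_* M ⟶ p^* M`, `s ↦ p^* s`. -/
def restrictTo {B C : Scheme.{0}} {c : C ⟶ B} {p : B ⟶ C} (hp : p ≫ c = 𝟙 B) (M : C.Modules) :
    (Scheme.Modules.pushforward c).obj M ⟶ (Scheme.Modules.pullback p).obj M :=
  (Scheme.Modules.pushforward c).map ((Scheme.Modules.pullbackPushforwardAdjunction p).unit.app M) ≫
    (Scheme.Modules.pushforwardComp p c).hom.app _ ≫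
    (Scheme.Modules.pushforwardCongr hp).hom.app _ ≫ (Scheme.Modules.pushforwardId B).hom.app _

variable {B : Scheme.{0}} {T E : Type} [Finite T] [Finite E]

/-- The spinor bundle `S_C`. -/
def SpinCurve.spinorBundle {T E : Type} (D : SpinCurve B T E) : D.C.Modules :=
  (Scheme.Modules.pushforward D.ν).obj D.L

/-- The sum of the `p_t^* S_C` over the tails and of the `p_e^* S_C` over the edges. -/
def SpinCurve.specialFibres (D : SpinCurve B T E) : B.Modules :=
  (⨁ fun t => (Scheme.Modules.pullback (D.tail t)).obj D.spinorBundle) ⊞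
    (⨁ fun e => (Scheme.Modules.pullback (D.node e)).obj D.spinorBundle)

/-- The morphism `s ↦ (p_t^* s, p_e^* s)`. -/
def SpinCurve.evaluate (D : SpinCurve B T E) :
    (Scheme.Modules.pushforward D.c).obj D.spinorBundle ⟶ D.specialFibres :=
  biprod.lift (biproduct.lift fun t => restrictTo (D.tail_section t) D.spinorBundle)
    (biproduct.lift fun e => restrictTo (D.node_section e) D.spinorBundle)

/-- The SUSY normal bundle `N_C`. -/
def SpinCurve.normalBundle (D : SpinCurve B T E) : B.Modules := cokernel D.evaluate

variable {X S : Scheme.{0}} {b : B ⟶ S} {x : X ⟶ S}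

lemma SpinMap.φ_comp' {T E : Type} (D : SpinMap b x T E) : (D.ν ≫ D.φ) ≫ x = (D.ν ≫ D.c) ≫ b := by
  rw [Category.assoc, D.φ_comp, Category.assoc]

/-- The module `S_C^∨ ⊗ φ^* T_X = ν_* ℋom(L, (φ ∘ ν)^* T_X)`. -/
def SpinMap.twistedTangent {T E : Type} (D : SpinMap b x T E) : D.C.Modules :=
  (Scheme.Modules.pushforward D.ν).obj (internalHom D.L (tangentAlong (D.ν ≫ D.φ) x))

/-- The morphism `S_C ⟶ S_C^∨ ⊗ φ^* T_X`, `s ↦ ⟨s, dφ⟩`. It sends a section `s` of `L` to the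
homomorphism `s' ↦ dφ(s ⊗ s')`, where `s ⊗ s'` is a vector field by `L ⊗ L = T_{Cn/B}`. -/
def SpinMap.contract {T E : Type} (D : SpinMap b x T E) :
    D.spinorBundle ⟶ D.twistedTangent :=
  (Scheme.Modules.pushforward D.ν).map
    (D.spin.hom ≫ internalHomMap D.L (differential (D.ν ≫ D.φ) x (D.ν ≫ D.c) b D.φ_comp'))

/-- The SUSY normal bundle `N_{(C, φ)}`. -/
def SpinMap.normalBundle (D : SpinMap b x T E) : B.Modules :=
  cokernel (biprod.lift D.evaluate (-(Scheme.Modules.pushforward D.c).map D.contract))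

end NormalBundle

section Gluing
variable {B : Scheme.{0}}

/-- The scheme `C` is glued from `C₁` and `C₂` along `p₁ : B ⟶ C₁` and `p₂ : B ⟶ C₂`: it is the union
of the closed subschemes `C₁` and `C₂`, which meet exactly in `B`, and a function on `C` is the same
as a pair of functions on `C₁` and `C₂` which agree on `B`. -/
structure IsGlued {C₁ C₂ C : Scheme.{0}} (p₁ : B ⟶ C₁) (p₂ : B ⟶ C₂) (i₁ : C₁ ⟶ C) (i₂ : C₂ ⟶ C) :
    Prop where
  closed₁ : IsClosedImmersion i₁
  closed₂ : IsClosedImmersion i₂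
  comm : p₁ ≫ i₁ = p₂ ≫ i₂
  cover : ∀ z : C, z ∈ Set.range i₁ ∨ z ∈ Set.range i₂
  meet : ∀ (y₁ : C₁) (y₂ : C₂), i₁ y₁ = i₂ y₂ → ∃ β : B, p₁ β = y₁ ∧ p₂ β = y₂
  functions : ∀ (U : C.Opens) (h : p₁ ⁻¹ᵁ (i₁ ⁻¹ᵁ U) ≤ p₂ ⁻¹ᵁ (i₂ ⁻¹ᵁ U))
    (f₁ : Γ(C₁, i₁ ⁻¹ᵁ U)) (f₂ : Γ(C₂, i₂ ⁻¹ᵁ U)),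
    p₁.app (i₁ ⁻¹ᵁ U) f₁ = resO B h (p₂.app (i₂ ⁻¹ᵁ U) f₂) →
      ∃! f : Γ(C, U), i₁.app U f = f₁ ∧ i₂.app U f = f₂

/-- For sections `s`, `s'` of `L`, the derivative of a function `a` along the vector field
`s ⊗ s'` given by the isomorphism `L ⊗ L = T_{Cn/B}`. -/
def SpinCurve.derivative {T E : Type} (D : SpinCurve B T E) {U : D.Cn.Opens} (s s' : Γ(D.L, U))
    (a : Γ(D.Cn, U)) : Γ(D.Cn, U) :=
  let q : Γ(tangentSheaf (D.ν ≫ D.c), U ⊓ U) :=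
    (homFam D.L (tangentSheaf (D.ν ≫ D.c))).ofSection (U := U) (D.spin.hom.app U s) ⟨U, s'⟩
  resO D.Cn (le_inf (le_inf le_rfl le_rfl) le_rfl : U ≤ (U ⊓ U) ⊓ U)
    ((derFam (𝟙 D.Cn) (D.ν ≫ D.c) (structureModule D.Cn)).ofSection (U := U ⊓ U) q ⟨U, a⟩)

/-- A compatible embedding of a spin curve `D'` as a union of components into a spin curve `D`. -/
structure SpinInclusion {T' E' T E : Type} (D' : SpinCurve B T' E') (D : SpinCurve B T E) where
  i : D'.C ⟶ D.C
  over_base : i ≫ D.c = D'.c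
  j : D'.Cn ⟶ D.Cn
  [isOpenImmersion : IsOpenImmersion j]
  comm : j ≫ D.ν = D'.ν ≫ i
  θ : D.L.restrict j ≅ D'.L
  spin_comm : ∀ (V : D'.Cn.Opens) (s s' : Γ(D.L.restrict j, V)) (a : Γ(D.Cn, j ''ᵁ V)),
    D'.derivative (θ.hom.app V s) (θ.hom.app V s') ((j.appIso V).hom a) =
      (j.appIso V).hom (D.derivative (U := j ''ᵁ V) s s' a)

attribute [instance] SpinInclusion.isOpenImmersion

/-- The spin curve `D` is obtained from `D₁` and `D₂` by gluing along the tails `t₁` and `t₂`. The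
normalization of `D` is the disjoint union of those of `D₁` and `D₂`, and the spinor bundle of `D`
restricts to the ones of `D₁` and `D₂`. -/
structure SpinGluing {T₁ E₁ T₂ E₂ : Type} (D₁ : SpinCurve B T₁ E₁) (t₁ : T₁) (D₂ : SpinCurve B T₂ E₂)
    (t₂ : T₂) (D : SpinCurve B ({t : T₁ // t ≠ t₁} ⊕ {t : T₂ // t ≠ t₂}) ((E₁ ⊕ E₂) ⊕ Unit)) where
  inc₁ : SpinInclusion D₁ D
  inc₂ : SpinInclusion D₂ D
  glued : IsGlued (D₁.tail t₁) (D₂.tail t₂) inc₁.i inc₂.i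
  disjoint : IsCompl inc₁.j.opensRange inc₂.j.opensRange
  tail₁ : ∀ t, D.tail (Sum.inl t) = D₁.tail t.1 ≫ inc₁.i
  tail₂ : ∀ t, D.tail (Sum.inr t) = D₂.tail t.1 ≫ inc₂.i
  node₁ : ∀ e, D.node (Sum.inl (Sum.inl e)) = D₁.node e ≫ inc₁.i
  node₂ : ∀ e, D.node (Sum.inl (Sum.inr e)) = D₂.node e ≫ inc₂.i
  node : D.node (Sum.inr ()) = D₁.tail t₁ ≫ inc₁.i

end Gluing
end SUSY
end

/-!
# SUSY normal bundles of glued stable spin curves and spin maps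

Let `C` be the union of closed subschemes `C₁` and `C₂` that meet in the section `p : B ⟶ C` given by
the tails `t₁` and `t₂`.

*The normal bundles.* The normalization of `C` is the disjoint union of those of `C₁` and `C₂`, so a
module on it is the direct sum of its restrictions. Pushing forward to `C` shows that `S_C` is the sum
of the `i_* S_{C_k}`, and `S_C^∨ ⊗ φ^* T_X` splits in the same way
(`SpinGluing.isIso_restrictSpinor`, `SpinInclusion.isRestriction_restrictHom`); contraction with `dφ`
respects the splitting (`SpinInclusion.contract_restrict`). For the fibres at the special points, two
facts on a closed immersion `i` are used. If `p = i ∘ p₁`, then `p^* i_* M = p₁^* M`, because `i_*` is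
fully faithful and so both sides represent the same functor (`isIso_pullbackPushforwardComparison`);
if `p` misses the image of `i`, then `p^* i_* M = 0` (`isZero_pullback_pushforward`). Hence a special
section of `C` which comes from one of the pieces sees only the spinor bundle of this piece, whereas
the fibre at the new node is the sum of the fibres at `t₁` and `t₂`, the two tails that are missing
in `C` (`SpinGluing.isProductOf_restrictPiece`). The morphism that defines the normal bundle is thus
the direct sum of those for `C₁` and `C₂`, and so is its cokernel. That the other special sections miss
the glued tails is checked on geometric points (`SpinCurve.avoids_of_isDualTree`).

*The fibres.* In a geometric fibre the pieces are closed and meet in the rational point cut out by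
`p`, and each piece is open away from this point; there it has the same smooth points as the fibre of
`C`. At a smooth rational point of a nodal curve the local ring is a domain but not a field:
differentials are free of rank one, which makes the maximal ideal principal and nonzero
(`IsNodalCurve.isDomain_and_not_isField_stalk`). It is not a field, so the point is not a component,
and the components of the fibre of `C` are those of the two pieces
(`exists_equiv_irreducibleComponents`). It is a domain, so a smooth point lies on only one component;
the new node lies on two, and so is not smooth. Hence the fibre has the grafted tree as its dual tree
(`SpinGluing.exists_isDualTree`), and grafting does not change the valence of a vertex, as the new
edge replaces the tail.

*The morphism.* Since functions on `C` are pairs of functions on `C₁` and `C₂` which agree on `B`, and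
`C` carries the quotient topology, morphisms out of `C` are pairs of morphisms that agree on `B`
(`IsGlued.existsUnique_hom`).
-/

noncomputable section

namespace SUSY

/-! ### Products and cokernels in abelian categories -/

section Category

universe v u
variable {𝒞 : Type u} [Category.{v} 𝒞]

/-- The object `P` with the projections `π i` is a product of the objects `A i`. No choice of a limit
cone is involved, so that index types may be partitioned without transport along equalities. -/
def IsProductOf {ι : Type*} {P : 𝒞} {A : ι → 𝒞} (π : ∀ i, P ⟶ A i) : Prop :=
  ∀ (Z : 𝒞) (f : ∀ i, Z ⟶ A i), ∃! g : Z ⟶ P, ∀ i, g ≫ π i = f i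

namespace IsProductOf

variable {ι : Type*} {P : 𝒞} {A : ι → 𝒞} {π : ∀ i, P ⟶ A i}

lemma hom_ext (h : IsProductOf π) {Z : 𝒞} {f g : Z ⟶ P} (w : ∀ i, f ≫ π i = g ≫ π i) : f = g :=
  (h Z fun i => g ≫ π i).unique w fun _ => rfl

/-- A morphism between products of the same objects which is compatible with the projections is an
isomorphism. -/
lemma isIso (h : IsProductOf π) {P' : 𝒞} {π' : ∀ i, P' ⟶ A i} (h' : IsProductOf π') (f : P ⟶ P')
    (w : ∀ i, f ≫ π' i = π i) : IsIso f := by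
  obtain ⟨g, hg, -⟩ := h P' π'
  refine ⟨g, h.hom_ext fun i => ?_, h'.hom_ext fun i => ?_⟩
  · rw [Category.assoc, hg, w, Category.id_comp]
  · rw [Category.assoc, w, hg, Category.id_comp]

/-- A product of products is the product of all the factors. The factor `A i` is itself a product,
indexed by the fibre over `i` of a map `y`; the projection `α i k` takes the equation `y k = i` as an
argument to avoid casts. -/
lemma trans (h : IsProductOf π) {κ : Type*} {A' : κ → 𝒞} (y : κ → ι)
    (α : ∀ i k, y k = i → (A i ⟶ A' k))
    (hα : ∀ i, IsProductOf fun k : {k // y k = i} => α i k.1 k.2) :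
    IsProductOf fun k => π (y k) ≫ α (y k) k rfl := by
  intro Z f
  choose g hg hg' using fun i => hα i Z fun k => f k.1
  obtain ⟨u, hu, hu'⟩ := h Z g
  refine ⟨u, fun k => ?_, fun u' w => hu' _ fun i => hg' _ _ fun k => ?_⟩
  · exact (Category.assoc _ _ _).symm.trans ((congrArg (· ≫ _) (hu (y k))).trans (hg (y k) ⟨k, rfl⟩))
  · obtain ⟨k, rfl⟩ := k
    exact (Category.assoc _ _ _).trans (w k)

/-- A product with one factor. -/
lemma of_unique {P : 𝒞} {κ : Type*} (k₀ : κ) (hk : ∀ k, k = k₀) {A' : κ → 𝒞} (α : ∀ k, P ⟶ A' k)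
    [IsIso (α k₀)] : IsProductOf α := by
  intro Z f
  refine ⟨f k₀ ≫ inv (α k₀), fun k => ?_, fun g hg => ?_⟩
  · obtain rfl := hk k
    simp
  · rw [← hg]; simp

end IsProductOf

variable [Abelian 𝒞]

/-- If `X` and `Y` are products, then `X ⊞ Y` is the product of all their factors. -/
lemma IsProductOf.biprod {ι₁ ι₂ : Type*} {X Y : 𝒞} {A : ι₁ ⊕ ι₂ → 𝒞}
    {π₁ : ∀ i, X ⟶ A (Sum.inl i)} {π₂ : ∀ i, Y ⟶ A (Sum.inr i)} (h₁ : IsProductOf π₁)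
    (h₂ : IsProductOf π₂) {π : ∀ i, X ⊞ Y ⟶ A i} (w₁ : ∀ i, π (Sum.inl i) = biprod.fst ≫ π₁ i)
    (w₂ : ∀ i, π (Sum.inr i) = biprod.snd ≫ π₂ i) : IsProductOf π := by
  intro Z f
  obtain ⟨u, hu, hu'⟩ := h₁ Z fun i => f (Sum.inl i)
  obtain ⟨v, hv, hv'⟩ := h₂ Z fun i => f (Sum.inr i)
  refine ⟨biprod.lift u v, ?_, fun g hg => ?_⟩
  · rintro (i | i)
    · rw [w₁, biprod.lift_fst_assoc, hu]
    · rw [w₂, biprod.lift_snd_assoc, hv]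
  · apply biprod.hom_ext
    · rw [biprod.lift_fst]
      exact hu' _ fun i => by rw [Category.assoc, ← w₁, hg]
    · rw [biprod.lift_snd]
      exact hv' _ fun i => by rw [Category.assoc, ← w₂, hg]

/-- If `(f, g) : P ⟶ X ⊞ Y` is an isomorphism, then a morphism to `P` is a pair of morphisms to `X`
and `Y`. -/
lemma existsUnique_of_isIso_biprod_lift {X Y P : 𝒞} (f : P ⟶ X) (g : P ⟶ Y)
    [IsIso (biprod.lift f g)] {Z : 𝒞} (u : Z ⟶ X) (v : Z ⟶ Y) :
    ∃! w : Z ⟶ P, w ≫ f = u ∧ w ≫ g = v := by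
  have h₁ : inv (biprod.lift f g) ≫ f = biprod.fst := by simp [IsIso.inv_comp_eq]
  have h₂ : inv (biprod.lift f g) ≫ g = biprod.snd := by simp [IsIso.inv_comp_eq]
  refine ⟨biprod.lift u v ≫ inv (biprod.lift f g), ⟨?_, ?_⟩, fun w hw => ?_⟩
  · simp [h₁]
  · simp [h₂]
  · rw [← cancel_mono (biprod.lift f g)]
    apply biprod.hom_ext <;> simp [hw.1, hw.2]

lemma isProductOf_biproduct {ι : Type} [Finite ι] [HasFiniteBiproducts 𝒞] (A : ι → 𝒞) :
    IsProductOf fun i => biproduct.π A i := by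
  intro Z f
  exact ⟨biproduct.lift f, fun i => biproduct.lift_π _ _, fun g hg =>
    biproduct.hom_ext _ _ fun i => by rw [hg, biproduct.lift_π]⟩

/-- The cokernel of a direct sum of two morphisms. -/
def cokernelBiprodMap {P₁ P₂ Q₁ Q₂ : 𝒞} (e₁ : P₁ ⟶ Q₁) (e₂ : P₂ ⟶ Q₂) :
    cokernel (biprod.map e₁ e₂) ≅ cokernel e₁ ⊞ cokernel e₂ where
  hom := cokernel.desc _ (biprod.map (cokernel.π e₁) (cokernel.π e₂)) (by
    apply biprod.hom_ext' <;> simp)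
  inv := biprod.desc
    (cokernel.desc _ (biprod.inl ≫ cokernel.π _) (by
      rw [← Category.assoc, ← biprod.inl_map e₁ e₂, Category.assoc, cokernel.condition, comp_zero]))
    (cokernel.desc _ (biprod.inr ≫ cokernel.π _) (by
      rw [← Category.assoc, ← biprod.inr_map e₁ e₂, Category.assoc, cokernel.condition, comp_zero]))
  hom_inv_id := by
    ext <;> simp
  inv_hom_id := by
    ext <;> simp

/-- If source and target of `e` split compatibly with `e`, then the cokernel of `e` splits. -/
lemma nonempty_cokernel_iso_biprod {P Q P₁ Q₁ P₂ Q₂ : 𝒞} {e : P ⟶ Q} {e₁ : P₁ ⟶ Q₁} {e₂ : P₂ ⟶ Q₂}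
    {a₁ : P ⟶ P₁} {a₂ : P ⟶ P₂} {b₁ : Q ⟶ Q₁} {b₂ : Q ⟶ Q₂} (w₁ : e ≫ b₁ = a₁ ≫ e₁)
    (w₂ : e ≫ b₂ = a₂ ≫ e₂) (ha : IsIso (biprod.lift a₁ a₂)) (hb : IsIso (biprod.lift b₁ b₂)) :
    Nonempty (cokernel e ≅ cokernel e₁ ⊞ cokernel e₂) :=
  ⟨cokernel.mapIso e (biprod.map e₁ e₂) (asIso (biprod.lift a₁ a₂)) (asIso (biprod.lift b₁ b₂))
    (by ext <;> simp [w₁, w₂]) ≪≫ cokernelBiprodMap e₁ e₂⟩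

lemma isIso_biprod_lift_biprod_map {P Q P₁ Q₁ P₂ Q₂ : 𝒞}
    {a₁ : P ⟶ P₁} {a₂ : P ⟶ P₂} {b₁ : Q ⟶ Q₁} {b₂ : Q ⟶ Q₂} (ha : IsIso (biprod.lift a₁ a₂))
    (hb : IsIso (biprod.lift b₁ b₂)) :
    IsIso (biprod.lift (biprod.map a₁ b₁) (biprod.map a₂ b₂)) := by
  have h₁ : biprod.lift (biprod.map a₁ b₁) (biprod.map a₂ b₂) ≫ biprod.map biprod.fst biprod.fst =
      biprod.fst ≫ biprod.lift a₁ a₂ := by ext <;> simp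
  have h₂ : biprod.lift (biprod.map a₁ b₁) (biprod.map a₂ b₂) ≫ biprod.map biprod.snd biprod.snd =
      biprod.snd ≫ biprod.lift b₁ b₂ := by ext <;> simp
  have ha₁ : inv (biprod.lift a₁ a₂) ≫ a₁ = biprod.fst := by simp [IsIso.inv_comp_eq]
  have ha₂ : inv (biprod.lift a₁ a₂) ≫ a₂ = biprod.snd := by simp [IsIso.inv_comp_eq]
  have hb₁ : inv (biprod.lift b₁ b₂) ≫ b₁ = biprod.fst := by simp [IsIso.inv_comp_eq]
  have hb₂ : inv (biprod.lift b₁ b₂) ≫ b₂ = biprod.snd := by simp [IsIso.inv_comp_eq]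
  refine ⟨biprod.lift (biprod.map biprod.fst biprod.fst ≫ inv (biprod.lift a₁ a₂))
    (biprod.map biprod.snd biprod.snd ≫ inv (biprod.lift b₁ b₂)), ?_, ?_⟩
  · apply biprod.hom_ext
    · rw [Category.assoc, biprod.lift_fst, reassoc_of% h₁]; simp
    · rw [Category.assoc, biprod.lift_snd, reassoc_of% h₂]; simp
  · apply biprod.hom_ext <;> apply biprod.hom_ext <;> simp [ha₁, ha₂, hb₁, hb₂]

end Category

/-! ### Morphisms of modules on sections -/

section Sections
variable {Y : Scheme.{0}}

/-- A morphism of `𝒪_Y`-modules, given by compatible maps on sections. -/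
def modulesHomMk (M N : Y.Modules) (F : ∀ U : Y.Opens, Γ(M, U) →+ Γ(N, U))
    (hs : ∀ (U : Y.Opens) (r : Γ(Y, U)) (m : Γ(M, U)), F U (r • m) = r • F U m)
    (hr : ∀ {U V : Y.Opens} (h : V ≤ U) (m : Γ(M, U)), F V (res M h m) = res N h (F U m)) :
    M ⟶ N :=
  (⟨PresheafOfModules.homMk
    { app := fun U => AddCommGrpCat.ofHom (F U.unop)
      naturality := fun U V i => by
        ext f
        exact hr (leOfHom i.unop) f }
    (fun U r f => hs U.unop (r : Γ(Y, U.unop)) f)⟩ :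
    SheafOfModules.Hom _ _)

variable {M N : Y.Modules}

lemma modulesHom_ext {φ ψ : M ⟶ N} (h : ∀ (U : Y.Opens) (m : Γ(M, U)), φ.app U m = ψ.app U m) :
    φ = ψ := by
  ext U m
  exact h U m

lemma app_res (φ : M ⟶ N) {U V : Y.Opens} (h : V ≤ U) (m : Γ(M, U)) :
    φ.app V (res M h m) = res N h (φ.app U m) :=
  ConcreteCategory.congr_hom (φ.mapPresheaf.naturality (homOfLE h).op) m

lemma app_comp_apply {K : Y.Modules} (φ : M ⟶ N) (ψ : N ⟶ K) (U : Y.Opens) (m : Γ(M, U)) :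
    (φ ≫ ψ).app U m = ψ.app U (φ.app U m) := rfl

lemma sections_bot_subsingleton (N : Y.Modules) {U : Y.Opens} (hU : U ≤ ⊥) :
    Subsingleton Γ(N, U) :=
  ⟨fun s t => res_ext N (fun i : Empty => i.elim) (fun i => i.elim) (hU.trans bot_le) s t
    fun i => i.elim⟩

/-- Restriction between equal open subsets is bijective. -/
lemma res_bijective (N : Y.Modules) {U V : Y.Opens} (h : V ≤ U) (h' : U ≤ V) :
    Function.Bijective (res N h) :=
  Function.bijective_iff_has_inverse.2 ⟨res N h', fun x => by rw [res_res, res_self],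
    fun x => by rw [res_res, res_self]⟩

lemma isIso_of_app_bijective (φ : M ⟶ N) (h : ∀ U : Y.Opens, Function.Bijective (φ.app U)) :
    IsIso φ := by
  rw [Scheme.Modules.Hom.isIso_iff_isIso_app]
  intro U
  exact (ConcreteCategory.isIso_iff_bijective (φ.app U)).2 (h U)

/-- A module is a direct sum if this holds on sections. -/
lemma isIso_biprod_lift_of_sections {N₁ N₂ : Y.Modules} (f₁ : N ⟶ N₁) (f₂ : N ⟶ N₂)
    (inj : ∀ (U : Y.Opens) (n : Γ(N, U)), f₁.app U n = 0 → f₂.app U n = 0 → n = 0)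
    (surj : ∀ (U : Y.Opens) (n₁ : Γ(N₁, U)) (n₂ : Γ(N₂, U)),
      ∃ n, f₁.app U n = n₁ ∧ f₂.app U n = n₂) : IsIso (biprod.lift f₁ f₂) := by
  have hfst : ∀ (U : Y.Opens) (n : Γ(N, U)),
      (biprod.fst : N₁ ⊞ N₂ ⟶ N₁).app U ((biprod.lift f₁ f₂).app U n) = f₁.app U n := by
    intro U n
    rw [← app_comp_apply, biprod.lift_fst]
  have hsnd : ∀ (U : Y.Opens) (n : Γ(N, U)),
      (biprod.snd : N₁ ⊞ N₂ ⟶ N₂).app U ((biprod.lift f₁ f₂).app U n) = f₂.app U n := by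
    intro U n
    rw [← app_comp_apply, biprod.lift_snd]
  have hext : ∀ (U : Y.Opens) (z z' : Γ(N₁ ⊞ N₂, U)),
      (biprod.fst : N₁ ⊞ N₂ ⟶ N₁).app U z = (biprod.fst : N₁ ⊞ N₂ ⟶ N₁).app U z' →
      (biprod.snd : N₁ ⊞ N₂ ⟶ N₂).app U z = (biprod.snd : N₁ ⊞ N₂ ⟶ N₂).app U z' → z = z' := by
    intro U z z' h₁ h₂
    have key : ∀ w : Γ(N₁ ⊞ N₂, U), w = (biprod.inl : N₁ ⟶ N₁ ⊞ N₂).app U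
        ((biprod.fst : N₁ ⊞ N₂ ⟶ N₁).app U w) + (biprod.inr : N₂ ⟶ N₁ ⊞ N₂).app U
        ((biprod.snd : N₁ ⊞ N₂ ⟶ N₂).app U w) := by
      intro w
      have := congrArg (fun φ : N₁ ⊞ N₂ ⟶ N₁ ⊞ N₂ => φ.app U w) (biprod.total (X := N₁) (Y := N₂))
      exact this.symm
    rw [key z, key z', h₁, h₂]
  refine isIso_of_app_bijective _ fun U => ⟨?_, fun z => ?_⟩
  · refine (injective_iff_map_eq_zero ((biprod.lift f₁ f₂).app U).hom).2 fun n hn => inj U n ?_ ?_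
    · have := hfst U n
      rw [← this]
      exact (congrArg _ hn).trans (map_zero _)
    · have := hsnd U n
      rw [← this]
      exact (congrArg _ hn).trans (map_zero _)
  · obtain ⟨n, h₁, h₂⟩ := surj U ((biprod.fst : N₁ ⊞ N₂ ⟶ N₁).app U z)
      ((biprod.snd : N₁ ⊞ N₂ ⟶ N₂).app U z)
    exact ⟨n, hext U _ _ ((hfst U n).trans h₁) ((hsnd U n).trans h₂)⟩

end Sections

/-! ### Pushforward along closed immersions -/

section ClosedImmersion

variable {Z C : Scheme.{0}} (i : Z ⟶ C) [IsClosedImmersion i]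

/-- Every open subset of a closed subscheme is induced by an open subset of the ambient scheme. -/
lemma exists_preimage_eq (V : Z.Opens) : ∃ U : C.Opens, i ⁻¹ᵁ U = V := by
  obtain ⟨U, hU, h⟩ := i.isClosedEmbedding.isInducing.isOpen_iff.1 V.2
  exact ⟨⟨U, hU⟩, Opens.ext h⟩

/-- Locally, functions on a closed subscheme extend to the ambient scheme. -/
lemma exists_local_extension (U : C.Opens) (r : Γ(Z, i ⁻¹ᵁ U)) (z : C) (hz : z ∈ U) :
    ∃ (W : C.Opens) (h : W ≤ U) (_ : z ∈ W) (r' : Γ(C, W)),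
      i.app W r' = resO Z (i.preimage_mono h) r := by
  obtain ⟨_, ⟨W, hW, rfl⟩, hzW, hWU⟩ :=
    C.isBasis_affineOpens.exists_subset_of_mem_open (show z ∈ (U : Set C) from hz) U.2
  obtain ⟨r', hr'⟩ := i.app_surjective W hW (resO Z (i.preimage_mono hWU) r)
  exact ⟨W, hWU, hzW, r', hr'⟩

/-- Every morphism `i_* M ⟶ i_* N` comes from a morphism `M ⟶ N`: every open subset of `Z` is the
preimage of one of `C`, and linearity over `𝒪_C` gives linearity over `𝒪_Z`, because functions on `Z`
extend locally. -/
lemma exists_pushforward_map_eq {M N : Z.Modules}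
    (h : (Scheme.Modules.pushforward i).obj M ⟶ (Scheme.Modules.pushforward i).obj N) :
    ∃ φ : M ⟶ N, (Scheme.Modules.pushforward i).map φ = h := by
  let hh : ∀ U : C.Opens, Γ(M, i ⁻¹ᵁ U) →+ Γ(N, i ⁻¹ᵁ U) := fun U => (h.app U).hom
  have hh_res : ∀ {U U' : C.Opens} (hU : U' ≤ U) (m : Γ(M, i ⁻¹ᵁ U)),
      hh U' (res M (i.preimage_mono hU) m) = res N (i.preimage_mono hU) (hh U m) :=
    fun hU m => app_res h hU m
  have hh_smul : ∀ (U : C.Opens) (r : Γ(C, U)) (m : Γ(M, i ⁻¹ᵁ U)),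
      hh U (i.app U r • m) = i.app U r • hh U m := fun U r m => h.app_smul r m
  choose E hE using exists_preimage_eq i
  let F : ∀ V : Z.Opens, Γ(M, V) →+ Γ(N, V) := fun V =>
    (res N (hE V).ge).comp ((hh (E V)).comp (res M (hE V).le))
  -- `F V` may be computed with any open subset of `C` that induces a subset of `V`.
  have key : ∀ (V : Z.Opens) (U : C.Opens) (hU : i ⁻¹ᵁ U ≤ V) (m : Γ(M, V)),
      res N hU (F V m) = hh U (res M hU m) := by
    intro V U hU m
    have h₁ : i ⁻¹ᵁ U ≤ i ⁻¹ᵁ (U ⊓ E V) := le_inf le_rfl (hU.trans (hE V).ge)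
    have h₂ : i ⁻¹ᵁ (U ⊓ E V) ≤ V :=
      (i.preimage_mono inf_le_left).trans hU
    have e₁ : res N h₂ (F V m) = hh (U ⊓ E V) (res M h₂ m) := by
      change res N h₂ (res N (hE V).ge (hh (E V) (res M (hE V).le m))) = _
      have := hh_res (inf_le_right : U ⊓ E V ≤ E V) (res M (hE V).le m)
      rw [res_res] at this
      rw [res_res]
      exact this.symm
    have e₂ := hh_res (inf_le_left : U ⊓ E V ≤ U) (res M hU m)
    rw [res_res] at e₂
    have e₃ := congrArg (res N h₁) (e₁.trans e₂)
    rw [res_res, res_res, res_self] at e₃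
    exact e₃
  have F_res : ∀ {U V : Z.Opens} (hV : V ≤ U) (m : Γ(M, U)), F V (res M hV m) = res N hV (F U m) := by
    intro U V hV m
    obtain ⟨U', rfl⟩ := exists_preimage_eq i V
    rw [key, ← res_self N le_rfl (F _ _), key, res_self]
  have F_smul : ∀ (V : Z.Opens) (r : Γ(Z, V)) (m : Γ(M, V)), F V (r • m) = r • F V m := by
    intro V r m
    obtain ⟨U, rfl⟩ := exists_preimage_eq i V
    choose W hWU hzW r' hr' using fun z : U => exists_local_extension i U r z.1 z.2
    refine res_ext N (fun z : U => i ⁻¹ᵁ (W z)) (fun z => i.preimage_mono (hWU z)) ?_ _ _ fun z => ?_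
    · intro y hy
      exact Opens.mem_iSup.2 ⟨⟨i y, hy⟩, hzW ⟨i y, hy⟩⟩
    · rw [res_smul, ← hr', ← F_res, ← F_res, res_smul, ← hr', ← res_self N le_rfl (F _ _), key,
        ← res_self N le_rfl (F _ _), key, res_self, res_self]
      exact hh_smul _ _ _
  refine ⟨modulesHomMk M N F F_smul F_res, modulesHom_ext fun U m => ?_⟩
  have := key (i ⁻¹ᵁ U) U le_rfl m
  exact (res_self N le_rfl _).symm.trans (this.trans (congrArg (hh U) (res_self M le_rfl m)))

instance pushforward_full_of_isClosedImmersion : (Scheme.Modules.pushforward i).Full where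
  map_surjective := exists_pushforward_map_eq i

instance pushforward_faithful_of_isClosedImmersion : (Scheme.Modules.pushforward i).Faithful where
  map_injective {M N φ ψ} h := modulesHom_ext fun V m => by
    obtain ⟨U, rfl⟩ := exists_preimage_eq i V
    exact congrArg (fun χ : (Scheme.Modules.pushforward i).obj M ⟶
      (Scheme.Modules.pushforward i).obj N => χ.app U m) h

end ClosedImmersion

/-! ### Restriction along sections -/

section Comparison

open Scheme.Modules hiding pullback

variable {B Z C : Scheme.{0}} {p₁ : B ⟶ Z} {i : Z ⟶ C} {p : B ⟶ C} (h : p₁ ≫ i = p) (M : Z.Modules)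

lemma preimage_le_preimage_of_comp_eq (h : p₁ ≫ i = p) (U : C.Opens) :
    p ⁻¹ᵁ U ≤ p₁ ⁻¹ᵁ (i ⁻¹ᵁ U) := by
  rw [← h, Scheme.Hom.comp_preimage]

lemma le_preimage_of_section {c : C ⟶ B} (hp : p ≫ c = 𝟙 B) (U : B.Opens) :
    U ≤ p ⁻¹ᵁ (c ⁻¹ᵁ U) := by
  rw [← Scheme.Hom.comp_preimage, hp, Scheme.Hom.id_preimage]

/-- The isomorphism `i_* p_* ≅ q_*` for `q = i ∘ p`. -/
def pushforwardTrans (h : p₁ ≫ i = p) : pushforward p₁ ⋙ pushforward i ≅ pushforward p :=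
  pushforwardComp p₁ i ≪≫ pushforwardCongr h

lemma pushforwardTrans_app (N : B.Modules) (U : C.Opens) (n : Γ(N, p₁ ⁻¹ᵁ (i ⁻¹ᵁ U))) :
    ((pushforwardTrans h).hom.app N).app U n =
      res N (preimage_le_preimage_of_comp_eq h U) n := by
  subst h
  rfl

/-- The comparison morphism `p^* i_* M ⟶ p₁^* M` for `p = i ∘ p₁`. -/
def pullbackPushforwardComparison :
    (Scheme.Modules.pullback p).obj ((pushforward i).obj M) ⟶ (Scheme.Modules.pullback p₁).obj M :=
  ((pullbackPushforwardAdjunction p).homEquiv _ _).symm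
    ((pushforward i).map ((pullbackPushforwardAdjunction p₁).unit.app M) ≫
      (pushforwardTrans h).hom.app _)

lemma unit_pullbackPushforwardComparison :
    (pullbackPushforwardAdjunction p).unit.app ((pushforward i).obj M) ≫
      (pushforward p).map (pullbackPushforwardComparison h M) =
    (pushforward i).map ((pullbackPushforwardAdjunction p₁).unit.app M) ≫
      (pushforwardTrans h).hom.app _ := by
  exact (Adjunction.homEquiv_unit _ _ _ _).symm.trans (Equiv.apply_symm_apply _ _)

lemma pullbackPushforwardComparison_unit_app (U : C.Opens) (m : Γ(M, i ⁻¹ᵁ U)) :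
    (pullbackPushforwardComparison h M).app (p ⁻¹ᵁ U)
        (((pullbackPushforwardAdjunction p).unit.app ((pushforward i).obj M)).app U m) =
      res _ (preimage_le_preimage_of_comp_eq h U)
        (((pullbackPushforwardAdjunction p₁).unit.app M).app (i ⁻¹ᵁ U) m) := by
  have h₁ := congrArg (fun χ : (pushforward i).obj M ⟶
    (pushforward p).obj ((Scheme.Modules.pullback p₁).obj M) => χ.app U m)
    (unit_pullbackPushforwardComparison h M)
  have h₂ := pushforwardTrans_app h ((Scheme.Modules.pullback p₁).obj M) U
    (((pullbackPushforwardAdjunction p₁).unit.app M).app (i ⁻¹ᵁ U) m)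
  exact h₁.trans h₂

/-- For a closed immersion `i`, the comparison morphism is an isomorphism: both sides represent the
same functor, because `i_*` is fully faithful. -/
instance isIso_pullbackPushforwardComparison [IsClosedImmersion i] :
    IsIso (pullbackPushforwardComparison h M) := by
  refine isIso_of_coyoneda_map_bijective _ fun N => ?_
  let e : ((Scheme.Modules.pullback p₁).obj M ⟶ N) ≃
      ((Scheme.Modules.pullback p).obj ((pushforward i).obj M) ⟶ N) :=
    (((pullbackPushforwardAdjunction p₁).homEquiv M N).trans
      (Functor.FullyFaithful.ofFullyFaithful (pushforward i)).homEquiv).trans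
      (((pushforwardTrans h).app N).homToEquiv.trans
        ((pullbackPushforwardAdjunction p).homEquiv _ N).symm)
  have he : ∀ g, pullbackPushforwardComparison h M ≫ g = e g := by
    intro g
    apply ((pullbackPushforwardAdjunction p).homEquiv _ _).injective
    refine (Adjunction.homEquiv_naturality_right _ _ _).trans ?_
    rw [pullbackPushforwardComparison, Equiv.apply_symm_apply]
    refine Eq.trans ?_ (Equiv.apply_symm_apply _ _).symm
    change _ = (pushforward i).map (((pullbackPushforwardAdjunction p₁).homEquiv M N) g) ≫
      (pushforwardTrans h).hom.app N
    rw [Adjunction.homEquiv_unit, Functor.map_comp, Category.assoc, Category.assoc,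
      ← NatTrans.naturality]
    rfl
  rw [funext he]
  exact e.bijective

/-- If `p` misses the closed subscheme `Z`, then `p^* i_* M = 0`. -/
lemma isZero_pullback_pushforward [IsClosedImmersion i] (hp : ∀ b z, p b ≠ i z) :
    IsZero ((Scheme.Modules.pullback p).obj ((pushforward i).obj M)) := by
  -- Morphisms out of `p^* i_* M` are morphisms `i_* M ⟶ p_* N`; these vanish because `i_* M`
  -- vanishes over the complement of `Z`, which contains the image of `p`.
  rw [IsZero.iff_id_eq_zero]
  apply ((pullbackPushforwardAdjunction p).homEquiv _ _).injective
  have key : ∀ {N : B.Modules} (φ : (pushforward i).obj M ⟶ (pushforward p).obj N), φ = 0 := by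
    intro N φ
    refine modulesHom_ext fun U m => ?_
    let V : C.Opens := ⟨(Set.range i)ᶜ, i.isClosedEmbedding.isClosed_range.isOpen_compl⟩
    have hV : i ⁻¹ᵁ (U ⊓ V) ≤ ⊥ := fun z hz => hz.2 ⟨z, rfl⟩
    have hV' : p ⁻¹ᵁ U ≤ p ⁻¹ᵁ (U ⊓ V) := fun b hb => ⟨hb, fun ⟨z, hz⟩ => hp b z hz.symm⟩
    have := sections_bot_subsingleton M hV
    have h0 : res ((pushforward i).obj M) (inf_le_left : U ⊓ V ≤ U) m = 0 :=
      Subsingleton.elim (α := Γ(M, i ⁻¹ᵁ (U ⊓ V))) _ _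
    have h1 := app_res φ (inf_le_left : U ⊓ V ≤ U) m
    rw [h0, map_zero] at h1
    refine (res_bijective N (p.preimage_mono (inf_le_left : U ⊓ V ≤ U)) hV').1 ?_
    exact h1.symm.trans (map_zero _).symm
  exact (key _).trans (key _).symm

lemma restrictTo_app {c : C ⟶ B} (hp : p ≫ c = 𝟙 B) (M : C.Modules) (U : B.Opens)
    (m : Γ(M, c ⁻¹ᵁ U)) : (restrictTo hp M).app U m =
      res _ (le_preimage_of_section hp U)
        (((pullbackPushforwardAdjunction p).unit.app M).app (c ⁻¹ᵁ U) m) := rfl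

lemma restrictTo_naturality {c : C ⟶ B} (hp : p ≫ c = 𝟙 B) {M N : C.Modules} (φ : M ⟶ N) :
    restrictTo hp M ≫ (Scheme.Modules.pullback p).map φ =
      (pushforward c).map φ ≫ restrictTo hp N := by
  refine modulesHom_ext fun U m => ?_
  refine (congrArg _ (restrictTo_app hp M U m)).trans ((app_res _ _ _).trans ?_)
  refine Eq.trans (congrArg (res _ _) ?_) (restrictTo_app hp N U (φ.app (c ⁻¹ᵁ U) m)).symm
  have := (pullbackPushforwardAdjunction p).unit.naturality φ
  exact (congrArg (fun χ : M ⟶ (pushforward p).obj ((Scheme.Modules.pullback p).obj N) =>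
    χ.app (c ⁻¹ᵁ U) m) this).symm

/-- Restriction along a section `p = i ∘ p₁` of a module supported on `Z` is restriction along the
section `p₁`. -/
lemma restrictTo_comparison {c₁ : Z ⟶ B} {c : C ⟶ B} (hc : i ≫ c = c₁) (hp : p ≫ c = 𝟙 B)
    (hp₁ : p₁ ≫ c₁ = 𝟙 B) :
    restrictTo hp ((pushforward i).obj M) ≫ pullbackPushforwardComparison h M =
      (pushforwardTrans hc).hom.app M ≫ restrictTo hp₁ M := by
  refine modulesHom_ext fun U m => ?_
  have h₁ : (restrictTo hp ((pushforward i).obj M) ≫ pullbackPushforwardComparison h M).app U m =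
      (pullbackPushforwardComparison h M).app U (res _
        (le_preimage_of_section hp U)
        (((pullbackPushforwardAdjunction p).unit.app ((pushforward i).obj M)).app (c ⁻¹ᵁ U) m)) :=
    rfl
  have h₂ : ((pushforwardTrans hc).hom.app M ≫ restrictTo hp₁ M).app U m =
      res _ (le_preimage_of_section hp₁ U)
        (((pullbackPushforwardAdjunction p₁).unit.app M).app (c₁ ⁻¹ᵁ U)
          (res M (preimage_le_preimage_of_comp_eq hc U) m)) := by
    rw [← pushforwardTrans_app hc M U m]
    rfl
  refine h₁.trans (Eq.trans ?_ h₂.symm)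
  refine (app_res _ _ _).trans ?_
  refine (congrArg _ (pullbackPushforwardComparison_unit_app h M (c ⁻¹ᵁ U) m)).trans ?_
  refine (res_res _ _ _ _).trans (Eq.trans ?_ (congrArg _ (app_res _ _ _)).symm)
  exact (res_res _ _ _ _).symm

end Comparison

/-! ### Restriction to open subschemes -/

section OpenRestriction

open Scheme.Modules hiding pullback

variable {Y₁ Y : Scheme.{0}} {j : Y₁ ⟶ Y}

/-- The map `N(U) → N₁(j⁻¹ U)` given by a morphism `N ⟶ j_* N₁`. -/
def restrictSections {N : Y.Modules} {N₁ : Y₁.Modules} (ρ : N ⟶ (pushforward j).obj N₁)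
    (U : Y.Opens) : Γ(N, U) →+ Γ(N₁, j ⁻¹ᵁ U) := (ρ.app U).hom

section
variable {N : Y.Modules} {N₁ : Y₁.Modules} (ρ : N ⟶ (pushforward j).obj N₁)

lemma restrictSections_res {U V : Y.Opens} (h : V ≤ U) (n : Γ(N, U)) :
    restrictSections ρ V (res N h n) = res N₁ (j.preimage_mono h) (restrictSections ρ U n) :=
  app_res ρ h n

lemma restrictSections_smul (U : Y.Opens) (r : Γ(Y, U)) (n : Γ(N, U)) :
    restrictSections ρ U (r • n) = j.app U r • restrictSections ρ U n :=
  ρ.app_smul r n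

/-- The morphism `ρ : N ⟶ j_* N₁` identifies `N₁` with the restriction of `N` along the open
immersion `j`. -/
def IsRestriction [IsOpenImmersion j] : Prop :=
  ∀ U : Y.Opens, U ≤ j.opensRange → Function.Bijective (restrictSections ρ U)

end

lemma image_preimage_eq_of_le [IsOpenImmersion j] {U : Y.Opens} (hU : U ≤ j.opensRange) :
    j ''ᵁ (j ⁻¹ᵁ U) = U := by
  rw [Scheme.Hom.image_preimage_eq_opensRange_inf, inf_eq_right.2 hU]

/-- A module on the disjoint union of two open subschemes is the direct sum of its restrictions. -/
lemma isIso_biprod_lift_of_isRestriction {Y₂ : Scheme.{0}} {j₂ : Y₂ ⟶ Y} [IsOpenImmersion j]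
    [IsOpenImmersion j₂] (hj : IsCompl j.opensRange j₂.opensRange) {N : Y.Modules}
    {N₁ : Y₁.Modules} {N₂ : Y₂.Modules} {ρ₁ : N ⟶ (pushforward j).obj N₁}
    {ρ₂ : N ⟶ (pushforward j₂).obj N₂} (h₁ : IsRestriction ρ₁) (h₂ : IsRestriction ρ₂) :
    IsIso (biprod.lift ρ₁ ρ₂) := by
  have hc : ∀ U : Y.Opens, U ≤ ⨆ i : Bool, U ⊓ cond i j.opensRange j₂.opensRange := by
    intro U
    rw [iSup_bool_eq]
    change U ≤ U ⊓ j.opensRange ⊔ U ⊓ j₂.opensRange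
    rw [← inf_sup_left, hj.sup_eq_top, inf_top_eq]
  have hle : ∀ (U : Y.Opens) (i : Bool), U ⊓ cond i j.opensRange j₂.opensRange ≤ U :=
    fun _ _ => inf_le_left
  refine isIso_biprod_lift_of_sections ρ₁ ρ₂ (fun U n e₁ e₂ => ?_) fun U n₁ n₂ => ?_
  · refine res_ext N _ (hle U) (hc U) n 0 fun i => ?_
    rw [map_zero]
    cases i
    · apply (h₂ (U ⊓ j₂.opensRange) inf_le_right).1
      exact (restrictSections_res ρ₂ _ n).trans
        ((congrArg _ e₂).trans ((map_zero _).trans (map_zero _).symm))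
    · apply (h₁ (U ⊓ j.opensRange) inf_le_right).1
      exact (restrictSections_res ρ₁ _ n).trans
        ((congrArg _ e₁).trans ((map_zero _).trans (map_zero _).symm))
  · obtain ⟨m₁, hm₁⟩ := (h₁ (U ⊓ j.opensRange) inf_le_right).2
      (res N₁ (j.preimage_mono inf_le_left) n₁)
    obtain ⟨m₂, hm₂⟩ := (h₂ (U ⊓ j₂.opensRange) inf_le_right).2
      (res N₂ (j₂.preimage_mono inf_le_left) n₂)
    have hbot : ∀ i i' : Bool, i ≠ i' → (U ⊓ cond i j.opensRange j₂.opensRange) ⊓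
        (U ⊓ cond i' j.opensRange j₂.opensRange) ≤ ⊥ := by
      intro i i' hne
      have hd := hj.inf_eq_bot.le
      cases i <;> cases i' <;> first | exact absurd rfl hne | skip
      · exact (le_inf (inf_le_right.trans inf_le_right) (inf_le_left.trans inf_le_right)).trans hd
      · exact (le_inf (inf_le_left.trans inf_le_right) (inf_le_right.trans inf_le_right)).trans hd
    obtain ⟨n, hn⟩ := res_glue N _ (hle U) (hc U)
      (fun i => match i with | true => m₁ | false => m₂) fun i i' => by
        by_cases hii : i = i'
        · subst hii; rfl
        · have := sections_bot_subsingleton N (hbot i i' hii)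
          exact Subsingleton.elim _ _
    refine ⟨n, ?_, ?_⟩
    · apply (res_bijective N₁ (j.preimage_mono (inf_le_left : U ⊓ j.opensRange ≤ U))
        fun y hy => ⟨hy, y, rfl⟩).1
      exact (restrictSections_res ρ₁ _ n).symm.trans ((congrArg _ (hn true)).trans hm₁)
    · apply (res_bijective N₂ (j₂.preimage_mono (inf_le_left : U ⊓ j₂.opensRange ≤ U))
        fun y hy => ⟨hy, y, rfl⟩).1
      exact (restrictSections_res ρ₂ _ n).symm.trans ((congrArg _ (hn false)).trans hm₂)

/-- Functions restrict along `j`. -/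
def structureRestrict (j : Y₁ ⟶ Y) :
    structureModule Y ⟶ (pushforward j).obj (structureModule Y₁) :=
  modulesHomMk _ _ (fun U => (j.app U).hom.toAddMonoidHom)
    (fun U r m => map_mul (j.app U).hom r m) (fun h m => resO_app j h m)

lemma isRestriction_structureRestrict [IsOpenImmersion j] :
    IsRestriction (structureRestrict j) := by
  intro U hU
  have : IsIso (j.app U) := j.isIso_app U hU
  exact ConcreteCategory.bijective_of_isIso (j.app U)

section Derivations

variable {X S : Scheme.{0}} {g : Y ⟶ X} {g₁ : Y₁ ⟶ X} (hg : j ≫ g = g₁) (x : X ⟶ S)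
  {N : Y.Modules} {N₁ : Y₁.Modules} (ρ : N ⟶ (pushforward j).obj N₁)

lemma preimage_inf_preimage_le (hg : j ≫ g = g₁) (U : Y.Opens) (W : X.Opens) :
    j ⁻¹ᵁ U ⊓ g₁ ⁻¹ᵁ W ≤ j ⁻¹ᵁ (U ⊓ g ⁻¹ᵁ W) := by subst hg; exact le_rfl

lemma le_preimage_inf_preimage (hg : j ≫ g = g₁) (U : Y.Opens) (W : X.Opens) :
    j ⁻¹ᵁ (U ⊓ g ⁻¹ᵁ W) ≤ j ⁻¹ᵁ U ⊓ g₁ ⁻¹ᵁ W := by subst hg; exact le_rfl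

lemma resO_app_app (hg : j ≫ g = g₁) {W : X.Opens} (a : Γ(X, W)) {V : Y.Opens} (hV : V ≤ g ⁻¹ᵁ W)
    {O : Y₁.Opens} (hO : O ≤ j ⁻¹ᵁ V) (hO' : O ≤ g₁ ⁻¹ᵁ W) :
    resO Y₁ hO (j.app V (resO Y hV (g.app W a))) = resO Y₁ hO' (g₁.app W a) := by
  subst hg
  rw [resO_app, resO_resO]
  rfl

lemma isDerFam_restrict {U : Y.Opens} {d : ∀ W : X.Opens, Γ(X, W) → Γ(N, U ⊓ g ⁻¹ᵁ W)}
    (hd : IsDerFam g x N U d) : IsDerFam g₁ x N₁ (j ⁻¹ᵁ U) fun W a =>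
      res N₁ (preimage_inf_preimage_le hg U W) (restrictSections ρ _ (d W a)) where
  add W a a' := by rw [hd.add, map_add, map_add]
  leibniz W a a' := by
    rw [hd.leibniz, map_add, map_add, restrictSections_smul, restrictSections_smul, res_smul,
      res_smul, resO_app_app hg, resO_app_app hg]
  res h a := by
    rw [hd.res, restrictSections_res, res_res, res_res]
  const Z a := by rw [hd.const, map_zero, map_zero]

/-- Restriction of derivations along `j`, on sections. A derivation is a family of values on the
functions on `X`, and its values are restricted by `ρ`. -/
def derRestrictSections (U : Y.Opens) (d : (derFam g x N).carrier U) :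
    (derFam g₁ x N₁).carrier (j ⁻¹ᵁ U) :=
  ⟨fun k => res N₁ (preimage_inf_preimage_le hg U k.1) (restrictSections ρ _ (d.1 k)),
    isDerFam_restrict hg x ρ d.2⟩

/-- Restriction of derivations along `j`. -/
def derRestrict : (derFam g x N).toModules ⟶ (pushforward j).obj (derFam g₁ x N₁).toModules :=
  modulesHomMk _ _
    (fun U =>
      { toFun := derRestrictSections hg x ρ U
        map_zero' := Subtype.ext (funext fun k =>
          (congrArg (res N₁ _) (map_zero (restrictSections ρ _))).trans (map_zero _))
        map_add' := fun d e => Subtype.ext (funext fun k =>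
          (congrArg (res N₁ _) (map_add (restrictSections ρ _) _ _)).trans (map_add _ _ _)) })
    (fun U r d => Subtype.ext (funext fun k => by
      refine (congrArg (res N₁ _) (restrictSections_smul ρ _ _ _)).trans ((res_smul _ _ _ _).trans ?_)
      refine congrArg (· • _) ?_
      refine (congrArg (resO Y₁ _) (resO_app j inf_le_left r)).trans ?_
      exact resO_resO _ _ _))
    (fun {U V} h d => Subtype.ext (funext fun k => by
      refine (congrArg (res N₁ _) (restrictSections_res ρ _ _)).trans ?_
      exact (res_res _ _ _ _).trans (res_res _ _ _ _).symm))

variable {ρ}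

lemma isRestriction_derRestrict [IsOpenImmersion j] (hρ : IsRestriction ρ) :
    IsRestriction (derRestrict hg x ρ) := by
  intro U hU
  have hUW : ∀ W : X.Opens, U ⊓ g ⁻¹ᵁ W ≤ j.opensRange := fun W => inf_le_left.trans hU
  constructor
  · refine (injective_iff_map_eq_zero _).2 fun (d : (derFam g x N).carrier U) hd => ?_
    refine Subtype.ext (funext fun k => ?_)
    apply (hρ _ (hUW k.1)).1
    apply (res_bijective N₁ (preimage_inf_preimage_le hg U k.1)
      (le_preimage_inf_preimage hg U k.1)).1
    have h1 : derRestrictSections hg x ρ U d = 0 := hd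
    refine (congrFun (congrArg Subtype.val h1) k).trans ?_
    exact ((congrArg (res N₁ _) (map_zero (restrictSections ρ _))).trans (map_zero _)).symm
  · intro (d : (derFam g₁ x N₁).carrier (j ⁻¹ᵁ U))
    choose e he using fun k : (Σ W : X.Opens, Γ(X, W)) =>
      (hρ _ (hUW k.1)).2 (res N₁ (le_preimage_inf_preimage hg U k.1) (d.1 k))
    have hd := d.2
    have he' : ∀ W a, restrictSections ρ (U ⊓ g ⁻¹ᵁ W) (e ⟨W, a⟩) =
      res N₁ (le_preimage_inf_preimage hg U W) (d.1 ⟨W, a⟩) := fun W a => he ⟨W, a⟩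
    have hde : IsDerFam g x N U fun W a => e ⟨W, a⟩ :=
      { add := fun W a a' => by
          apply (hρ _ (hUW W)).1
          rw [map_add, he', he', he', ← map_add]
          exact congrArg _ (hd.add W a a')
        leibniz := fun W a a' => by
          apply (hρ _ (hUW W)).1
          rw [map_add, restrictSections_smul, restrictSections_smul, he', he', he']
          refine (congrArg _ (hd.leibniz W a a')).trans ?_
          have key : ∀ c : Γ(X, W), j.app (U ⊓ g ⁻¹ᵁ W) (resO Y inf_le_right (g.app W c)) =
              resO Y₁ ((le_preimage_inf_preimage hg U W).trans inf_le_right) (g₁.app W c) :=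
            fun c => (resO_self le_rfl _).symm.trans (resO_app_app hg c _ _ _)
          rw [map_add, res_smul, res_smul, resO_resO, resO_resO, key, key]
        res := fun {W W'} h a => by
          apply (hρ _ (hUW W')).1
          rw [restrictSections_res, he', he', res_res]
          refine (congrArg _ (hd.res h a)).trans ?_
          rw [res_res]
        const := fun Z a => by
          apply (hρ _ (hUW (x ⁻¹ᵁ Z))).1
          rw [he', map_zero]
          exact (congrArg _ (hd.const Z a)).trans (map_zero _) }
    refine ⟨(⟨e, hde⟩ : (derFam g x N).carrier U), Subtype.ext (funext fun k => ?_)⟩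
    refine (congrArg (res N₁ (preimage_inf_preimage_le hg U k.1)) (he k)).trans ?_
    rw [res_res, res_self]

end Derivations

section Hom

variable [IsOpenImmersion j] {M N : Y.Modules} {M₁ N₁ : Y₁.Modules}
  {ρ : M ⟶ (pushforward j).obj M₁} (hρ : IsRestriction ρ) (σ : N ⟶ (pushforward j).obj N₁)

/-- The section of `M` over `j(V)` that corresponds to a section of the restriction of `M`. -/
def IsRestriction.extend (V : Y₁.Opens) (m : Γ(M₁, V)) : Γ(M, j ''ᵁ V) :=
  (Equiv.ofBijective _ (hρ (j ''ᵁ V) (Scheme.Hom.image_le_opensRange j V))).symm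
    (res M₁ (j.preimage_image_eq V).le m)

lemma IsRestriction.restrictSections_extend (V : Y₁.Opens) (m : Γ(M₁, V)) :
    restrictSections ρ _ (hρ.extend V m) = res M₁ (j.preimage_image_eq V).le m :=
  Equiv.apply_symm_apply (Equiv.ofBijective _ (hρ (j ''ᵁ V) (Scheme.Hom.image_le_opensRange j V))) _

lemma IsRestriction.extend_eq {V : Y₁.Opens} {m : Γ(M₁, V)} {n : Γ(M, j ''ᵁ V)}
    (h : restrictSections ρ _ n = res M₁ (j.preimage_image_eq V).le m) : hρ.extend V m = n :=
  (hρ _ (Scheme.Hom.image_le_opensRange j V)).1 ((hρ.restrictSections_extend V m).trans h.symm)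

lemma IsRestriction.extend_restrictSections (V : Y.Opens) (m : Γ(M, V)) :
    hρ.extend _ (restrictSections ρ V m) = res M (j.image_preimage_le V) m :=
  hρ.extend_eq (restrictSections_res ρ _ _)

lemma inf_le_preimage_inf_image (U : Y.Opens) (V : Y₁.Opens) :
    j ⁻¹ᵁ U ⊓ V ≤ j ⁻¹ᵁ (U ⊓ j ''ᵁ V) :=
  le_inf inf_le_left (inf_le_right.trans (j.preimage_image_eq V).ge)

lemma isHomFam_restrict {U : Y.Opens} {f : ∀ V : Y.Opens, Γ(M, V) → Γ(N, U ⊓ V)}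
    (hf : IsHomFam M N U f) : IsHomFam M₁ N₁ (j ⁻¹ᵁ U) fun V m =>
      res N₁ (inf_le_preimage_inf_image U V) (restrictSections σ _ (f _ (hρ.extend V m))) where
  add V m m' := by
    have : hρ.extend V (m + m') = hρ.extend V m + hρ.extend V m' := hρ.extend_eq (by
      rw [map_add, map_add, hρ.restrictSections_extend, hρ.restrictSections_extend])
    rw [this, hf.add, map_add, map_add]
  smul V r m := by
    have hr := ConcreteCategory.congr_hom (j.appIso_inv_app V) r
    have : hρ.extend V (r • m) = (j.appIso V).inv r • hρ.extend V m := hρ.extend_eq (by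
      rw [restrictSections_smul, hρ.restrictSections_extend, res_smul]
      exact congrArg (· • _) hr)
    rw [this, hf.smul, restrictSections_smul, res_smul, resO_app, resO_resO]
    refine congrArg (· • _) ?_
    refine (congrArg (resO Y₁ _) hr).trans ?_
    exact resO_resO _ _ _
  res {V V'} h m := by
    have : hρ.extend V' (res M₁ h m) = res M (j.image_mono h) (hρ.extend V m) := hρ.extend_eq (by
      rw [restrictSections_res, hρ.restrictSections_extend, res_res, res_res])
    rw [this, hf.res, restrictSections_res, res_res, res_res]

/-- Restriction of homomorphisms along `j`, on sections: a section of `M₁` over `V` is regarded as a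
section of `M` over `j(V)`, where the given homomorphism can be applied. -/
def homRestrictSections (U : Y.Opens) (f : (homFam M N).carrier U) :
    (homFam M₁ N₁).carrier (j ⁻¹ᵁ U) :=
  ⟨fun k => res N₁ (inf_le_preimage_inf_image U k.1)
    (restrictSections σ _ (f.1 ⟨_, hρ.extend k.1 k.2⟩)), isHomFam_restrict hρ σ f.2⟩

lemma homRestrictSections_apply (U : Y.Opens) (f : (homFam M N).carrier U) (V : Y.Opens)
    (m : Γ(M, V)) : (homRestrictSections hρ σ U f).1 ⟨j ⁻¹ᵁ V, restrictSections ρ V m⟩ =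
      restrictSections σ (U ⊓ V) (f.1 ⟨V, m⟩) := by
  change res N₁ _ (restrictSections σ _ (f.1 ⟨_, hρ.extend _ (restrictSections ρ V m)⟩)) = _
  rw [hρ.extend_restrictSections]
  refine (congrArg (fun n => res N₁ _ (restrictSections σ _ n)) (f.2.res _ m)).trans ?_
  refine (congrArg (res N₁ _) (restrictSections_res σ _ _)).trans ?_
  rw [res_res]
  exact res_self N₁ _ _

/-- A homomorphism over `Y₁` is determined by its values on restrictions of sections. -/
lemma homFam_ext_of_isRestriction (hρ : IsRestriction ρ) {U : Y₁.Opens}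
    {f f' : (homFam M₁ N₁).carrier U}
    (h : ∀ (V : Y.Opens) (m : Γ(M, V)), V ≤ j.opensRange →
      f.1 ⟨j ⁻¹ᵁ V, restrictSections ρ V m⟩ = f'.1 ⟨j ⁻¹ᵁ V, restrictSections ρ V m⟩) : f = f' := by
  refine Subtype.ext (funext fun k => ?_)
  have hle : k.1 ≤ j ⁻¹ᵁ (j ''ᵁ k.1) := (j.preimage_image_eq k.1).ge
  have hk : ∀ f : (homFam M₁ N₁).carrier U, f.1 k = res N₁ (inf_le_inf_left U hle)
      (f.1 ⟨j ⁻¹ᵁ (j ''ᵁ k.1), restrictSections ρ _ (hρ.extend k.1 k.2)⟩) := by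
    intro f
    refine Eq.trans ?_ (f.2.res hle _)
    obtain ⟨V, m⟩ := k
    have : m = res M₁ hle (restrictSections ρ _ (hρ.extend V m)) := by
      rw [hρ.restrictSections_extend, res_res, res_self]
    have key : ∀ m', m = m' → f.1 ⟨V, m⟩ = f.1 ⟨V, m'⟩ := by rintro _ rfl; rfl
    exact key _ this
  rw [hk f, hk f', h _ _ (Scheme.Hom.image_le_opensRange j k.1)]

/-- Restriction of homomorphisms along `j`. -/
def homRestrict : internalHom M N ⟶ (pushforward j).obj (internalHom M₁ N₁) :=
  modulesHomMk _ _
    (fun U =>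
      { toFun := homRestrictSections hρ σ U
        map_zero' := Subtype.ext (funext fun k =>
          (congrArg (res N₁ _) (map_zero (restrictSections σ _))).trans (map_zero _))
        map_add' := fun d e => Subtype.ext (funext fun k =>
          (congrArg (res N₁ _) (map_add (restrictSections σ _) _ _)).trans (map_add _ _ _)) })
    (fun U r d => Subtype.ext (funext fun k => by
      refine (congrArg (res N₁ _) (restrictSections_smul σ _ _ _)).trans ((res_smul _ _ _ _).trans ?_)
      refine congrArg (· • _) ?_
      refine (congrArg (resO Y₁ _) (resO_app j inf_le_left r)).trans ?_
      exact resO_resO _ _ _))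
    (fun {U V} h d => Subtype.ext (funext fun k => by
      refine (congrArg (res N₁ _) (restrictSections_res σ _ _)).trans ?_
      exact (res_res _ _ _ _).trans (res_res _ _ _ _).symm))

variable {σ}

lemma isRestriction_homRestrict (hσ : IsRestriction σ) : IsRestriction (homRestrict hρ σ) := by
  intro U hU
  have hUV : ∀ V : Y.Opens, U ⊓ V ≤ j.opensRange := fun V => inf_le_left.trans hU
  constructor
  · refine (injective_iff_map_eq_zero _).2 fun (f : (homFam M N).carrier U) hf => ?_
    refine Subtype.ext (funext fun k => ?_)
    apply (hσ _ (hUV k.1)).1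
    have h1 : homRestrictSections hρ σ U f = 0 := hf
    refine (homRestrictSections_apply hρ σ U f k.1 k.2).symm.trans ?_
    rw [h1]
    exact (map_zero (restrictSections σ (U ⊓ k.1))).symm
  · intro (f : (homFam M₁ N₁).carrier (j ⁻¹ᵁ U))
    choose e he using fun k : (Σ V : Y.Opens, Γ(M, V)) =>
      (hσ _ (hUV k.1)).2 (f.1 ⟨j ⁻¹ᵁ k.1, restrictSections ρ k.1 k.2⟩)
    have he' : ∀ V m, restrictSections σ (U ⊓ V) (e ⟨V, m⟩) =
      f.1 ⟨j ⁻¹ᵁ V, restrictSections ρ V m⟩ := fun V m => he ⟨V, m⟩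
    have hf := f.2
    have hfe : IsHomFam M N U fun V m => e ⟨V, m⟩ :=
      { add := fun V m m' => by
          apply (hσ _ (hUV V)).1
          rw [map_add, he', he', he', map_add]
          exact hf.add _ _ _
        smul := fun V r m => by
          apply (hσ _ (hUV V)).1
          rw [restrictSections_smul, he', he', restrictSections_smul]
          refine (hf.smul _ _ _).trans ?_
          exact congrArg (· • _) (resO_app j (inf_le_right : U ⊓ V ≤ V) r).symm
        res := fun {V V'} h m => by
          apply (hσ _ (hUV V')).1
          rw [restrictSections_res, he', he', restrictSections_res]
          exact hf.res _ _ }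
    refine ⟨(⟨e, hfe⟩ : (homFam M N).carrier U), ?_⟩
    change homRestrictSections hρ σ U ⟨e, hfe⟩ = f
    refine homFam_ext_of_isRestriction hρ fun V m _ => ?_
    rw [homRestrictSections_apply]
    exact he' V m

end Hom

end OpenRestriction

/-! ### Restriction of spin structures and of `⟨s, dφ⟩` -/

section SpinInclusion

open Scheme.Modules hiding pullback

variable {B : Scheme.{0}} {T' E' T E : Type}

lemma FamSub.ofSection_res {Y : Scheme.{0}} {N : Y.Modules} {κ : Type} {K : κ → Y.Opens}
    (S : FamSub N K) {U V : Y.Opens} (h : V ≤ U) (s : Γ(S.toModules, U)) (k : κ) :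
    S.ofSection (res S.toModules h s) k = res N (inf_le_inf_right (K k) h) (S.ofSection s k) := rfl

lemma FamSub.ofSection_mem {Y : Scheme.{0}} {N : Y.Modules} {κ : Type} {K : κ → Y.Opens}
    (S : FamSub N K) {U : Y.Opens} (s : Γ(S.toModules, U)) : S.ofSection s ∈ S.carrier U :=
  Subtype.property (p := (· ∈ S.carrier U)) s

/-- For sections `s` and `m` of `L` over `U` and `V`, the vector field `s ⊗ m` over `U ∩ V`. -/
def SpinCurve.vectorField (D : SpinCurve B T E) {U V : D.Cn.Opens} (s : Γ(D.L, U))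
    (m : Γ(D.L, V)) : Γ(tangentSheaf (D.ν ≫ D.c), U ⊓ V) :=
  (homFam D.L (tangentSheaf (D.ν ≫ D.c))).ofSection (U := U) (D.spin.hom.app U s) ⟨V, m⟩

/-- A vector field over `U` applied to a function on `W`, which gives a function on `U ∩ W`. -/
def applyField {Y S : Scheme.{0}} {y : Y ⟶ S} {U W : Y.Opens} (q : Γ(tangentSheaf y, U))
    (a : Γ(Y, W)) : Γ(Y, U ⊓ W) :=
  (derFam (𝟙 Y) y (structureModule Y)).ofSection (U := U) q ⟨W, a⟩

lemma SpinCurve.vectorField_res (D : SpinCurve B T E) {U V U' V' : D.Cn.Opens} (s : Γ(D.L, U))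
    (m : Γ(D.L, V)) (hU : U' ≤ U) (hV : V' ≤ V) :
    D.vectorField (res D.L hU s) (res D.L hV m) = res _ (inf_le_inf hU hV) (D.vectorField s m) := by
  have h₁ : D.spin.hom.app U' (res D.L hU s) = res _ hU (D.spin.hom.app U s) := app_res _ _ _
  have h₂ := ((homFam D.L (tangentSheaf (D.ν ≫ D.c))).ofSection_mem (D.spin.hom.app U s)).res hV m
  change (homFam D.L (tangentSheaf (D.ν ≫ D.c))).ofSection (U := U')
    (D.spin.hom.app U' (res D.L hU s)) ⟨V', res D.L hV m⟩ = _
  rw [h₁]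
  refine (FamSub.ofSection_res _ hU _ _).trans ((congrArg (res _ _) h₂).trans ?_)
  exact res_res _ _ _ _

lemma applyField_res {Y S : Scheme.{0}} {y : Y ⟶ S} {U W U' W' : Y.Opens}
    (q : Γ(tangentSheaf y, U)) (a : Γ(Y, W)) (hU : U' ≤ U) (hW : W' ≤ W) :
    applyField (res _ hU q) (resO Y hW a) = resO Y (inf_le_inf hU hW) (applyField q a) := by
  have h₂ := ((derFam (𝟙 Y) y (structureModule Y)).ofSection_mem q).res hW a
  refine (FamSub.ofSection_res _ hU _ _).trans ((congrArg (res _ _) h₂).trans ?_)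
  exact res_res _ _ _ _

/-- The derivative of a function along `s ⊗ m` is computed on any common open subset. -/
lemma SpinCurve.resO_applyField_vectorField (D : SpinCurve B T E) {U V W O : D.Cn.Opens}
    (s : Γ(D.L, U)) (m : Γ(D.L, V)) (a : Γ(D.Cn, W)) (hU : O ≤ U) (hV : O ≤ V) (hW : O ≤ W) :
    resO D.Cn (le_inf (le_inf hU hV) hW) (applyField (D.vectorField s m) a) =
      D.derivative (res D.L hU s) (res D.L hV m) (resO D.Cn hW a) := by
  change _ = resO D.Cn _ (applyField (D.vectorField (res D.L hU s) (res D.L hV m))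
    (resO D.Cn hW a))
  rw [D.vectorField_res, applyField_res, resO_resO]

lemma SpinCurve.derivative_resO (D : SpinCurve B T E) {U O : D.Cn.Opens} (s m : Γ(D.L, U))
    (a : Γ(D.Cn, U)) (h : O ≤ U) :
    D.derivative (res D.L h s) (res D.L h m) (resO D.Cn h a) =
      resO D.Cn h (D.derivative s m a) := by
  rw [← D.resO_applyField_vectorField]
  exact (resO_resO _ _ _).symm

variable {D' : SpinCurve B T' E'} {D : SpinCurve B T E} (I : SpinInclusion D' D)

/-- The restriction of the line bundle `L` to the normalization of a union of components. -/
def SpinInclusion.restrictL : D.L ⟶ (pushforward I.j).obj D'.L :=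
  (restrictAdjunction I.j).unit.app D.L ≫ (pushforward I.j).map I.θ.hom

lemma SpinInclusion.isRestriction_restrictL : IsRestriction I.restrictL := by
  intro U hU
  have h : U ≤ I.j ''ᵁ (I.j ⁻¹ᵁ U) := (image_preimage_eq_of_le hU).ge
  have hθ : Function.Bijective (I.θ.hom.app (I.j ⁻¹ᵁ U)) := ConcreteCategory.bijective_of_isIso _
  exact hθ.comp (res_bijective D.L (I.j.image_preimage_le U) h)

/-- The derivative along `s ⊗ s'` commutes with restriction to a union of components. -/
lemma SpinInclusion.derivative_restrict {O : D.Cn.Opens} (s s' : Γ(D.L, O)) (a : Γ(D.Cn, O)) :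
    D'.derivative (restrictSections I.restrictL O s) (restrictSections I.restrictL O s')
      (I.j.app O a) = I.j.app O (D.derivative s s' a) := by
  have h : ∀ b : Γ(D.Cn, O), I.j.app O b =
      (I.j.appIso (I.j ⁻¹ᵁ O)).hom (resO D.Cn (I.j.image_preimage_le O) b) := by
    intro b
    rw [Scheme.Hom.appIso_hom']
    have := ConcreteCategory.congr_hom (Scheme.Hom.map_appLE I.j (U := I.j ''ᵁ (I.j ⁻¹ᵁ O))
      (V := I.j ⁻¹ᵁ O) (I.j.preimage_image_eq _).ge (homOfLE (I.j.image_preimage_le O)).op) b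
    refine Eq.trans ?_ this.symm
    rw [Scheme.Hom.app_eq_appLE]
  rw [h, h, ← D.derivative_resO]
  exact I.spin_comm (I.j ⁻¹ᵁ O) (show Γ(D.L.restrict I.j, I.j ⁻¹ᵁ O) from
    res D.L (I.j.image_preimage_le O) s) (res D.L (I.j.image_preimage_le O) s') _

end SpinInclusion

section Contraction

open Scheme.Modules hiding pullback

variable {B X S : Scheme.{0}} {b : B ⟶ S} {x : X ⟶ S} {T' E' T E : Type}
  {Φ' : SpinMap b x T' E'} {Φ : SpinMap b x T E}
  (I : SpinInclusion Φ'.toSpinCurve Φ.toSpinCurve) (hφ : I.i ≫ Φ.φ = Φ'.φ)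

/-- The morphism `s ↦ ⟨s, dφ⟩` on the normalization. -/
def SpinMap.contractL (Φ : SpinMap b x T E) :
    Φ.L ⟶ internalHom Φ.L (tangentAlong (Φ.ν ≫ Φ.φ) x) :=
  Φ.spin.hom ≫ internalHomMap Φ.L (differential (Φ.ν ≫ Φ.φ) x (Φ.ν ≫ Φ.c) b Φ.φ_comp')

lemma SpinInclusion.comp_normalization (hφ : I.i ≫ Φ.φ = Φ'.φ) :
    I.j ≫ Φ.ν ≫ Φ.φ = Φ'.ν ≫ Φ'.φ := by
  rw [← hφ, ← Category.assoc, I.comm, Category.assoc]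

/-- Restriction of `ℋom(L, (φ ∘ ν)^* T_X)` to the normalization of a union of components. -/
def SpinInclusion.restrictHom : internalHom Φ.L (tangentAlong (Φ.ν ≫ Φ.φ) x) ⟶
    (pushforward I.j).obj (internalHom Φ'.L (tangentAlong (Φ'.ν ≫ Φ'.φ) x)) :=
  homRestrict I.isRestriction_restrictL
    (derRestrict (I.comp_normalization hφ) x (structureRestrict I.j))

lemma SpinInclusion.isRestriction_restrictHom : IsRestriction (I.restrictHom hφ) :=
  isRestriction_homRestrict _ (isRestriction_derRestrict _ _ isRestriction_structureRestrict)

/-- Contraction with `dφ` commutes with restriction to a union of components: the vector fields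
`s ⊗ m` do, by the compatibility of the spin structures. -/
lemma SpinInclusion.contractL_restrict :
    Φ.contractL ≫ I.restrictHom hφ = I.restrictL ≫ (pushforward I.j).map Φ'.contractL := by
  refine modulesHom_ext fun U s => ?_
  refine homFam_ext_of_isRestriction I.isRestriction_restrictL fun V m hV => ?_
  refine (homRestrictSections_apply I.isRestriction_restrictL
    (derRestrict (I.comp_normalization hφ) x (structureRestrict I.j)) U
    (Φ.contractL.app U s) V m).trans ?_
  refine Subtype.ext (funext fun k => ?_)
  obtain ⟨W, a⟩ := k
  have hW := I.comp_normalization hφ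
  change resO Φ'.Cn (preimage_inf_preimage_le hW (U ⊓ V) W) (I.j.app _
    (applyField (Φ.vectorField s m) ((Φ.ν ≫ Φ.φ).app W a))) =
    applyField (Φ'.vectorField (restrictSections I.restrictL U s) (restrictSections I.restrictL V m))
      ((Φ'.ν ≫ Φ'.φ).app W a)
  -- Both sides are the derivative of the same function along the same vector field.
  set O : Φ.Cn.Opens := (U ⊓ V) ⊓ (Φ.ν ≫ Φ.φ) ⁻¹ᵁ W with hO
  have hU : O ≤ U := inf_le_left.trans inf_le_left
  have hV' : O ≤ V := inf_le_left.trans inf_le_right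
  have hOW : O ≤ (Φ.ν ≫ Φ.φ) ⁻¹ᵁ W := inf_le_right
  have e₁ := Φ.resO_applyField_vectorField s m ((Φ.ν ≫ Φ.φ).app W a) hU hV' hOW
  have e₂ := Φ'.resO_applyField_vectorField (restrictSections I.restrictL U s)
    (restrictSections I.restrictL V m) ((Φ'.ν ≫ Φ'.φ).app W a) (I.j.preimage_mono hU)
    (I.j.preimage_mono hV') ((le_preimage_inf_preimage hW (U ⊓ V) W).trans inf_le_right)
  rw [← restrictSections_res _ hU, ← restrictSections_res _ hV',
    ← resO_app_app hW a hOW (le_refl (I.j ⁻¹ᵁ O)), resO_self, I.derivative_restrict, ← e₁] at e₂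
  have e₃ := congrArg (resO Φ'.Cn (preimage_inf_preimage_le hW (U ⊓ V) W)) e₂
  rw [resO_resO, resO_self] at e₃
  exact e₃.symm.trans (resO_self _ _)

end Contraction

/-! ### The SUSY normal bundle of a glued curve -/

section
open Scheme.Modules hiding pullback

variable {B : Scheme.{0}} {T' E' T E : Type}

section Spinor
variable {D' : SpinCurve B T' E'} {D : SpinCurve B T E} (I : SpinInclusion D' D)

/-- The isomorphism `ν_* j_* N ≅ i_* ν'_* N`. -/
def SpinInclusion.pushforwardIso (N : D'.Cn.Modules) :
    (pushforward D.ν).obj ((pushforward I.j).obj N) ≅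
      (pushforward I.i).obj ((pushforward D'.ν).obj N) :=
  (pushforwardTrans I.comm).app N ≪≫ ((pushforwardTrans rfl).app N).symm

lemma SpinInclusion.pushforwardIso_naturality {N N' : D'.Cn.Modules} (f : N ⟶ N') :
    (pushforward D.ν).map ((pushforward I.j).map f) ≫ (I.pushforwardIso N').hom =
      (I.pushforwardIso N).hom ≫ (pushforward I.i).map ((pushforward D'.ν).map f) := by
  have h₁ := (pushforwardTrans I.comm).hom.naturality f
  have h₂ := (pushforwardTrans (rfl : D'.ν ≫ I.i = _)).inv.naturality f
  simp only [Functor.comp_map] at h₁ h₂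
  simp only [pushforwardIso, Iso.trans_hom, Iso.app_hom, Iso.symm_hom, Iso.app_inv, Category.assoc]
  rw [reassoc_of% h₁, h₂]

/-- Restriction of the spinor bundle to a union of components. -/
def SpinInclusion.restrictSpinor :
    D.spinorBundle ⟶ (pushforward I.i).obj D'.spinorBundle :=
  (pushforward D.ν).map I.restrictL ≫ (I.pushforwardIso _).hom

/-- The morphism `c_* N ⟶ c'_* N'` given by a morphism `N ⟶ i_* N'`. -/
def SpinInclusion.restrictGlobal {N : D.C.Modules} {N' : D'.C.Modules}
    (ρ : N ⟶ (pushforward I.i).obj N') :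
    (pushforward D.c).obj N ⟶ (pushforward D'.c).obj N' :=
  (pushforward D.c).map ρ ≫ (pushforwardTrans I.over_base).hom.app N'

/-- Restriction of the fibre of the spinor bundle along a section that factors through a union of
components. -/
def SpinInclusion.restrictFibre {p : B ⟶ D.C} {p' : B ⟶ D'.C} (h : p' ≫ I.i = p) :
    (Scheme.Modules.pullback p).obj D.spinorBundle ⟶
      (Scheme.Modules.pullback p').obj D'.spinorBundle :=
  (Scheme.Modules.pullback p).map I.restrictSpinor ≫ pullbackPushforwardComparison h _

lemma SpinInclusion.restrictTo_restrictFibre {p : B ⟶ D.C} {p' : B ⟶ D'.C} (h : p' ≫ I.i = p)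
    (hp : p ≫ D.c = 𝟙 B) (hp' : p' ≫ D'.c = 𝟙 B) :
    restrictTo hp D.spinorBundle ≫ I.restrictFibre h =
      I.restrictGlobal I.restrictSpinor ≫ restrictTo hp' D'.spinorBundle := by
  rw [restrictFibre, restrictGlobal, ← Category.assoc, restrictTo_naturality, Category.assoc,
    restrictTo_comparison h _ I.over_base hp hp', Category.assoc]

end Spinor

section Special

/-- The sections that are the tails and the nodes. -/
def SpinCurve.special (D : SpinCurve B T E) : T ⊕ E → (B ⟶ D.C) := Sum.elim D.tail D.node

lemma SpinCurve.special_section (D : SpinCurve B T E) (y : T ⊕ E) : D.special y ≫ D.c = 𝟙 B := by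
  cases y
  · exact D.tail_section _
  · exact D.node_section _

variable [Finite T] [Finite E] (D : SpinCurve B T E)

/-- The projection to the fibre of the spinor bundle along a tail or a node. -/
def SpinCurve.proj : ∀ y : T ⊕ E,
    D.specialFibres ⟶ (Scheme.Modules.pullback (D.special y)).obj D.spinorBundle
  | Sum.inl t => biprod.fst ≫ biproduct.π _ t
  | Sum.inr e => biprod.snd ≫ biproduct.π _ e

lemma SpinCurve.isProductOf_proj : IsProductOf D.proj :=
  IsProductOf.biprod
    (A := fun y : T ⊕ E => (Scheme.Modules.pullback (D.special y)).obj D.spinorBundle)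
    (isProductOf_biproduct fun t : T => (Scheme.Modules.pullback (D.tail t)).obj D.spinorBundle)
    (isProductOf_biproduct fun e : E => (Scheme.Modules.pullback (D.node e)).obj D.spinorBundle)
    (fun _ => rfl) (fun _ => rfl)

lemma SpinCurve.evaluate_proj (y : T ⊕ E) :
    D.evaluate ≫ D.proj y = restrictTo (D.special_section y) D.spinorBundle := by
  cases y
  · exact (biprod.lift_fst_assoc _ _ _).trans (biproduct.lift_π _ _)
  · exact (biprod.lift_snd_assoc _ _ _).trans (biproduct.lift_π _ _)

end Special

section Additive

universe v u
variable {𝒞 𝒟 : Type u} [Category.{v} 𝒞] [Category.{v} 𝒟] [Abelian 𝒞] [Abelian 𝒟]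

lemma isIso_biprod_lift_map (F : 𝒞 ⥤ 𝒟) [F.Additive] {P P₁ P₂ : 𝒞} (f : P ⟶ P₁) (g : P ⟶ P₂)
    (_ : IsIso (biprod.lift f g)) : IsIso (biprod.lift (F.map f) (F.map g)) := by
  obtain ⟨r, hr, hr'⟩ := (inferInstance : IsIso (biprod.lift f g))
  have h₁ : r ≫ f = biprod.fst := by
    rw [← biprod.lift_fst f g, ← Category.assoc, hr', Category.id_comp]
  have h₂ : r ≫ g = biprod.snd := by
    rw [← biprod.lift_snd f g, ← Category.assoc, hr', Category.id_comp]
  have h₃ : f ≫ biprod.inl ≫ r + g ≫ biprod.inr ≫ r = 𝟙 P := by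
    rw [← hr, biprod.lift_eq, Preadditive.add_comp, Category.assoc, Category.assoc]
  refine ⟨biprod.desc (F.map (biprod.inl ≫ r)) (F.map (biprod.inr ≫ r)), ?_, ?_⟩
  · rw [biprod.lift_desc, ← F.map_comp, ← F.map_comp, ← F.map_add, h₃, F.map_id]
  · apply biprod.hom_ext' <;> apply biprod.hom_ext <;>
      simp only [Category.assoc, biprod.inl_desc_assoc, biprod.inr_desc_assoc, biprod.lift_fst,
        biprod.lift_snd, ← F.map_comp, h₁, h₂] <;> simp

lemma isIso_of_isIso_biprod_lift_left {P P₁ P₂ : 𝒞} (f : P ⟶ P₁) (g : P ⟶ P₂)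
    (_ : IsIso (biprod.lift f g)) (h : IsZero P₂) : IsIso f := by
  have h₁ : inv (biprod.lift f g) ≫ f = biprod.fst := by simp [IsIso.inv_comp_eq]
  refine ⟨biprod.inl ≫ inv (biprod.lift f g), ?_, by simp [h₁]⟩
  rw [← cancel_mono (biprod.lift f g)]
  apply biprod.hom_ext
  · simp
  · exact h.eq_of_tgt _ _

lemma isIso_of_isIso_biprod_lift_right {P P₁ P₂ : 𝒞} (f : P ⟶ P₁) (g : P ⟶ P₂)
    (_ : IsIso (biprod.lift f g)) (h : IsZero P₁) : IsIso g := by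
  have h₁ : inv (biprod.lift f g) ≫ g = biprod.snd := by simp [IsIso.inv_comp_eq]
  refine ⟨biprod.inr ≫ inv (biprod.lift f g), ?_, by simp [h₁]⟩
  rw [← cancel_mono (biprod.lift f g)]
  apply biprod.hom_ext
  · exact h.eq_of_tgt _ _
  · simp

lemma isIso_biprod_lift_comp {P P₁ P₂ Q₁ Q₂ : 𝒞} (f : P ⟶ P₁) (g : P ⟶ P₂) (u : P₁ ⟶ Q₁)
    (v : P₂ ⟶ Q₂) (_ : IsIso (biprod.lift f g)) (_ : IsIso u) (_ : IsIso v) :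
    IsIso (biprod.lift (f ≫ u) (g ≫ v)) := by
  have : biprod.lift (f ≫ u) (g ≫ v) = biprod.lift f g ≫ biprod.map u v := by
    apply biprod.hom_ext <;> simp
  rw [this]
  have : IsIso (biprod.map u v) := (biprod.mapIso (asIso u) (asIso v)).isIso_hom
  infer_instance

end Additive

section Gluing

variable {T₁ E₁ T₂ E₂ : Type} {D₁ : SpinCurve B T₁ E₁} {t₁ : T₁} {D₂ : SpinCurve B T₂ E₂} {t₂ : T₂}
  {D : SpinCurve B ({t : T₁ // t ≠ t₁} ⊕ {t : T₂ // t ≠ t₂}) ((E₁ ⊕ E₂) ⊕ Unit)}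
  (G : SpinGluing D₁ t₁ D₂ t₂ D)

/-- The spinor bundle of a glued curve is the direct sum of the spinor bundles of the pieces. -/
lemma SpinGluing.isIso_restrictSpinor :
    IsIso (biprod.lift G.inc₁.restrictSpinor G.inc₂.restrictSpinor) := by
  have := isIso_biprod_lift_of_isRestriction G.disjoint G.inc₁.isRestriction_restrictL
    G.inc₂.isRestriction_restrictL
  exact isIso_biprod_lift_comp _ _ _ _
    (isIso_biprod_lift_map (pushforward D.ν) G.inc₁.restrictL G.inc₂.restrictL this)
    (Iso.isIso_hom _) (Iso.isIso_hom _)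

lemma SpinGluing.isIso_restrictGlobal {N : D.C.Modules} {N₁ : D₁.C.Modules} {N₂ : D₂.C.Modules}
    (ρ₁ : N ⟶ (pushforward G.inc₁.i).obj N₁) (ρ₂ : N ⟶ (pushforward G.inc₂.i).obj N₂)
    (h : IsIso (biprod.lift ρ₁ ρ₂)) :
    IsIso (biprod.lift (G.inc₁.restrictGlobal ρ₁) (G.inc₂.restrictGlobal ρ₂)) :=
  isIso_biprod_lift_comp _ _ _ _ (isIso_biprod_lift_map (pushforward D.c) ρ₁ ρ₂ h)
    inferInstance inferInstance

open Classical in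
/-- The tail or node of the glued curve that is given by a tail or a node of one of the pieces. The
tails `t₁` and `t₂` both become the new node. -/
def graftIndex (t₁ : T₁) (t₂ : T₂) : (T₁ ⊕ E₁) ⊕ (T₂ ⊕ E₂) →
    ({t : T₁ // t ≠ t₁} ⊕ {t : T₂ // t ≠ t₂}) ⊕ ((E₁ ⊕ E₂) ⊕ Unit)
  | Sum.inl (Sum.inl t) => if h : t = t₁ then Sum.inr (Sum.inr ()) else Sum.inl (Sum.inl ⟨t, h⟩)
  | Sum.inl (Sum.inr e) => Sum.inr (Sum.inl (Sum.inl e))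
  | Sum.inr (Sum.inl t) => if h : t = t₂ then Sum.inr (Sum.inr ()) else Sum.inl (Sum.inr ⟨t, h⟩)
  | Sum.inr (Sum.inr e) => Sum.inr (Sum.inl (Sum.inr e))

lemma eq_of_graftIndex_eq_inl_inl {k : (T₁ ⊕ E₁) ⊕ (T₂ ⊕ E₂)} {t : {t : T₁ // t ≠ t₁}}
    (h : graftIndex t₁ t₂ k = Sum.inl (Sum.inl t)) : k = Sum.inl (Sum.inl t.1) := by
  obtain (t' | e) | (t' | e) := k <;> simp only [graftIndex] at h <;> (try split_ifs at h) <;>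
    cases h
  rfl

lemma eq_of_graftIndex_eq_inl_inr {k : (T₁ ⊕ E₁) ⊕ (T₂ ⊕ E₂)} {t : {t : T₂ // t ≠ t₂}}
    (h : graftIndex t₁ t₂ k = Sum.inl (Sum.inr t)) : k = Sum.inr (Sum.inl t.1) := by
  obtain (t' | e) | (t' | e) := k <;> simp only [graftIndex] at h <;> (try split_ifs at h) <;>
    cases h
  rfl

lemma eq_of_graftIndex_eq_inr_inl_inl {k : (T₁ ⊕ E₁) ⊕ (T₂ ⊕ E₂)} {e : E₁}
    (h : graftIndex t₁ t₂ k = Sum.inr (Sum.inl (Sum.inl e))) : k = Sum.inl (Sum.inr e) := by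
  obtain (t' | e) | (t' | e) := k <;> simp only [graftIndex] at h <;> (try split_ifs at h) <;>
    cases h
  rfl

lemma eq_of_graftIndex_eq_inr_inl_inr {k : (T₁ ⊕ E₁) ⊕ (T₂ ⊕ E₂)} {e : E₂}
    (h : graftIndex t₁ t₂ k = Sum.inr (Sum.inl (Sum.inr e))) : k = Sum.inr (Sum.inr e) := by
  obtain (t' | e) | (t' | e) := k <;> simp only [graftIndex] at h <;> (try split_ifs at h) <;>
    cases h
  rfl

lemma eq_or_eq_of_graftIndex_eq_inr_inr {k : (T₁ ⊕ E₁) ⊕ (T₂ ⊕ E₂)}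
    (h : graftIndex t₁ t₂ k = Sum.inr (Sum.inr ())) :
    k = Sum.inl (Sum.inl t₁) ∨ k = Sum.inr (Sum.inl t₂) := by
  obtain (t' | e) | (t' | e) := k <;> simp only [graftIndex] at h <;> (try split_ifs at h with ht) <;>
    cases h
  · exact Or.inl (by rw [ht])
  · exact Or.inr (by rw [ht])

lemma SpinGluing.special_graftIndex_inl (y : T₁ ⊕ E₁) :
    D₁.special y ≫ G.inc₁.i = D.special (graftIndex t₁ t₂ (Sum.inl y)) := by
  obtain t | e := y
  · by_cases h : t = t₁
    · subst h
      simp [graftIndex, SpinCurve.special, G.node]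
    · simp [graftIndex, SpinCurve.special, h, G.tail₁]
  · simp [graftIndex, SpinCurve.special, G.node₁]

lemma SpinGluing.special_graftIndex_inr (y : T₂ ⊕ E₂) :
    D₂.special y ≫ G.inc₂.i = D.special (graftIndex t₁ t₂ (Sum.inr y)) := by
  obtain t | e := y
  · by_cases h : t = t₂
    · subst h
      simp [graftIndex, SpinCurve.special, G.node, G.glued.comm]
    · simp [graftIndex, SpinCurve.special, h, G.tail₂]
  · simp [graftIndex, SpinCurve.special, G.node₂]

/-- The fibre of the spinor bundle along a tail or a node of one of the pieces. -/
def pieceFibre (D₁ : SpinCurve B T₁ E₁) (D₂ : SpinCurve B T₂ E₂) :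
    (T₁ ⊕ E₁) ⊕ (T₂ ⊕ E₂) → B.Modules
  | Sum.inl y => (Scheme.Modules.pullback (D₁.special y)).obj D₁.spinorBundle
  | Sum.inr y => (Scheme.Modules.pullback (D₂.special y)).obj D₂.spinorBundle

/-- Restriction of a fibre of the spinor bundle to one of the pieces. -/
def SpinGluing.restrictPiece (y : ({t : T₁ // t ≠ t₁} ⊕ {t : T₂ // t ≠ t₂}) ⊕ ((E₁ ⊕ E₂) ⊕ Unit)) :
    ∀ k : (T₁ ⊕ E₁) ⊕ (T₂ ⊕ E₂), graftIndex t₁ t₂ k = y →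
      ((Scheme.Modules.pullback (D.special y)).obj D.spinorBundle ⟶ pieceFibre D₁ D₂ k)
  | Sum.inl k, h => G.inc₁.restrictFibre (by rw [← h, G.special_graftIndex_inl])
  | Sum.inr k, h => G.inc₂.restrictFibre (by rw [← h, G.special_graftIndex_inr])

/-- The tail `t` is disjoint from all other tails and from all nodes. -/
def SpinCurve.Avoids (D : SpinCurve B T E) (t : T) : Prop :=
  ∀ y : T ⊕ E, y ≠ Sum.inl t → ∀ b b' : B, D.special y b ≠ D.tail t b'

/-- At a special point away from the gluing, the spinor bundle is that of one piece; at the new node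
it is the sum of the fibres at the two tails. -/
lemma SpinGluing.isProductOf_restrictPiece (h₁ : D₁.Avoids t₁) (h₂ : D₂.Avoids t₂) (y) :
    IsProductOf fun k : {k // graftIndex t₁ t₂ k = y} => G.restrictPiece y k.1 k.2 := by
  have hc₁ := G.glued.closed₁
  have hc₂ := G.glued.closed₂
  have hS := G.isIso_restrictSpinor
  have := isIso_biprod_lift_map (Scheme.Modules.pullback (D.special y)) G.inc₁.restrictSpinor
    G.inc₂.restrictSpinor hS
  -- A section of the first piece other than the tail `t₁` misses the second piece.
  have left : ∀ k (hk : graftIndex t₁ t₂ (Sum.inl k) = y), k ≠ Sum.inl t₁ →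
      IsIso (G.restrictPiece y (Sum.inl k) hk) := by
    intro k hk hne
    have hz : IsZero ((Scheme.Modules.pullback (D.special y)).obj
        ((pushforward G.inc₂.i).obj D₂.spinorBundle)) := by
      refine isZero_pullback_pushforward _ fun b z hbz => ?_
      rw [← hk, ← G.special_graftIndex_inl, Scheme.Hom.comp_apply] at hbz
      obtain ⟨b', hb', -⟩ := G.glued.meet _ _ hbz
      exact h₁ k hne b b' hb'.symm
    have := isIso_of_isIso_biprod_lift_left _ _ this hz
    exact IsIso.comp_isIso' this (isIso_pullbackPushforwardComparison _ _)
  have right : ∀ k (hk : graftIndex t₁ t₂ (Sum.inr k) = y), k ≠ Sum.inl t₂ →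
      IsIso (G.restrictPiece y (Sum.inr k) hk) := by
    intro k hk hne
    have hz : IsZero ((Scheme.Modules.pullback (D.special y)).obj
        ((pushforward G.inc₁.i).obj D₁.spinorBundle)) := by
      refine isZero_pullback_pushforward _ fun b z hbz => ?_
      rw [← hk, ← G.special_graftIndex_inr, Scheme.Hom.comp_apply] at hbz
      obtain ⟨b', -, hb'⟩ := G.glued.meet _ _ hbz.symm
      exact h₂ k hne b b' hb'.symm
    have := isIso_of_isIso_biprod_lift_right _ _ this hz
    exact IsIso.comp_isIso' this (isIso_pullbackPushforwardComparison _ _)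
  have single : ∀ k₀ : {k // graftIndex t₁ t₂ k = y}, (∀ k, k = k₀) → k₀.1 ≠ Sum.inl (Sum.inl t₁) →
      k₀.1 ≠ Sum.inr (Sum.inl t₂) →
      IsProductOf fun k : {k // graftIndex t₁ t₂ k = y} => G.restrictPiece y k.1 k.2 := by
    rintro ⟨k | k, hk⟩ hu hne₁ hne₂
    · have := left k hk fun h => hne₁ (congrArg Sum.inl h)
      exact IsProductOf.of_unique ⟨Sum.inl k, hk⟩ hu _
    · have := right k hk fun h => hne₂ (congrArg Sum.inr h)
      exact IsProductOf.of_unique ⟨Sum.inr k, hk⟩ hu _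
  obtain (⟨t, ht⟩ | ⟨t, ht⟩) | ((e | e) | ⟨⟩) := y
  · refine single ⟨Sum.inl (Sum.inl t), by simp [graftIndex, ht]⟩ ?_ (by simpa using ht) (by simp)
    exact fun k => Subtype.ext (eq_of_graftIndex_eq_inl_inl k.2)
  · refine single ⟨Sum.inr (Sum.inl t), by simp [graftIndex, ht]⟩ ?_ (by simp) (by simpa using ht)
    exact fun k => Subtype.ext (eq_of_graftIndex_eq_inl_inr k.2)
  · refine single ⟨Sum.inl (Sum.inr e), by simp [graftIndex]⟩ ?_ (by simp) (by simp)
    exact fun k => Subtype.ext (eq_of_graftIndex_eq_inr_inl_inl k.2)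
  · refine single ⟨Sum.inr (Sum.inr e), by simp [graftIndex]⟩ ?_ (by simp) (by simp)
    exact fun k => Subtype.ext (eq_of_graftIndex_eq_inr_inl_inr k.2)
  · have hk₁ : graftIndex t₁ t₂ (Sum.inl (Sum.inl t₁) : (T₁ ⊕ E₁) ⊕ (T₂ ⊕ E₂)) =
        Sum.inr (Sum.inr ()) := by simp [graftIndex]
    have hk₂ : graftIndex t₁ t₂ (Sum.inr (Sum.inl t₂) : (T₁ ⊕ E₁) ⊕ (T₂ ⊕ E₂)) =
        Sum.inr (Sum.inr ()) := by simp [graftIndex]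
    have hiso : IsIso (biprod.lift (G.restrictPiece (Sum.inr (Sum.inr ())) (Sum.inl (Sum.inl t₁)) hk₁)
        (G.restrictPiece (Sum.inr (Sum.inr ())) (Sum.inr (Sum.inl t₂)) hk₂)) :=
      isIso_biprod_lift_comp _ _ _ _ this (isIso_pullbackPushforwardComparison _ _)
        (isIso_pullbackPushforwardComparison _ _)
    intro Z f
    obtain ⟨w, ⟨hw₁, hw₂⟩, hw⟩ := existsUnique_of_isIso_biprod_lift
      (G.restrictPiece (Sum.inr (Sum.inr ())) (Sum.inl (Sum.inl t₁)) hk₁)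
      (G.restrictPiece (Sum.inr (Sum.inr ())) (Sum.inr (Sum.inl t₂)) hk₂) (f ⟨_, hk₁⟩) (f ⟨_, hk₂⟩)
    refine ⟨w, ?_, fun w' h => hw w' ⟨h ⟨_, hk₁⟩, h ⟨_, hk₂⟩⟩⟩
    have hcases : ∀ k : {k : (T₁ ⊕ E₁) ⊕ (T₂ ⊕ E₂) // graftIndex t₁ t₂ k = Sum.inr (Sum.inr ())},
        k = ⟨_, hk₁⟩ ∨ k = ⟨_, hk₂⟩ := by
      intro k
      exact (eq_or_eq_of_graftIndex_eq_inr_inr k.2).imp Subtype.ext Subtype.ext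
    intro k
    obtain rfl | rfl := hcases k
    · exact hw₁
    · exact hw₂

variable [Finite T₁] [Finite E₁] [Finite T₂] [Finite E₂]

/-- The fibres at the special points of a glued curve are the sum of those for the two pieces. -/
lemma SpinGluing.exists_restrictSpecial (h₁ : D₁.Avoids t₁) (h₂ : D₂.Avoids t₂) :
    ∃ (b₁ : D.specialFibres ⟶ D₁.specialFibres) (b₂ : D.specialFibres ⟶ D₂.specialFibres),
      IsIso (biprod.lift b₁ b₂) ∧
      D.evaluate ≫ b₁ = G.inc₁.restrictGlobal G.inc₁.restrictSpinor ≫ D₁.evaluate ∧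
      D.evaluate ≫ b₂ = G.inc₂.restrictGlobal G.inc₂.restrictSpinor ≫ D₂.evaluate := by
  obtain ⟨b₁, hb₁, -⟩ := D₁.isProductOf_proj D.specialFibres fun y =>
    D.proj (graftIndex t₁ t₂ (Sum.inl y)) ≫ G.inc₁.restrictFibre (G.special_graftIndex_inl y)
  obtain ⟨b₂, hb₂, -⟩ := D₂.isProductOf_proj D.specialFibres fun y =>
    D.proj (graftIndex t₁ t₂ (Sum.inr y)) ≫ G.inc₂.restrictFibre (G.special_graftIndex_inr y)
  refine ⟨b₁, b₂, ?_, D₁.isProductOf_proj.hom_ext fun y => ?_,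
    D₂.isProductOf_proj.hom_ext fun y => ?_⟩
  · have hP := D.isProductOf_proj.trans (graftIndex t₁ t₂) G.restrictPiece
      (G.isProductOf_restrictPiece h₁ h₂)
    let π : ∀ k, D₁.specialFibres ⊞ D₂.specialFibres ⟶ pieceFibre D₁ D₂ k := fun k =>
      match k with
      | Sum.inl y => biprod.fst ≫ D₁.proj y
      | Sum.inr y => biprod.snd ≫ D₂.proj y
    have hQ : IsProductOf π := IsProductOf.biprod (A := pieceFibre D₁ D₂) D₁.isProductOf_proj
      D₂.isProductOf_proj (fun _ => rfl) (fun _ => rfl)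
    refine hP.isIso hQ _ ?_
    rintro (y | y)
    · exact (biprod.lift_fst_assoc _ _ _).trans (hb₁ y)
    · exact (biprod.lift_snd_assoc _ _ _).trans (hb₂ y)
  · rw [Category.assoc, Category.assoc, hb₁, ← Category.assoc, D.evaluate_proj, D₁.evaluate_proj]
    exact G.inc₁.restrictTo_restrictFibre _ _ _
  · rw [Category.assoc, Category.assoc, hb₂, ← Category.assoc, D.evaluate_proj, D₂.evaluate_proj]
    exact G.inc₂.restrictTo_restrictFibre _ _ _

include G in
/-- Source and target of the evaluation at the special points split compatibly, hence so does its
cokernel. -/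
lemma SpinGluing.nonempty_normalBundle_iso (h₁ : D₁.Avoids t₁) (h₂ : D₂.Avoids t₂) :
    Nonempty (D.normalBundle ≅ D₁.normalBundle ⊞ D₂.normalBundle) := by
  obtain ⟨b₁, b₂, hb, w₁, w₂⟩ := G.exists_restrictSpecial h₁ h₂
  exact nonempty_cokernel_iso_biprod w₁ w₂
    (G.isIso_restrictGlobal _ _ G.isIso_restrictSpinor) hb

end Gluing

/-! ### The SUSY normal bundle of a map on a glued curve -/

section Maps

variable {X S : Scheme.{0}} {b : B ⟶ S} {x : X ⟶ S}
  {Φ' : SpinMap b x T' E'} {Φ : SpinMap b x T E}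
  (I : SpinInclusion Φ'.toSpinCurve Φ.toSpinCurve) (hφ : I.i ≫ Φ.φ = Φ'.φ)

/-- Restriction of `S_C^∨ ⊗ φ^* T_X` to a union of components. -/
def SpinInclusion.restrictTwisted :
    Φ.twistedTangent ⟶ (pushforward I.i).obj Φ'.twistedTangent :=
  (pushforward Φ.ν).map (I.restrictHom hφ) ≫ (I.pushforwardIso _).hom

lemma SpinInclusion.contract_restrict :
    Φ.contract ≫ I.restrictTwisted hφ = I.restrictSpinor ≫ (pushforward I.i).map Φ'.contract := by
  have h := congrArg (pushforward Φ.ν).map (I.contractL_restrict hφ)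
  rw [Functor.map_comp, Functor.map_comp] at h
  have h' := I.pushforwardIso_naturality Φ'.contractL
  change (pushforward Φ.ν).map Φ.contractL ≫ (pushforward Φ.ν).map (I.restrictHom hφ) ≫
    (I.pushforwardIso _).hom = ((pushforward Φ.ν).map I.restrictL ≫ (I.pushforwardIso _).hom) ≫
      (pushforward I.i).map ((pushforward Φ'.ν).map Φ'.contractL)
  rw [reassoc_of% h, h', Category.assoc]

lemma SpinInclusion.restrictGlobal_comp {N M : Φ.C.Modules} {N' M' : Φ'.C.Modules}
    (ρ : N ⟶ (pushforward I.i).obj N') (σ : M ⟶ (pushforward I.i).obj M') (f : N ⟶ M) (f' : N' ⟶ M')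
    (h : f ≫ σ = ρ ≫ (pushforward I.i).map f') :
    (pushforward Φ.c).map f ≫ I.restrictGlobal σ =
      I.restrictGlobal ρ ≫ (pushforward Φ'.c).map f' := by
  have h' := congrArg (pushforward Φ.c).map h
  rw [Functor.map_comp, Functor.map_comp] at h'
  have h₁ := (pushforwardTrans I.over_base).hom.naturality f'
  rw [restrictGlobal, restrictGlobal, reassoc_of% h', Category.assoc, ← h₁]
  rfl

end Maps

section MapGluing

variable {X S : Scheme.{0}} {b : B ⟶ S} {x : X ⟶ S} {T₁ E₁ T₂ E₂ : Type}
  [Finite T₁] [Finite E₁] [Finite T₂] [Finite E₂]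
  {Φ₁ : SpinMap b x T₁ E₁} {t₁ : T₁} {Φ₂ : SpinMap b x T₂ E₂} {t₂ : T₂}
  {Φ : SpinMap b x ({t : T₁ // t ≠ t₁} ⊕ {t : T₂ // t ≠ t₂}) ((E₁ ⊕ E₂) ⊕ Unit)}
  (G : SpinGluing Φ₁.toSpinCurve t₁ Φ₂.toSpinCurve t₂ Φ.toSpinCurve)
  (hφ₁ : G.inc₁.i ≫ Φ.φ = Φ₁.φ) (hφ₂ : G.inc₂.i ≫ Φ.φ = Φ₂.φ)

include hφ₁ hφ₂ in
lemma SpinGluing.nonempty_map_normalBundle_iso (h₁ : Φ₁.Avoids t₁) (h₂ : Φ₂.Avoids t₂) :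
    Nonempty (Φ.normalBundle ≅ Φ₁.normalBundle ⊞ Φ₂.normalBundle) := by
  obtain ⟨b₁, b₂, hb, w₁, w₂⟩ := G.exists_restrictSpecial h₁ h₂
  have hT : IsIso (biprod.lift (G.inc₁.restrictTwisted hφ₁) (G.inc₂.restrictTwisted hφ₂)) :=
    isIso_biprod_lift_comp _ _ _ _ (isIso_biprod_lift_map (pushforward Φ.ν) _ _
      (isIso_biprod_lift_of_isRestriction G.disjoint (G.inc₁.isRestriction_restrictHom hφ₁)
        (G.inc₂.isRestriction_restrictHom hφ₂))) (Iso.isIso_hom _) (Iso.isIso_hom _)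
  refine nonempty_cokernel_iso_biprod
    (b₁ := biprod.map b₁ (G.inc₁.restrictGlobal (G.inc₁.restrictTwisted hφ₁)))
    (b₂ := biprod.map b₂ (G.inc₂.restrictGlobal (G.inc₂.restrictTwisted hφ₂))) ?_ ?_
    (G.isIso_restrictGlobal _ _ G.isIso_restrictSpinor)
    (isIso_biprod_lift_biprod_map hb (G.isIso_restrictGlobal _ _ hT))
  · have h := G.inc₁.restrictGlobal_comp _ _ _ _ (G.inc₁.contract_restrict hφ₁)
    apply biprod.hom_ext
    · simp [w₁]
    · simp [h]
  · have h := G.inc₂.restrictGlobal_comp _ _ _ _ (G.inc₂.contract_restrict hφ₂)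
    apply biprod.hom_ext
    · simp [w₂]
    · simp [h]

end MapGluing

end

/-! ### Local rings at rational points of smooth curves -/

section LocalAlgebra

/-- A reduced Noetherian local ring with principal maximal ideal is a domain. -/
lemma isDomain_of_maximalIdeal_eq_span {L : Type*} [CommRing L] [IsLocalRing L] [IsNoetherianRing L]
    [IsReduced L] (t : L) (ht : IsLocalRing.maximalIdeal L = Ideal.span {t}) : IsDomain L := by
  -- By the intersection theorem of Krull, a nonzero element is a unit times a power of `t`.
  have key : ∀ a : L, a ≠ 0 → ∃ (n : ℕ) (u : L), IsUnit u ∧ a = t ^ n * u := by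
    intro a ha
    have hn : ∃ n, a ∉ IsLocalRing.maximalIdeal L ^ n := by
      by_contra! h
      have h0 := Ideal.iInf_pow_eq_bot_of_isLocalRing (IsLocalRing.maximalIdeal L)
        (IsLocalRing.maximalIdeal.isMaximal L).ne_top
      exact ha (by simpa [h0] using (Submodule.mem_iInf _).2 h)
    classical
    obtain ⟨m, hm⟩ : ∃ m, Nat.find hn = m + 1 := Nat.exists_eq_succ_of_ne_zero fun h => by
      have := Nat.find_spec hn
      rw [h] at this
      simp at this
    have hmem : a ∈ IsLocalRing.maximalIdeal L ^ m := by
      by_contra h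
      have := Nat.find_min' hn h
      omega
    rw [ht, Ideal.span_singleton_pow, Ideal.mem_span_singleton] at hmem
    obtain ⟨u, rfl⟩ := hmem
    refine ⟨m, u, ?_, rfl⟩
    by_contra hu
    have hu' : u ∈ IsLocalRing.maximalIdeal L := hu
    apply Nat.find_spec hn
    rw [hm, ht, Ideal.span_singleton_pow, Ideal.mem_span_singleton]
    rw [ht, Ideal.mem_span_singleton] at hu'
    obtain ⟨v, rfl⟩ := hu'
    exact ⟨v, by ring⟩
  refine @NoZeroDivisors.to_isDomain _ _ _ ⟨fun {a b} hab => ?_⟩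
  by_contra! h
  obtain ⟨i, u, hu, rfl⟩ := key a h.1
  obtain ⟨j, v, hv, rfl⟩ := key b h.2
  -- Thus `t` is nilpotent, and so it vanishes.
  have h0 : t ^ (i + j) = 0 := by
    have : t ^ (i + j) * (u * v) = 0 := by rw [← hab]; ring
    exact (hu.mul hv).mul_left_eq_zero.1 this
  have ht0 : t = 0 := eq_zero_of_pow_eq_zero h0
  obtain rfl | hi := Nat.eq_zero_or_pos i
  · obtain rfl | hj := Nat.eq_zero_or_pos j
    · simp at h0
    · exact h.2 (by rw [ht0, zero_pow hj.ne', zero_mul])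
  · exact h.1 (by rw [ht0, zero_pow hi.ne', zero_mul])

variable {R A : Type*} [CommRing R] [CommRing A] [Algebra R A] (ε : A →ₐ[R] R)

lemma sub_algebraMap_mem_ker (a : A) : a - algebraMap R A (ε a) ∈ RingHom.ker ε := by
  rw [RingHom.mem_ker, map_sub, AlgHom.commutes, Algebra.algebraMap_self, RingHom.id_apply, sub_self]

/-- The derivation `a ↦ a - ε(a)` with values in the cotangent space of a section `ε`. -/
def cotangentDerivation : Derivation R A (RingHom.ker ε).Cotangent :=
  Derivation.mk'
    { toFun := fun a => (RingHom.ker ε).toCotangent ⟨_, sub_algebraMap_mem_ker ε a⟩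
      map_add' := fun a b => by
        rw [← map_add]
        congr 1
        apply Subtype.ext
        simp only [map_add, Submodule.coe_add]
        ring
      map_smul' := fun r a => by
        refine Eq.trans ?_ (algebraMap_smul A r _)
        rw [← map_smul]
        congr 1
        apply Subtype.ext
        simp only [Algebra.smul_def, map_mul, AlgHom.commutes, Algebra.algebraMap_self,
          RingHom.id_apply, Submodule.coe_smul]
        ring }
    fun a b => by
      change (RingHom.ker ε).toCotangent _ = a • (RingHom.ker ε).toCotangent _ +
        b • (RingHom.ker ε).toCotangent _
      rw [← map_smul, ← map_smul, ← map_add, Ideal.toCotangent_eq]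
      simp only [map_mul, Submodule.coe_add, Submodule.coe_smul, smul_eq_mul]
      have h := Ideal.mul_mem_mul (sub_algebraMap_mem_ker ε a) (sub_algebraMap_mem_ker ε b)
      rw [← pow_two] at h
      convert neg_mem h using 1
      ring

/-- If `Ω[A⁄R]` is free of rank one, then the cotangent space of a section is generated by one element:
the differentials generate it. -/
lemma exists_ker_le_span_sup_sq (e : Ω[A⁄R] ≃ₗ[A] A) :
    ∃ t ∈ RingHom.ker ε, RingHom.ker ε ≤ Ideal.span {t} ⊔ RingHom.ker ε ^ 2 := by
  obtain ⟨t, ht⟩ := (RingHom.ker ε).toCotangent_surjective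
    ((cotangentDerivation ε).liftKaehlerDifferential (e.symm 1))
  refine ⟨t, t.2, fun x hx => ?_⟩
  have h : (RingHom.ker ε).toCotangent ⟨x, hx⟩ =
      (RingHom.ker ε).toCotangent (e (KaehlerDifferential.D R A x) • t) := by
    rw [map_smul, ht, ← map_smul, ← map_smul, smul_eq_mul, mul_one, LinearEquiv.symm_apply_apply,
      Derivation.liftKaehlerDifferential_comp_D]
    change _ = (RingHom.ker ε).toCotangent _
    congr 1
    apply Subtype.ext
    have hx' : ε x = 0 := hx
    simp [hx']
  rw [Ideal.toCotangent_eq] at h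
  have : x = e (KaehlerDifferential.D R A x) * t +
      (x - e (KaehlerDifferential.D R A x) * t) := by ring
  rw [this]
  exact Submodule.add_mem_sup (Ideal.mem_span_singleton.2 (Dvd.intro_left _ rfl)) h

variable [(RingHom.ker ε).IsPrime] (L : Type*) [CommRing L] [Algebra A L]

/-- The local ring at a rational point of a smooth curve is a domain: the cotangent space is spanned
by one element, so by the lemma of Nakayama the maximal ideal is principal. -/
lemma isDomain_of_kaehlerDifferential_equiv [IsLocalization.AtPrime L (RingHom.ker ε)]
    [IsNoetherianRing L] [IsReduced L] (e : Ω[A⁄R] ≃ₗ[A] A) : IsDomain L := by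
  have := IsLocalization.AtPrime.isLocalRing L (RingHom.ker ε)
  obtain ⟨t, ht, hle⟩ := exists_ker_le_span_sup_sq ε e
  have hm := IsLocalization.AtPrime.map_eq_maximalIdeal (RingHom.ker ε) L
  refine isDomain_of_maximalIdeal_eq_span (algebraMap A L t) (le_antisymm ?_ ?_)
  · refine Submodule.le_of_le_smul_of_le_jacobson_bot (I := IsLocalRing.maximalIdeal L)
      (IsNoetherian.noetherian _) (IsLocalRing.maximalIdeal_le_jacobson ⊥) ?_
    rw [smul_eq_mul, ← pow_two]
    have := Ideal.map_mono (f := algebraMap A L) hle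
    rwa [Ideal.map_sup, Ideal.map_pow, Ideal.map_span, Set.image_singleton, hm] at this
  · rw [Ideal.span_le, Set.singleton_subset_iff, ← hm]
    exact Ideal.mem_map_of_mem _ ht

/-- The local ring at a rational point of a smooth curve is not a field: otherwise all differentials
would vanish at that point. -/
lemma not_isField_of_kaehlerDifferential_equiv [IsLocalization.AtPrime L (RingHom.ker ε)]
    (e : Ω[A⁄R] ≃ₗ[A] A) : ¬ IsField L := by
  intro hL
  have := IsLocalization.AtPrime.isLocalRing L (RingHom.ker ε)
  have hm := IsLocalization.AtPrime.map_eq_maximalIdeal (RingHom.ker ε) L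
  rw [IsLocalRing.isField_iff_maximalIdeal_eq.1 hL] at hm
  have hD : ∀ a, e (KaehlerDifferential.D R A a) ∈ RingHom.ker ε := by
    intro a
    set x := a - algebraMap R A (ε a) with hx
    have hxm : x ∈ RingHom.ker ε := sub_algebraMap_mem_ker ε a
    have hDx : KaehlerDifferential.D R A a = KaehlerDifferential.D R A x := by
      rw [hx, map_sub, Derivation.map_algebraMap, sub_zero]
    have h0 : algebraMap A L x = 0 := by
      have := Ideal.mem_map_of_mem (algebraMap A L) hxm
      rwa [hm] at this
    obtain ⟨⟨s, hs⟩, hsx⟩ := (IsLocalization.map_eq_zero_iff (RingHom.ker ε).primeCompl L x).1 h0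
    have h1 : s • KaehlerDifferential.D R A x + x • KaehlerDifferential.D R A s = 0 := by
      rw [← Derivation.leibniz]
      exact (congrArg _ hsx).trans (map_zero _)
    have h2 := congrArg e h1
    rw [map_add, map_smul, map_smul, map_zero, smul_eq_mul, smul_eq_mul] at h2
    have h3 : s * e (KaehlerDifferential.D R A x) ∈ RingHom.ker ε := by
      rw [eq_neg_of_add_eq_zero_left h2]
      exact neg_mem (Ideal.mul_mem_right _ _ hxm)
    rw [hDx]
    exact (Ideal.IsPrime.mem_or_mem inferInstance h3).resolve_left hs
  have hall : ∀ ω : Ω[A⁄R], e ω ∈ RingHom.ker ε := by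
    intro ω
    have : ω ∈ Submodule.span A (Set.range (KaehlerDifferential.D R A)) := by
      rw [KaehlerDifferential.span_range_derivation]; trivial
    have hle : Submodule.span A (Set.range (KaehlerDifferential.D R A)) ≤
        Submodule.comap e.toLinearMap (RingHom.ker ε) :=
      Submodule.span_le.2 (by rintro _ ⟨a, rfl⟩; exact hD a)
    exact hle this
  have := hall (e.symm 1)
  rw [LinearEquiv.apply_symm_apply] at this
  exact Ideal.IsPrime.ne_top inferInstance ((Ideal.eq_top_iff_one _).2 this)

end LocalAlgebra

section RationalPoints

variable {K : Type} [Field K] (pt : ↥(Spec (CommRingCat.of K)))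

lemma isField_sections_of_mem (U : (Spec (CommRingCat.of K)).Opens)
    (hU : pt ∈ U) : IsField Γ(Spec (CommRingCat.of K), U) := by
  have : U = ⊤ := by
    apply TopologicalSpace.Opens.ext
    exact Set.eq_univ_of_forall fun y => by
      rwa [show y = pt from Subsingleton.elim _ _]
  subst this
  exact (Scheme.ΓSpecIso (CommRingCat.of K)).commRingCatIsoToRingEquiv.toMulEquiv.isField
    (Field.toIsField K)

/-- The local ring at a rational point of a reduced smooth curve. -/
lemma isDomain_and_not_isField_stalk_of_smooth {W : Scheme.{0}} (g : W ⟶ Spec (CommRingCat.of K))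
    [SmoothOfRelativeDimension 1 g] [AlgebraicGeometry.IsReduced W]
    (σ : Spec (CommRingCat.of K) ⟶ W) (hσ : σ ≫ g = 𝟙 _) :
    IsDomain (W.presheaf.stalk (σ (pt))) ∧
      ¬ IsField (W.presheaf.stalk (σ (pt))) := by
  have : Smooth g := SmoothOfRelativeDimension.smooth 1 g
  have : IsLocallyNoetherian W := LocallyOfFiniteType.isLocallyNoetherian g
  obtain ⟨U, hU, V, hV, hx, e, hs⟩ :=
    SmoothOfRelativeDimension.exists_isStandardSmoothOfRelativeDimension (n := 1) (f := g)
      (σ (pt))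
  have hpt : pt ∈ U := by
    have h := e hx
    have h' : (σ ≫ g) (pt) ∈ U := by rwa [Scheme.Hom.comp_apply]
    rwa [hσ] at h'
  have hF := isField_sections_of_mem pt U hpt
  have e' : U ≤ σ ⁻¹ᵁ V := fun y _ => by
    rw [show y = pt from Subsingleton.elim _ _]
    exact hx
  algebraize [(g.appLE U V e).hom]
  have hs' : Algebra.IsStandardSmoothOfRelativeDimension 1 Γ(Spec (CommRingCat.of K), U) Γ(W, V) := hs
  let ε : Γ(W, V) →ₐ[Γ(Spec (CommRingCat.of K), U)] Γ(Spec (CommRingCat.of K), U) :=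
    { (σ.appLE V U e').hom with
      commutes' := fun r => by
        have h := Scheme.Hom.appLE_comp_appLE σ g U V U e e'
        have h₂ : ∀ (τ : Spec (CommRingCat.of K) ⟶ Spec (CommRingCat.of K)) (_ : τ = 𝟙 _)
            (hτ : U ≤ τ ⁻¹ᵁ U), τ.appLE U U hτ = 𝟙 _ := by
          rintro _ rfl _
          rw [Scheme.Hom.appLE, Scheme.Hom.id_app]
          exact (Category.id_comp _).trans ((Spec (CommRingCat.of K)).presheaf.map_id _)
        exact ConcreteCategory.congr_hom (h.trans (h₂ _ hσ _)) r }
  let _ := hF.toField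
  let _ : Algebra Γ(W, V) (W.presheaf.stalk (σ pt)) :=
    TopCat.Presheaf.algebra_section_stalk W.presheaf (U := V) ⟨_, hx⟩
  have := hs'.isStandardSmooth
  have hker : RingHom.ker ε = (hV.primeIdealOf ⟨_, hx⟩).asIdeal := by
    have h := IsAffineOpen.comap_primeIdealOf_appLE (f := σ) V hV U hU e' hpt
    rw [← h]
    have h0 : (hU.primeIdealOf ⟨_, hpt⟩).asIdeal = ⊥ :=
      (Ideal.eq_bot_or_top _).resolve_right (hU.primeIdealOf ⟨_, hpt⟩).2.ne_top
    ext a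
    rw [PrimeSpectrum.comap_asIdeal, h0]
    rfl
  have hp : (RingHom.ker ε).IsPrime := by rw [hker]; exact (hV.primeIdealOf ⟨_, hx⟩).2
  have hloc : IsLocalization.AtPrime (W.presheaf.stalk (σ (pt)))
      (RingHom.ker ε) := by
    have := hV.isLocalization_stalk ⟨_, hx⟩
    have : ∀ (I : Ideal Γ(W, V)) (hI : I.IsPrime), I = (hV.primeIdealOf ⟨_, hx⟩).asIdeal →
        IsLocalization.AtPrime (W.presheaf.stalk (σ (pt))) I := by
      rintro _ _ rfl
      assumption
    exact this _ _ hker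
  have : Nontrivial Γ(W, V) := by
    refine ⟨0, 1, fun h => hp.ne_top ((Ideal.eq_top_iff_one _).2 ?_)⟩
    rw [← h]
    exact zero_mem _
  have hrank := Algebra.IsStandardSmoothOfRelativeDimension.rank_kaehlerDifferential
    (R := Γ(Spec (CommRingCat.of K), U)) (S := Γ(W, V)) 1
  obtain ⟨eΩ⟩ : Nonempty (Ω[Γ(W, V)⁄Γ(Spec (CommRingCat.of K), U)] ≃ₗ[Γ(W, V)] Γ(W, V)) :=
    nonempty_linearEquiv_of_rank_eq (by rw [hrank, Module.rank_self, Nat.cast_one])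
  exact ⟨isDomain_of_kaehlerDifferential_equiv ε _ eΩ, not_isField_of_kaehlerDifferential_equiv ε _ eΩ⟩

/-- The local ring at a smooth rational point of a nodal curve is a domain, but not a field. -/
lemma IsNodalCurve.isDomain_and_not_isField_stalk {Y : Scheme.{0}} {f : Y ⟶ Spec (CommRingCat.of K)}
    [LocallyOfFinitePresentation f] (hf : IsNodalCurve f) (σ : Spec (CommRingCat.of K) ⟶ Y)
    (hσ : σ ≫ f = 𝟙 _) (hz : σ (pt) ∈ f.smoothLocus) :
    IsDomain (Y.presheaf.stalk (σ (pt))) ∧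
      ¬ IsField (Y.presheaf.stalk (σ (pt))) := by
  have := hf.reduced
  have := hf.one_dimensional
  have hr : Set.range σ ⊆ Set.range f.smoothLocus.ι := by
    rintro _ ⟨y, rfl⟩
    rw [Scheme.Opens.range_ι, show y = pt from Subsingleton.elim _ _]
    exact hz
  let σ' := IsOpenImmersion.lift f.smoothLocus.ι σ hr
  have hσ' : σ' ≫ f.smoothLocus.ι = σ := IsOpenImmersion.lift_fac _ _ _
  obtain ⟨h₁, h₂⟩ := isDomain_and_not_isField_stalk_of_smooth pt (f.smoothLocus.ι ≫ f) σ'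
    (by rw [← Category.assoc, hσ', hσ])
  have hpt : f.smoothLocus.ι (σ' (pt)) = σ (pt) := by
    rw [← Scheme.Hom.comp_apply, hσ']
  rw [← hpt]
  let E := (asIso (f.smoothLocus.ι.stalkMap
    (σ' (pt)))).commRingCatIsoToRingEquiv
  exact ⟨E.toMulEquiv.isDomain _, fun h => h₂ (E.symm.toMulEquiv.isField h)⟩

end RationalPoints

/-! ### Irreducible components through a point -/

section Components

variable {Y : Scheme.{0}} {z : Y}

/-- If the local ring at `z` is a domain, then `z` lies on only one irreducible component. -/
lemma eq_of_isDomain_stalk (h : IsDomain (Y.presheaf.stalk z)) {Z Z' : Set Y}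
    (hZ : Z ∈ irreducibleComponents Y) (hZ' : Z' ∈ irreducibleComponents Y) (hz : z ∈ Z)
    (hz' : z ∈ Z') : Z = Z' := by
  let ξ : Y := Y.fromSpecStalk z (genericPoint (Spec (Y.presheaf.stalk z)))
  have hξ : ∀ y : Y, y ⤳ z → ξ ⤳ y := by
    intro y hy
    have : y ∈ Set.range (Y.fromSpecStalk z) := by rw [Scheme.range_fromSpecStalk]; exact hy
    obtain ⟨w, rfl⟩ := this
    exact (genericPoint_specializes w).map (Y.fromSpecStalk z).continuous
  have key : ∀ Z ∈ irreducibleComponents Y, z ∈ Z → Z = closure {ξ} := by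
    intro Z hZ hz
    obtain ⟨η, hη⟩ := QuasiSober.sober hZ.1 (isClosed_of_mem_irreducibleComponents Z hZ)
    have hηz : η ⤳ z := hη.specializes hz
    have hle : Z ⊆ closure {ξ} := by
      rw [← hη.def]
      exact closure_minimal (Set.singleton_subset_iff.2 (hξ η hηz).mem_closure) isClosed_closure
    exact hle.antisymm (hZ.2 isIrreducible_singleton.closure hle)
  rw [key Z hZ hz, key Z' hZ' hz']

/-- If the local ring at `z` is a domain but not a field, then `z` is not an irreducible component. -/
lemma singleton_notMem_irreducibleComponents (h : IsDomain (Y.presheaf.stalk z))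
    (h' : ¬ IsField (Y.presheaf.stalk z)) : {z} ∉ irreducibleComponents Y := by
  intro hz
  have hgen : ∀ w : Spec (Y.presheaf.stalk z), Y.fromSpecStalk z w = z := by
    intro w
    have hw : Y.fromSpecStalk z w ⤳ z := by
      have : Y.fromSpecStalk z w ∈ Set.range (Y.fromSpecStalk z) := ⟨w, rfl⟩
      rwa [Scheme.range_fromSpecStalk] at this
    have hle : ({z} : Set Y) ⊆ closure {Y.fromSpecStalk z w} :=
      Set.singleton_subset_iff.2 hw.mem_closure
    exact hz.2 isIrreducible_singleton.closure hle (subset_closure rfl)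
  have hinj : Function.Injective (Y.fromSpecStalk z) := (Y.fromSpecStalk z).isEmbedding.injective
  have heq : (⟨⊥, Ideal.isPrime_bot⟩ : PrimeSpectrum (Y.presheaf.stalk z)) =
      IsLocalRing.closedPoint _ := hinj ((hgen _).trans (hgen _).symm)
  have := congrArg PrimeSpectrum.asIdeal heq
  exact h' (IsLocalRing.isField_iff_maximalIdeal_eq.2 this.symm)

end Components

/-! ### Geometry of glued schemes -/

section Glued

variable {B C₁ C₂ C : Scheme.{0}} {p₁ : B ⟶ C₁} {p₂ : B ⟶ C₂} {i₁ : C₁ ⟶ C} {i₂ : C₂ ⟶ C}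

lemma preimage_eq_of_comp_eq (h : p₁ ≫ i₁ = p₂ ≫ i₂) (U : C.Opens) :
    p₁ ⁻¹ᵁ (i₁ ⁻¹ᵁ U) = p₂ ⁻¹ᵁ (i₂ ⁻¹ᵁ U) := by
  rw [← Scheme.Hom.comp_preimage, h, Scheme.Hom.comp_preimage]

lemma app_app_eq_of_comp_eq (h : p₁ ≫ i₁ = p₂ ≫ i₂) (U : C.Opens) (f : Γ(C, U)) :
    p₁.app (i₁ ⁻¹ᵁ U) (i₁.app U f) =
      resO B (preimage_eq_of_comp_eq h U).le (p₂.app (i₂ ⁻¹ᵁ U) (i₂.app U f)) := by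
  have h1 := ConcreteCategory.congr_hom (Scheme.Hom.congr_app h U) f
  rw [Scheme.Hom.comp_app, Scheme.Hom.comp_app] at h1
  exact h1

namespace IsGlued

variable (H : IsGlued p₁ p₂ i₁ i₂)
include H

lemma symm : IsGlued p₂ p₁ i₂ i₁ where
  closed₁ := H.closed₂
  closed₂ := H.closed₁
  comm := H.comm.symm
  cover z := (H.cover z).symm
  meet y₂ y₁ h := by
    obtain ⟨β, h₁, h₂⟩ := H.meet y₁ y₂ h.symm
    exact ⟨β, h₂, h₁⟩
  functions U h f₂ f₁ hf := by
    have h' := (preimage_eq_of_comp_eq H.comm U).le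
    obtain ⟨f, hf', hu⟩ := H.functions U h' f₁ f₂ (by rw [hf, resO_resO, resO_self])
    exact ⟨f, ⟨hf'.2, hf'.1⟩, fun g hg => hu g ⟨hg.2, hg.1⟩⟩

lemma app_ext {U : C.Opens} {f g : Γ(C, U)} (h₁ : i₁.app U f = i₁.app U g)
    (h₂ : i₂.app U f = i₂.app U g) : f = g :=
  (H.functions U (preimage_eq_of_comp_eq H.comm U).le _ _
    (app_app_eq_of_comp_eq H.comm U g)).unique ⟨h₁, h₂⟩ ⟨rfl, rfl⟩

/-- Away from the other piece, a piece of a glued scheme is open. -/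
lemma isOpenImmersion_of_forall_notMem (U : C.Opens) (hU : ∀ y, i₂ y ∉ U) :
    IsOpenImmersion ((i₁ ⁻¹ᵁ U).ι ≫ i₁) := by
  have := H.closed₁
  have hbot : i₂ ⁻¹ᵁ U = ⊥ := by
    ext y
    simpa using hU y
  have hinj : ∀ V : C.Opens, V ≤ U → Function.Injective (i₁.app V) := by
    intro V hV f g h
    refine H.app_ext h ?_
    have hV' : i₂ ⁻¹ᵁ V = ⊥ := by
      rw [← le_bot_iff, ← hbot]
      exact i₂.preimage_mono hV
    have : Subsingleton Γ(C₂, i₂ ⁻¹ᵁ V) := by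
      rw [hV']
      infer_instance
    exact Subsingleton.elim _ _
  -- Over `U`, the closed immersion `i₁` is injective on functions, hence an isomorphism.
  have hcl : IsClosedImmersion (i₁ ∣_ U) := inferInstance
  have : IsIso (i₁ ∣_ U) := by
    rw [IsClosedImmersion.isIso_iff_ker_eq_bot]
    apply Scheme.IdealSheafData.ext
    funext V
    rw [Scheme.Hom.ker_apply, Scheme.IdealSheafData.ideal_bot, Pi.bot_apply,
      ← RingHom.injective_iff_ker_eq_bot, morphismRestrict_app]
    refine Function.Injective.comp (g := (C₁.presheaf.map (eqToHom
      (image_morphismRestrict_preimage i₁ U V.1)).op).hom)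
      (ConcreteCategory.bijective_of_isIso _).1 (hinj (U.ι ''ᵁ V.1) ?_)
    exact U.ι_image_le _
  rw [← morphismRestrict_ι]
  infer_instance

end IsGlued

/-- Smoothness at a point `z` may be tested after a morphism that is an open immersion on a
neighbourhood of `z`. -/
lemma mem_smoothLocus_iff_of_isOpenImmersion {Y' Y Z : Scheme.{0}} {k : Y' ⟶ Y} {f : Y ⟶ Z}
    {f' : Y' ⟶ Z} (hf : k ≫ f = f') [LocallyOfFinitePresentation f] [LocallyOfFinitePresentation f']
    (W : Y'.Opens) (hW : IsOpenImmersion (W.ι ≫ k)) {z : Y'} (hz : z ∈ W) :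
    z ∈ f'.smoothLocus ↔ k z ∈ f.smoothLocus := by
  subst hf
  have h₁ := Scheme.Hom.preimage_smoothLocus_eq W.ι (k ≫ f)
  have h₂ := Scheme.Hom.preimage_smoothLocus_eq (W.ι ≫ k) f
  have h₃ : W.ι ⁻¹ᵁ (k ≫ f).smoothLocus = (W.ι ≫ k) ⁻¹ᵁ f.smoothLocus := by
    rw [h₁, h₂]
    congr 1
  have := congrArg (fun V : (W : Scheme.{0}).Opens => (⟨z, hz⟩ : W) ∈ V) h₃
  exact this.to_iff

end Glued

/-! ### Fibres and the points cut out by sections -/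

section Fibres

variable {B C' C : Scheme.{0}} {c' : C' ⟶ B} {c : C ⟶ B} {i : C' ⟶ C} (hi : i ≫ c = c')
  {K : Type} [Field K] (s : Spec (CommRingCat.of K) ⟶ B)

/-- The morphism of fibres given by a morphism over the base. -/
def fibreMap : pullback c' s ⟶ pullback c s :=
  pullback.lift (pullback.fst c' s ≫ i) (pullback.snd c' s)
    (by rw [Category.assoc, hi, pullback.condition])

lemma fibreMap_fst : fibreMap hi s ≫ pullback.fst c s = pullback.fst c' s ≫ i :=
  pullback.lift_fst _ _ _

lemma fibreMap_snd : fibreMap hi s ≫ pullback.snd c s = pullback.snd c' s :=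
  pullback.lift_snd _ _ _

lemma isPullback_fibreMap :
    IsPullback (fibreMap hi s) (pullback.fst c' s) (pullback.fst c s) i := by
  refine IsPullback.of_right ?_ (fibreMap_fst hi s) (IsPullback.of_hasPullback c s).flip
  rw [fibreMap_snd, hi]
  exact (IsPullback.of_hasPullback c' s).flip

lemma isClosedImmersion_fibreMap [IsClosedImmersion i] : IsClosedImmersion (fibreMap hi s) :=
  MorphismProperty.of_isPullback (isPullback_fibreMap hi s).flip ‹_›

lemma mem_range_fibreMap {z : ↥(pullback c s)} (hz : pullback.fst c s z ∈ Set.range i) :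
    z ∈ Set.range (fibreMap hi s) := by
  obtain ⟨y, hy⟩ := hz
  obtain ⟨w, hw, -⟩ := Scheme.exists_preimage_of_isPullback (isPullback_fibreMap hi s) z y
    hy.symm
  exact ⟨w, hw⟩

/-- The rational point of the fibre that is cut out by a section. -/
def fibreSection {p : B ⟶ C} (hp : p ≫ c = 𝟙 B) : Spec (CommRingCat.of K) ⟶ pullback c s :=
  pullback.lift (s ≫ p) (𝟙 _) (by simp [hp])

lemma fibreSection_apply {p : B ⟶ C} (hp : p ≫ c = 𝟙 B) (pt : ↥(Spec (CommRingCat.of K))) :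
    fibreSection s hp pt = fibrePoint hp s :=
  congrArg (fibreSection s hp) (Subsingleton.elim _ _)

lemma fibreSection_snd {p : B ⟶ C} (hp : p ≫ c = 𝟙 B) : fibreSection s hp ≫ pullback.snd c s = 𝟙 _ :=
  pullback.lift_snd _ _ _

lemma fibreSection_fst {p : B ⟶ C} (hp : p ≫ c = 𝟙 B) :
    fibreSection s hp ≫ pullback.fst c s = s ≫ p :=
  pullback.lift_fst _ _ _

lemma fst_fibrePoint {p : B ⟶ C} (hp : p ≫ c = 𝟙 B) (pt : ↥(Spec (CommRingCat.of K))) :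
    pullback.fst c s (fibrePoint hp s) = p (s pt) := by
  rw [← fibreSection_apply s hp pt, ← Scheme.Hom.comp_apply, fibreSection_fst, Scheme.Hom.comp_apply]

lemma fibreMap_fibrePoint {p' : B ⟶ C'} {p : B ⟶ C} (hp' : p' ≫ c' = 𝟙 B) (hp : p ≫ c = 𝟙 B)
    (h : p = p' ≫ i) : fibreMap hi s (fibrePoint hp' s) = fibrePoint hp s := by
  let pt : ↥(Spec (CommRingCat.of K)) := IsLocalRing.closedPoint K
  rw [← fibreSection_apply s hp' pt, ← fibreSection_apply s hp pt, ← Scheme.Hom.comp_apply]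
  refine congrArg (fun g : Spec (CommRingCat.of K) ⟶ pullback c s => g pt) ?_
  apply pullback.hom_ext
  · rw [Category.assoc, fibreMap_fst, ← Category.assoc, fibreSection_fst, fibreSection_fst, h,
      Category.assoc]
  · rw [Category.assoc, fibreMap_snd, fibreSection_snd, fibreSection_snd]

/-- The only point of the fibre `C_s` that lies over a section is the one that is cut out by it: the
section `Spec K ⟶ C_s` is the base change of `B ⟶ C`. -/
lemma eq_fibrePoint_of_fst_eq {p : B ⟶ C} (hp : p ≫ c = 𝟙 B) {z : ↥(pullback c s)} {β : B}
    (h : pullback.fst c s z = p β) : z = fibrePoint hp s := by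
  have h₁ : IsPullback (fibreSection s hp) s (pullback.fst c s) p := by
    refine IsPullback.of_right ?_ (fibreSection_fst s hp) (IsPullback.of_hasPullback c s).flip
    rw [fibreSection_snd, hp]
    exact IsPullback.of_horiz_isIso ⟨by simp⟩
  obtain ⟨w, hw, -⟩ := Scheme.exists_preimage_of_isPullback h₁ z β h
  rw [← hw, fibreSection_apply]

/-- Two sections that meet over the image of `s` cut out the same point of the fibre. -/
lemma fibrePoint_eq_of_apply_eq {p q : B ⟶ C} (hp : p ≫ c = 𝟙 B) (hq : q ≫ c = 𝟙 B)
    (pt : ↥(Spec (CommRingCat.of K))) (h : p (s pt) = q (s pt)) :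
    fibrePoint hp s = fibrePoint hq s :=
  eq_fibrePoint_of_fst_eq s hq ((fst_fibrePoint s hp pt).trans h)

end Fibres

/-! ### Gluing of morphisms -/

section MkHom

variable {Y X : Scheme.{0}}

/-- The preimage of an open subset under a continuous map. -/
def preimageOpen (g : C(Y, X)) (V : X.Opens) : Y.Opens := ⟨g ⁻¹' V, V.2.preimage g.continuous⟩

lemma preimageOpen_mono (g : C(Y, X)) {V W : X.Opens} (h : V ≤ W) :
    preimageOpen g V ≤ preimageOpen g W := fun _ hy => h hy

/-- A morphism of schemes is the same as a continuous map together with compatible ring maps on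
sections, such that a pulled back function is invertible only where the function is. -/
lemma exists_hom_of_ringHom (g : C(Y, X)) (r : ∀ V : X.Opens, Γ(X, V) →+* Γ(Y, preimageOpen g V))
    (nat : ∀ {V W : X.Opens} (h : V ≤ W) (a : Γ(X, W)),
      r V (resO X h a) = resO Y (preimageOpen_mono g h) (r W a))
    (loc : ∀ (V : X.Opens) (a : Γ(X, V)) (y : Y), y ∈ Y.basicOpen (r V a) → g y ∈ X.basicOpen a) :
    ∃ φ : Y ⟶ X, ∃ hφ : ∀ V, preimageOpen g V ≤ φ ⁻¹ᵁ V, (∀ y, φ y = g y) ∧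
      ∀ (V : X.Opens) (a : Γ(X, V)), φ.appLE V (preimageOpen g V) (hφ V) a = r V a := by
  let F : Y.toPresheafedSpace.Hom X.toPresheafedSpace :=
    { base := TopCat.ofHom g
      c := { app := fun V => CommRingCat.ofHom (r V.unop)
             naturality := fun V W h => by
              ext a
              exact nat (leOfHom h.unop) a } }
  have hF : ∀ y, IsLocalHom (F.stalkMap y).hom := by
    intro y
    refine ⟨fun a ha => ?_⟩
    obtain ⟨V, hV, a, rfl⟩ := X.presheaf.exists_germ_eq (x := g y) a
    have h1 := ConcreteCategory.congr_hom (PresheafedSpace.stalkMap_germ F V y hV) a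
    have h2 : IsUnit (Y.presheaf.germ (preimageOpen g V) y hV (r V a)) := by
      have h3 : (F.stalkMap y).hom (X.presheaf.germ V (g y) hV a) =
          Y.presheaf.germ (preimageOpen g V) y hV (r V a) := h1
      rw [← h3]
      exact ha
    exact (Scheme.mem_basicOpen X a (g y) hV).1
      (loc V a y ((Scheme.mem_basicOpen Y (r V a) y hV).2 h2))
  let φ : Y ⟶ X := ⟨⟨F, hF⟩⟩
  refine ⟨φ, fun V => le_rfl, fun _ => rfl, fun V a => ?_⟩
  exact resO_self _ _

lemma hom_ext_of_appLE {φ ψ : Y ⟶ X} (hb : ∀ y, φ y = ψ y)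
    (h : ∀ (V : X.Opens) (U : Y.Opens) (e : U ≤ φ ⁻¹ᵁ V) (e' : U ≤ ψ ⁻¹ᵁ V) (a : Γ(X, V)),
      φ.appLE V U e a = ψ.appLE V U e' a) : φ = ψ := by
  have hb' : φ.base = ψ.base := by
    ext y
    exact hb y
  refine Scheme.Hom.ext hb' fun V => ?_
  have hle : ψ ⁻¹ᵁ V ≤ φ ⁻¹ᵁ V := fun y hy => by
    rw [Scheme.Hom.mem_preimage, hb y]
    exact hy
  ext a
  have h1 := h V (ψ ⁻¹ᵁ V) hle le_rfl a
  have h2 : ψ.appLE V (ψ ⁻¹ᵁ V) le_rfl a = ψ.app V a := by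
    rw [Scheme.Hom.appLE]
    exact resO_self _ _
  rw [← h2, ← h1]
  rfl

lemma preimage_le_comp_preimage {Z : Scheme.{0}} (i : Z ⟶ Y) {φ : Y ⟶ X} {V : X.Opens} {U : Y.Opens}
    (e : U ≤ φ ⁻¹ᵁ V) : i ⁻¹ᵁ U ≤ (i ≫ φ) ⁻¹ᵁ V := i.preimage_mono e

lemma appLE_comp_apply {Z : Scheme.{0}} (i : Z ⟶ Y) (φ : Y ⟶ X) (V : X.Opens) (U : Y.Opens)
    (e : U ≤ φ ⁻¹ᵁ V) (e' : i ⁻¹ᵁ U ≤ (i ≫ φ) ⁻¹ᵁ V) (a : Γ(X, V)) :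
    i.app U (φ.appLE V U e a) = (i ≫ φ).appLE V (i ⁻¹ᵁ U) e' a := by
  have h := Scheme.Hom.appLE_comp_appLE i φ V U (i ⁻¹ᵁ U) e le_rfl
  rw [← h]
  have h2 : ∀ b, i.appLE U (i ⁻¹ᵁ U) le_rfl b = i.app U b := fun b => by
    rw [Scheme.Hom.appLE]
    exact resO_self _ _
  exact (h2 _).symm

lemma resO_appLE (φ : Y ⟶ X) {V : X.Opens} {U U' : Y.Opens} (e : U ≤ φ ⁻¹ᵁ V) (h : U' ≤ U)
    (a : Γ(X, V)) : resO Y h (φ.appLE V U e a) = φ.appLE V U' (h.trans e) a :=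
  ConcreteCategory.congr_hom (φ.appLE_map e (homOfLE h).op) a

lemma appLE_resO (φ : Y ⟶ X) {V V' : X.Opens} {U : Y.Opens} (e : U ≤ φ ⁻¹ᵁ V) (h : V ≤ V')
    (a : Γ(X, V')) :
    φ.appLE V U e (resO X h a) = φ.appLE V' U (e.trans (φ.preimage_mono h)) a :=
  ConcreteCategory.congr_hom (φ.map_appLE e (homOfLE h).op) a

end MkHom

section GluedMorphisms

variable {B C₁ C₂ C X : Scheme.{0}} {p₁ : B ⟶ C₁} {p₂ : B ⟶ C₂} {i₁ : C₁ ⟶ C} {i₂ : C₂ ⟶ C}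

namespace IsGlued

variable (H : IsGlued p₁ p₂ i₁ i₂)
include H

/-- A morphism on a glued scheme is determined by its restrictions to the pieces. -/
lemma hom_ext {φ ψ : C ⟶ X} (h₁ : i₁ ≫ φ = i₁ ≫ ψ) (h₂ : i₂ ≫ φ = i₂ ≫ ψ) : φ = ψ := by
  refine hom_ext_of_appLE (fun z => ?_) fun V U e e' a => H.app_ext ?_ ?_
  · obtain ⟨y, rfl⟩ | ⟨y, rfl⟩ := H.cover z
    · rw [← Scheme.Hom.comp_apply, h₁, Scheme.Hom.comp_apply]
    · rw [← Scheme.Hom.comp_apply, h₂, Scheme.Hom.comp_apply]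
  · rw [appLE_comp_apply i₁ φ V U e (preimage_le_comp_preimage i₁ e),
      appLE_comp_apply i₁ ψ V U e' (preimage_le_comp_preimage i₁ e')]
    congr 3
  · rw [appLE_comp_apply i₂ φ V U e (preimage_le_comp_preimage i₂ e),
      appLE_comp_apply i₂ ψ V U e' (preimage_le_comp_preimage i₂ e')]
    congr 3

/-- Continuous maps on the pieces of a glued scheme that agree on the intersection can be glued. -/
lemma exists_continuousMap (f₁ : C(C₁, X)) (f₂ : C(C₂, X)) (h : ∀ β, f₁ (p₁ β) = f₂ (p₂ β)) :
    ∃ g : C(C, X), (∀ y, g (i₁ y) = f₁ y) ∧ ∀ y, g (i₂ y) = f₂ y := by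
  have := H.closed₁
  have := H.closed₂
  have hi₁ := i₁.isClosedEmbedding
  have hi₂ := i₂.isClosedEmbedding
  have key : ∀ z, ∃ w, (∀ y, i₁ y = z → f₁ y = w) ∧ ∀ y, i₂ y = z → f₂ y = w := by
    intro z
    obtain ⟨y, rfl⟩ | ⟨y, rfl⟩ := H.cover z
    · refine ⟨f₁ y, fun y' hy' => by rw [hi₁.injective hy'], fun y' hy' => ?_⟩
      obtain ⟨β, rfl, rfl⟩ := H.meet _ _ hy'.symm
      exact (h β).symm
    · refine ⟨f₂ y, fun y' hy' => ?_, fun y' hy' => by rw [hi₂.injective hy']⟩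
      obtain ⟨β, rfl, rfl⟩ := H.meet _ _ hy'
      exact h β
  choose g hg₁ hg₂ using key
  have e₁ : ∀ y, g (i₁ y) = f₁ y := fun y => (hg₁ _ y rfl).symm
  have e₂ : ∀ y, g (i₂ y) = f₂ y := fun y => (hg₂ _ y rfl).symm
  refine ⟨⟨g, continuous_iff_isClosed.2 fun Z hZ => ?_⟩, e₁, e₂⟩
  have : g ⁻¹' Z = i₁ '' (f₁ ⁻¹' Z) ∪ i₂ '' (f₂ ⁻¹' Z) := by
    ext z
    constructor
    · intro hz
      obtain ⟨y, rfl⟩ | ⟨y, rfl⟩ := H.cover z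
      · exact Or.inl ⟨y, by rwa [Set.mem_preimage, ← e₁], rfl⟩
      · exact Or.inr ⟨y, by rwa [Set.mem_preimage, ← e₂], rfl⟩
    · rintro (⟨y, hy, rfl⟩ | ⟨y, hy, rfl⟩)
      · rwa [Set.mem_preimage, e₁]
      · rwa [Set.mem_preimage, e₂]
  rw [this]
  exact (hi₁.isClosedMap _ (hZ.preimage f₁.continuous)).union
    (hi₂.isClosedMap _ (hZ.preimage f₂.continuous))

/-- Morphisms on the pieces of a glued scheme that agree on the intersection can be glued. -/
lemma existsUnique_hom {φ₁ : C₁ ⟶ X} {φ₂ : C₂ ⟶ X} (h : p₁ ≫ φ₁ = p₂ ≫ φ₂) :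
    ∃! φ : C ⟶ X, i₁ ≫ φ = φ₁ ∧ i₂ ≫ φ = φ₂ := by
  have hh : ∀ β, φ₁ (p₁ β) = φ₂ (p₂ β) := fun β => by
    rw [← Scheme.Hom.comp_apply, h, Scheme.Hom.comp_apply]
  obtain ⟨g, hg₁, hg₂⟩ := H.exists_continuousMap (X := X) ⟨φ₁, φ₁.continuous⟩ ⟨φ₂, φ₂.continuous⟩ hh
  have e₁ : ∀ V : X.Opens, i₁ ⁻¹ᵁ (preimageOpen g V) ≤ φ₁ ⁻¹ᵁ V := fun V y hy => by
    have : g (i₁ y) ∈ V := hy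
    rwa [hg₁] at this
  have e₂ : ∀ V : X.Opens, i₂ ⁻¹ᵁ (preimageOpen g V) ≤ φ₂ ⁻¹ᵁ V := fun V y hy => by
    have : g (i₂ y) ∈ V := hy
    rwa [hg₂] at this
  have key : ∀ (V : X.Opens) (a : Γ(X, V)), ∃ f : Γ(C, preimageOpen g V),
      i₁.app _ f = φ₁.appLE V _ (e₁ V) a ∧ i₂.app _ f = φ₂.appLE V _ (e₂ V) a := by
    intro V a
    refine (H.functions _ (preimage_eq_of_comp_eq H.comm _).le _ _ ?_).exists
    rw [appLE_comp_apply p₁ φ₁ V _ (e₁ V) (preimage_le_comp_preimage p₁ (e₁ V)),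
      appLE_comp_apply p₂ φ₂ V _ (e₂ V) (preimage_le_comp_preimage p₂ (e₂ V)), resO_appLE]
    congr 3
  choose r hr₁ hr₂ using key
  let R : ∀ V : X.Opens, Γ(X, V) →+* Γ(C, preimageOpen g V) := fun V =>
    { toFun := r V
      map_one' := H.app_ext (by rw [hr₁, map_one, map_one]) (by rw [hr₂, map_one, map_one])
      map_mul' := fun a b => H.app_ext (by rw [map_mul, hr₁, hr₁, hr₁, map_mul])
        (by rw [map_mul, hr₂, hr₂, hr₂, map_mul])
      map_zero' := H.app_ext (by rw [hr₁, map_zero, map_zero]) (by rw [hr₂, map_zero, map_zero])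
      map_add' := fun a b => H.app_ext (by rw [map_add, hr₁, hr₁, hr₁, map_add])
        (by rw [map_add, hr₂, hr₂, hr₂, map_add]) }
  obtain ⟨φ, hφ, hb, ha⟩ := exists_hom_of_ringHom g R
    (fun {V W} hVW a => H.app_ext
      (by
        change i₁.app _ (r V _) = i₁.app _ (resO C _ (r W a))
        rw [resO_app, hr₁, hr₁, appLE_resO, resO_appLE])
      (by
        change i₂.app _ (r V _) = i₂.app _ (resO C _ (r W a))
        rw [resO_app, hr₂, hr₂, appLE_resO, resO_appLE]))
    (fun V a z hz => by
      change z ∈ C.basicOpen (r V a) at hz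
      obtain ⟨y, rfl⟩ | ⟨y, rfl⟩ := H.cover z
      · have hy : y ∈ i₁ ⁻¹ᵁ C.basicOpen (r V a) := hz
        rw [Scheme.preimage_basicOpen, hr₁, Scheme.basicOpen_appLE] at hy
        rw [hg₁]
        exact hy.2
      · have hy : y ∈ i₂ ⁻¹ᵁ C.basicOpen (r V a) := hz
        rw [Scheme.preimage_basicOpen, hr₂, Scheme.basicOpen_appLE] at hy
        rw [hg₂]
        exact hy.2)
  have hφ₁ : i₁ ≫ φ = φ₁ := by
    refine hom_ext_of_appLE (fun y => ?_) fun V U e e' a => ?_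
    · rw [Scheme.Hom.comp_apply, hb, hg₁]; rfl
    · have hU : U ≤ i₁ ⁻¹ᵁ preimageOpen g V := fun y hy => by
        change g (i₁ y) ∈ V
        rw [hg₁]
        exact e' hy
      have h1 := hr₁ V a
      rw [← show φ.appLE V _ (hφ V) a = r V a from ha V a,
        appLE_comp_apply i₁ φ V _ (hφ V) (preimage_le_comp_preimage i₁ (hφ V))] at h1
      have h2 := congrArg (resO C₁ hU) h1
      rwa [resO_appLE, resO_appLE] at h2
  have hφ₂ : i₂ ≫ φ = φ₂ := by
    refine hom_ext_of_appLE (fun y => ?_) fun V U e e' a => ?_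
    · rw [Scheme.Hom.comp_apply, hb, hg₂]; rfl
    · have hU : U ≤ i₂ ⁻¹ᵁ preimageOpen g V := fun y hy => by
        change g (i₂ y) ∈ V
        rw [hg₂]
        exact e' hy
      have h1 := hr₂ V a
      rw [← show φ.appLE V _ (hφ V) a = r V a from ha V a,
        appLE_comp_apply i₂ φ V _ (hφ V) (preimage_le_comp_preimage i₂ (hφ V))] at h1
      have h2 := congrArg (resO C₂ hU) h1
      rwa [resO_appLE, resO_appLE] at h2
  exact ⟨φ, ⟨hφ₁, hφ₂⟩, fun ψ hψ => H.hom_ext (hψ.1.trans hφ₁.symm) (hψ.2.trans hφ₂.symm)⟩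

end IsGlued

end GluedMorphisms

/-! ### Irreducible components of a union of two closed subspaces -/

section GluedComponents

variable {Y₁ Y₂ Y : Type*} [TopologicalSpace Y₁] [TopologicalSpace Y₂] [TopologicalSpace Y]
  {k₁ : Y₁ → Y} {k₂ : Y₂ → Y}

lemma isIrreducible_preimage_of_isClosedEmbedding (h₁ : Topology.IsClosedEmbedding k₁) {W : Set Y}
    (hW : IsIrreducible W) (hr : W ⊆ Set.range k₁) : IsIrreducible (k₁ ⁻¹' W) := by
  refine ⟨?_, isPreirreducible_iff_isClosed_union_isClosed.2 fun z₁ z₂ hz₁ hz₂ h => ?_⟩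
  · obtain ⟨w, hw⟩ := hW.1
    obtain ⟨y, rfl⟩ := hr hw
    exact ⟨y, hw⟩
  · refine (isPreirreducible_iff_isClosed_union_isClosed.1 hW.2 (k₁ '' z₁) (k₁ '' z₂)
      (h₁.isClosedMap _ hz₁) (h₁.isClosedMap _ hz₂) fun w hw => ?_).imp (fun h' y hy => ?_)
      fun h' y hy => ?_
    · obtain ⟨y, rfl⟩ := hr hw
      exact (h hw).imp (Set.mem_image_of_mem k₁) (Set.mem_image_of_mem k₁)
    · exact (h₁.injective.mem_set_image).1 (h' hy)
    · exact (h₁.injective.mem_set_image).1 (h' hy)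

lemma subset_range_or_subset_range (h₁ : Topology.IsClosedEmbedding k₁)
    (h₂ : Topology.IsClosedEmbedding k₂) (cover : ∀ z, z ∈ Set.range k₁ ∨ z ∈ Set.range k₂)
    {W : Set Y} (hW : IsIrreducible W) : W ⊆ Set.range k₁ ∨ W ⊆ Set.range k₂ :=
  isPreirreducible_iff_isClosed_union_isClosed.1 hW.2 _ _ h₁.isClosed_range h₂.isClosed_range
    fun z _ => cover z

/-- If an irreducible subset of `Y₂` contained the image of a component of `Y₁`, then this component
would be the point `q₁` where the subspaces meet. -/
lemma image_mem_irreducibleComponents (h₁ : Topology.IsClosedEmbedding k₁)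
    (h₂ : Topology.IsClosedEmbedding k₂) (cover : ∀ z, z ∈ Set.range k₁ ∨ z ∈ Set.range k₂)
    {q₁ : Y₁} (meet : ∀ y₁ y₂, k₁ y₁ = k₂ y₂ → y₁ = q₁) (hq : {q₁} ∉ irreducibleComponents Y₁)
    {Z : Set Y₁} (hZ : Z ∈ irreducibleComponents Y₁) : k₁ '' Z ∈ irreducibleComponents Y := by
  refine ⟨hZ.1.image _ h₁.continuous.continuousOn, fun W hW hle => ?_⟩
  obtain hr | hr := subset_range_or_subset_range h₁ h₂ cover hW
  · have h := hZ.2 (isIrreducible_preimage_of_isClosedEmbedding h₁ hW hr)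
      fun y hy => hle (Set.mem_image_of_mem k₁ hy)
    intro w hw
    obtain ⟨y, rfl⟩ := hr hw
    exact Set.mem_image_of_mem _ (h hw)
  · refine absurd hZ ?_
    have hsub : ∀ y ∈ Z, y = q₁ := fun y hy => by
      obtain ⟨y₂, hy₂⟩ := hr (hle (Set.mem_image_of_mem k₁ hy))
      exact meet y y₂ hy₂.symm
    rwa [(Set.eq_singleton_iff_nonempty_unique_mem.2 ⟨hZ.1.1, hsub⟩ : Z = {q₁})]

/-- If two closed subspaces that cover a space meet in at most one point, and this point is not an
irreducible component of either of them, then the irreducible components of the space are those of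
the two subspaces. -/
lemma exists_equiv_irreducibleComponents (h₁ : Topology.IsClosedEmbedding k₁)
    (h₂ : Topology.IsClosedEmbedding k₂) (cover : ∀ z, z ∈ Set.range k₁ ∨ z ∈ Set.range k₂)
    {q₁ : Y₁} {q₂ : Y₂} (meet : ∀ y₁ y₂, k₁ y₁ = k₂ y₂ → y₁ = q₁ ∧ y₂ = q₂)
    (hq₁ : {q₁} ∉ irreducibleComponents Y₁) (hq₂ : {q₂} ∉ irreducibleComponents Y₂) :
    ∃ e : irreducibleComponents Y₁ ⊕ irreducibleComponents Y₂ ≃ irreducibleComponents Y,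
      (∀ Z, (e (Sum.inl Z) : Set Y) = k₁ '' Z.1) ∧ ∀ Z, (e (Sum.inr Z) : Set Y) = k₂ '' Z.1 := by
  let e : irreducibleComponents Y₁ ⊕ irreducibleComponents Y₂ → irreducibleComponents Y :=
    Sum.elim (fun Z => ⟨k₁ '' Z.1, image_mem_irreducibleComponents h₁ h₂ cover
        (fun y₁ y₂ h => (meet y₁ y₂ h).1) hq₁ Z.2⟩)
      (fun Z => ⟨k₂ '' Z.1, image_mem_irreducibleComponents h₂ h₁ (fun z => (cover z).symm)
        (fun y₂ y₁ h => (meet y₁ y₂ h.symm).2) hq₂ Z.2⟩)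
  have hne : ∀ (Z₁ : irreducibleComponents Y₁) (Z₂ : irreducibleComponents Y₂),
      k₁ '' Z₁.1 ≠ k₂ '' Z₂.1 := by
    intro Z₁ Z₂ h
    refine hq₁ ?_
    have hsub : ∀ y ∈ Z₁.1, y = q₁ := fun y hy => by
      have h' : k₁ y ∈ k₂ '' Z₂.1 := h ▸ Set.mem_image_of_mem k₁ hy
      obtain ⟨y₂, -, hy₂⟩ := h'
      exact (meet y y₂ hy₂.symm).1
    rw [← (Set.eq_singleton_iff_nonempty_unique_mem.2 ⟨Z₁.2.1.1, hsub⟩ : Z₁.1 = {q₁})]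
    exact Z₁.2
  refine ⟨Equiv.ofBijective e ⟨?_, ?_⟩, fun _ => rfl, fun _ => rfl⟩
  · rintro (Z | Z) (Z' | Z') h
    · exact congrArg Sum.inl (Subtype.ext (h₁.injective.image_injective (congrArg Subtype.val h)))
    · exact absurd (congrArg Subtype.val h) (hne Z Z')
    · exact absurd (congrArg Subtype.val h).symm (hne Z' Z)
    · exact congrArg Sum.inr (Subtype.ext (h₂.injective.image_injective (congrArg Subtype.val h)))
  · rintro ⟨W, hW⟩
    have hcl := isClosed_of_mem_irreducibleComponents W hW
    obtain hr | hr := subset_range_or_subset_range h₁ h₂ cover hW.1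
    · refine ⟨Sum.inl ⟨k₁ ⁻¹' W, isIrreducible_preimage_of_isClosedEmbedding h₁ hW.1 hr,
        fun V hV hle => ?_⟩, Subtype.ext (Set.image_preimage_eq_of_subset hr)⟩
      have h := hW.2 (hV.image _ h₁.continuous.continuousOn)
        ((Set.image_preimage_eq_of_subset hr).symm.le.trans (Set.image_mono hle))
      exact fun y hy => h (Set.mem_image_of_mem _ hy)
    · refine ⟨Sum.inr ⟨k₂ ⁻¹' W, isIrreducible_preimage_of_isClosedEmbedding h₂ hW.1 hr,
        fun V hV hle => ?_⟩, Subtype.ext (Set.image_preimage_eq_of_subset hr)⟩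
      have h := hW.2 (hV.image _ h₂.continuous.continuousOn)
        ((Set.image_preimage_eq_of_subset hr).symm.le.trans (Set.image_mono hle))
      exact fun y hy => h (Set.mem_image_of_mem _ hy)

end GluedComponents

/-! ### Valences of the grafted tree -/

section Valence

/-- The fibre of a map on `T` loses the element `t₁` when this element is removed. -/
lemma card_fibre_eq_card_fibre_ne_add {T V : Type} [Finite T] (root : T → V) (t₁ : T) (v : V) :
    Nat.card {t // root t = v} =
      Nat.card {t : {t // t ≠ t₁} // root t.1 = v} + Nat.card {_u : Unit // root t₁ = v} := by
  classical
  rw [← Nat.card_sum]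
  exact Nat.card_congr
    { toFun := fun t => if ht : t.1 = t₁ then Sum.inr ⟨(), ht ▸ t.2⟩ else Sum.inl ⟨⟨t.1, ht⟩, t.2⟩
      invFun := Sum.elim (fun t => ⟨t.1.1, t.2⟩) (fun u => ⟨t₁, u.2⟩)
      left_inv := by
        rintro ⟨t, ht⟩
        by_cases h : t = t₁
        · subst h
          simp
        · simp [h]
      right_inv := by
        rintro (⟨⟨t, ht⟩, h⟩ | ⟨⟨⟩, h⟩)
        · simp [ht]
        · simp }

lemma card_subtype_sum {α β : Type} [Finite α] [Finite β] (p : α ⊕ β → Prop) :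
    Nat.card {c // p c} = Nat.card {a // p (Sum.inl a)} + Nat.card {b // p (Sum.inr b)} := by
  rw [← Nat.card_sum]
  exact Nat.card_congr Equiv.subtypeSum

lemma card_subtype_eq_zero {α : Type} {p : α → Prop} (h : ∀ a, ¬ p a) : Nat.card {a // p a} = 0 := by
  have : IsEmpty {a // p a} := ⟨fun a => h a.1 a.2⟩
  exact Nat.card_of_isEmpty

lemma card_subtype_congr {α : Type} {p q : α → Prop} (h : ∀ a, p a ↔ q a) :
    Nat.card {a // p a} = Nat.card {a // q a} :=
  Nat.card_congr (Equiv.subtypeEquivRight h)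

lemma inl_mem_map_inl_iff {α β : Type} {z : Sym2 α} {v : α} :
    Sum.inl v ∈ z.map (Sum.inl : α → α ⊕ β) ↔ v ∈ z := by
  simp [Sym2.mem_map]

lemma inr_mem_map_inr_iff {α β : Type} {z : Sym2 β} {v : β} :
    Sum.inr v ∈ z.map (Sum.inr : β → α ⊕ β) ↔ v ∈ z := by
  simp [Sym2.mem_map]

lemma inl_notMem_map_inr {α β : Type} {z : Sym2 β} {v : α} :
    Sum.inl v ∉ z.map (Sum.inr : β → α ⊕ β) := by
  simp [Sym2.mem_map]

lemma inr_notMem_map_inl {α β : Type} {z : Sym2 α} {v : β} :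
    Sum.inr v ∉ z.map (Sum.inl : α → α ⊕ β) := by
  simp [Sym2.mem_map]

lemma inl_mem_mk_iff {α β : Type} {a v : α} {b : β} :
    (Sum.inl v : α ⊕ β) ∈ s(Sum.inl a, Sum.inr b) ↔ a = v := by
  simp [eq_comm]

lemma inr_mem_mk_iff {α β : Type} {a : α} {b v : β} :
    (Sum.inr v : α ⊕ β) ∈ s(Sum.inl a, Sum.inr b) ↔ b = v := by
  simp [eq_comm]

variable (τ₁ : MarkedTree) (t₁ : τ₁.T) (τ₂ : MarkedTree) (t₂ : τ₂.T)

/-- At a vertex of the first tree, the new edge replaces the tail `t₁`. -/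
lemma MarkedTree.valence_graft_inl (v : τ₁.V) :
    (τ₁.graft t₁ τ₂ t₂).valence (Sum.inl v) = τ₁.valence v := by
  have h₁ := card_fibre_eq_card_fibre_ne_add τ₁.root t₁ v
  have hT : Nat.card {t // (τ₁.graft t₁ τ₂ t₂).root t = Sum.inl v} =
      Nat.card {t : {t // t ≠ t₁} // τ₁.root t.1 = v} := by
    refine (card_subtype_sum (fun t : {t : τ₁.T // t ≠ t₁} ⊕ {t : τ₂.T // t ≠ t₂} =>
      (τ₁.graft t₁ τ₂ t₂).root t = Sum.inl v)).trans ?_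
    refine (congrArg₂ (· + ·) (card_subtype_congr fun _ => Sum.inl_injective.eq_iff)
      (card_subtype_eq_zero fun _ => Sum.inr_ne_inl)).trans (Nat.add_zero _)
  have hE : Nat.card {e // Sum.inl v ∈ (τ₁.graft t₁ τ₂ t₂).ends e} =
      Nat.card {e // v ∈ τ₁.ends e} + Nat.card {_u : Unit // τ₁.root t₁ = v} := by
    refine (card_subtype_sum (fun e : (τ₁.E ⊕ τ₂.E) ⊕ Unit =>
      Sum.inl v ∈ (τ₁.graft t₁ τ₂ t₂).ends e)).trans (congrArg₂ (· + ·) ?_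
        (card_subtype_congr fun _ => inl_mem_mk_iff))
    refine (card_subtype_sum (fun e : τ₁.E ⊕ τ₂.E =>
      Sum.inl v ∈ (τ₁.graft t₁ τ₂ t₂).ends (Sum.inl e))).trans ?_
    exact (congrArg₂ (· + ·) (card_subtype_congr fun _ => inl_mem_map_inl_iff)
      (card_subtype_eq_zero fun _ => inl_notMem_map_inr)).trans
      (Nat.add_zero _)
  change Nat.card {t // (τ₁.graft t₁ τ₂ t₂).root t = Sum.inl v} +
    Nat.card {e // Sum.inl v ∈ (τ₁.graft t₁ τ₂ t₂).ends e} =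
      Nat.card {t // τ₁.root t = v} + Nat.card {e // v ∈ τ₁.ends e}
  omega

/-- At a vertex of the second tree, the new edge replaces the tail `t₂`. -/
lemma MarkedTree.valence_graft_inr (v : τ₂.V) :
    (τ₁.graft t₁ τ₂ t₂).valence (Sum.inr v) = τ₂.valence v := by
  have h₁ := card_fibre_eq_card_fibre_ne_add τ₂.root t₂ v
  have hT : Nat.card {t // (τ₁.graft t₁ τ₂ t₂).root t = Sum.inr v} =
      Nat.card {t : {t // t ≠ t₂} // τ₂.root t.1 = v} := by
    refine (card_subtype_sum (fun t : {t : τ₁.T // t ≠ t₁} ⊕ {t : τ₂.T // t ≠ t₂} =>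
      (τ₁.graft t₁ τ₂ t₂).root t = Sum.inr v)).trans ?_
    refine (congrArg₂ (· + ·) (card_subtype_eq_zero fun _ => Sum.inl_ne_inr)
      (card_subtype_congr fun _ => Sum.inr_injective.eq_iff)).trans (Nat.zero_add _)
  have hE : Nat.card {e // Sum.inr v ∈ (τ₁.graft t₁ τ₂ t₂).ends e} =
      Nat.card {e // v ∈ τ₂.ends e} + Nat.card {_u : Unit // τ₂.root t₂ = v} := by
    refine (card_subtype_sum (fun e : (τ₁.E ⊕ τ₂.E) ⊕ Unit =>
      Sum.inr v ∈ (τ₁.graft t₁ τ₂ t₂).ends e)).trans (congrArg₂ (· + ·) ?_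
        (card_subtype_congr fun _ => inr_mem_mk_iff))
    refine (card_subtype_sum (fun e : τ₁.E ⊕ τ₂.E =>
      Sum.inr v ∈ (τ₁.graft t₁ τ₂ t₂).ends (Sum.inl e))).trans ?_
    exact (congrArg₂ (· + ·) (card_subtype_eq_zero fun _ => inr_notMem_map_inl)
      (card_subtype_congr fun _ => inr_mem_map_inr_iff)).trans
      (Nat.zero_add _)
  change Nat.card {t // (τ₁.graft t₁ τ₂ t₂).root t = Sum.inr v} +
    Nat.card {e // Sum.inr v ∈ (τ₁.graft t₁ τ₂ t₂).ends e} =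
      Nat.card {t // τ₂.root t = v} + Nat.card {e // v ∈ τ₂.ends e}
  omega

end Valence

/-! ### Curve classes -/

section Class

/-- The class of a component is intrinsic to this component with its reduced structure, so it does not
change when the curve is embedded into a larger one. -/
lemma HasClass.image {K : Type} [Field K] {X Y' Y : Scheme.{0}} {f' : Y' ⟶ Spec (CommRingCat.of K)}
    {f : Y ⟶ Spec (CommRingCat.of K)} {ψ' : Y' ⟶ X} {ψ : Y ⟶ X} {Z : Set Y'} {β : CurveClass X}
    (h : HasClass f' ψ' Z β) (k : Y' ⟶ Y) [IsClosedImmersion k] (hf : k ≫ f = f')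
    (hψ : k ≫ ψ = ψ') : HasClass f ψ (k '' Z) β := by
  obtain ⟨Z', ι, hred, hι, rfl, hdeg⟩ := h
  refine ⟨Z', ι ≫ k, hred, inferInstance, ?_, fun M => ?_⟩
  · ext z
    simp only [Set.mem_range, Set.mem_image, Scheme.Hom.comp_apply, exists_exists_eq_and]
  · subst hf hψ
    rw [Category.assoc, Category.assoc]
    exact hdeg M

end Class

/-! ### Geometric fibres of a glued curve -/

section GeometricPoints

variable {B : Scheme.{0}}

/-- The geometric point over a point `b` of the base with values in an algebraic closure of the
residue field. -/
def geometricPoint (b : B) :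
    Spec (CommRingCat.of (AlgebraicClosure (B.residueField b))) ⟶ B :=
  Spec.map (CommRingCat.ofHom
    (algebraMap (B.residueField b) (AlgebraicClosure (B.residueField b)))) ≫ B.fromSpecResidueField b

lemma geometricPoint_apply (b : B) (pt) : geometricPoint b pt = b := by
  rw [geometricPoint, Scheme.Hom.comp_apply]
  exact Scheme.fromSpecResidueField_apply _ _

variable {τ : MarkedTree} {D : SpinCurve B τ.T τ.E}

/-- Sections that meet over `b` cut out the same point of the geometric fibre at `b`; in a fibre with
dual tree `τ` the special points are distinct. -/
lemma SpinCurve.avoids_of_isDualTree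
    (h : ∀ (K : Type) [Field K] [IsAlgClosed K] (s : Spec (CommRingCat.of K) ⟶ B),
      ∃ Φ : τ.V ≃ irreducibleComponents ↥(pullback D.c s), IsDualTree τ D s Φ) (t : τ.T) :
    D.Avoids t := by
  intro y hy b b' hb
  have hbb : b = b' := by
    have h' := congrArg D.c hb
    rw [← Scheme.Hom.comp_apply, ← Scheme.Hom.comp_apply, D.special_section, D.tail_section] at h'
    exact h'
  subst hbb
  obtain ⟨Φ, hΦ⟩ := h _ (geometricPoint b)
  let pt : ↥(Spec (CommRingCat.of (AlgebraicClosure (B.residueField b)))) :=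
    IsLocalRing.closedPoint _
  have hpt := geometricPoint_apply b pt
  have heq := fibrePoint_eq_of_apply_eq (geometricPoint b) (D.special_section y) (D.tail_section t) pt
    (by rw [hpt, hb])
  obtain t' | e := y
  · exact hy (congrArg Sum.inl (hΦ.tail_injective heq))
  · refine (hΦ.node_range _).2 ⟨e, rfl⟩ ?_
    have heq' : fibrePoint (D.node_section e) (geometricPoint b) =
        fibrePoint (D.tail_section t) (geometricPoint b) := heq
    rw [heq']
    exact hΦ.tail_smooth t

end GeometricPoints

section GluedFibres

variable {B C₁ C₂ C : Scheme.{0}} {p₁ : B ⟶ C₁} {p₂ : B ⟶ C₂} {i₁ : C₁ ⟶ C} {i₂ : C₂ ⟶ C}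
  {c₁ : C₁ ⟶ B} {c₂ : C₂ ⟶ B} {c : C ⟶ B} {K : Type} [Field K]
  (s : Spec (CommRingCat.of K) ⟶ B)

namespace IsGlued

variable (H : IsGlued p₁ p₂ i₁ i₂) (h₁ : i₁ ≫ c = c₁) (h₂ : i₂ ≫ c = c₂)
include H

lemma fibre_cover (z : ↥(pullback c s)) :
    z ∈ Set.range (fibreMap h₁ s) ∨ z ∈ Set.range (fibreMap h₂ s) :=
  (H.cover (pullback.fst c s z)).imp (mem_range_fibreMap h₁ s) (mem_range_fibreMap h₂ s)

lemma fibre_meet (hp₁ : p₁ ≫ c₁ = 𝟙 B) (hp₂ : p₂ ≫ c₂ = 𝟙 B) (y₁ : ↥(pullback c₁ s))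
    (y₂ : ↥(pullback c₂ s)) (h : fibreMap h₁ s y₁ = fibreMap h₂ s y₂) :
    y₁ = fibrePoint hp₁ s ∧ y₂ = fibrePoint hp₂ s := by
  have h' := congrArg (pullback.fst c s) h
  rw [← Scheme.Hom.comp_apply, ← Scheme.Hom.comp_apply, fibreMap_fst, fibreMap_fst,
    Scheme.Hom.comp_apply, Scheme.Hom.comp_apply] at h'
  obtain ⟨β, hβ₁, hβ₂⟩ := H.meet _ _ h'
  exact ⟨eq_fibrePoint_of_fst_eq s hp₁ hβ₁.symm, eq_fibrePoint_of_fst_eq s hp₂ hβ₂.symm⟩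

/-- Away from the section along which it is glued, a fibre of a piece is open in the fibre of the
glued curve, so the smooth points are the same. -/
lemma mem_smoothLocus_iff [LocallyOfFinitePresentation c] [LocallyOfFinitePresentation c₁]
    (hp₁ : p₁ ≫ c₁ = 𝟙 B) {y : ↥(pullback c₁ s)} (hy : y ≠ fibrePoint hp₁ s) :
    y ∈ (pullback.snd c₁ s).smoothLocus ↔ fibreMap h₁ s y ∈ (pullback.snd c s).smoothLocus := by
  have := H.closed₂
  let U : C.Opens := ⟨(Set.range i₂)ᶜ, i₂.isClosedEmbedding.isClosed_range.isOpen_compl⟩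
  have hU := H.isOpenImmersion_of_forall_notMem U fun y hy => hy ⟨y, rfl⟩
  have hsq := (isPullback_morphismRestrict (pullback.fst c₁ s) (i₁ ⁻¹ᵁ U)).flip.paste_horiz
    (isPullback_fibreMap h₁ s)
  have hW : IsOpenImmersion ((pullback.fst c₁ s ⁻¹ᵁ (i₁ ⁻¹ᵁ U)).ι ≫ fibreMap h₁ s) :=
    MorphismProperty.of_isPullback hsq.flip hU
  refine mem_smoothLocus_iff_of_isOpenImmersion (fibreMap_snd h₁ s) _ hW ?_
  rintro ⟨y₂, hy₂⟩
  obtain ⟨β, hβ, -⟩ := H.meet _ _ hy₂.symm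
  exact hy (eq_fibrePoint_of_fst_eq s hp₁ hβ.symm)

end IsGlued

end GluedFibres

section DualTree

variable {B : Scheme.{0}} {K : Type} [Field K] [IsAlgClosed K]
  (s : Spec (CommRingCat.of K) ⟶ B)

lemma SpinCurve.isDomain_and_not_isField_stalk {T E : Type} (D : SpinCurve B T E) {p : B ⟶ D.C}
    (hp : p ≫ D.c = 𝟙 B) (h : fibrePoint hp s ∈ (pullback.snd D.c s).smoothLocus) :
    IsDomain ((pullback D.c s).presheaf.stalk (fibrePoint hp s)) ∧
      ¬ IsField ((pullback D.c s).presheaf.stalk (fibrePoint hp s)) :=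
  (D.prestable.geometric_fibre K s).isDomain_and_not_isField_stalk (IsLocalRing.closedPoint K)
    (fibreSection s hp) (fibreSection_snd s hp) h

variable {τ₁ τ₂ : MarkedTree} {t₁ : τ₁.T} {t₂ : τ₂.T} {D₁ : SpinCurve B τ₁.T τ₁.E}
  {D₂ : SpinCurve B τ₂.T τ₂.E} {D : SpinCurve B (τ₁.graft t₁ τ₂ t₂).T (τ₁.graft t₁ τ₂ t₂).E}
  (G : SpinGluing D₁ t₁ D₂ t₂ D)

/-- The dual tree of a fibre of a glued curve is the grafted tree: its irreducible components are the
images of those of the two pieces. -/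
lemma SpinGluing.exists_isDualTree {Φ₁ : τ₁.V ≃ irreducibleComponents ↥(pullback D₁.c s)}
    {Φ₂ : τ₂.V ≃ irreducibleComponents ↥(pullback D₂.c s)} (hΦ₁ : IsDualTree τ₁ D₁ s Φ₁)
    (hΦ₂ : IsDualTree τ₂ D₂ s Φ₂) :
    ∃ Φ : (τ₁.graft t₁ τ₂ t₂).V ≃ irreducibleComponents ↥(pullback D.c s),
      IsDualTree (τ₁.graft t₁ τ₂ t₂) D s Φ ∧
      (∀ v, (Φ (Sum.inl v) : Set _) = fibreMap G.inc₁.over_base s '' (Φ₁ v : Set _)) ∧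
      (∀ v, (Φ (Sum.inr v) : Set _) = fibreMap G.inc₂.over_base s '' (Φ₂ v : Set _)) := by
  have H := G.glued
  have := H.closed₁
  have := H.closed₂
  have hc₁ := isClosedImmersion_fibreMap G.inc₁.over_base s
  have hc₂ := isClosedImmersion_fibreMap G.inc₂.over_base s
  have cover := H.fibre_cover s G.inc₁.over_base G.inc₂.over_base
  have meet := H.fibre_meet s G.inc₁.over_base G.inc₂.over_base (D₁.tail_section t₁)
    (D₂.tail_section t₂)
  have smooth₁ := fun y hy => H.mem_smoothLocus_iff s G.inc₁.over_base (D₁.tail_section t₁) (y := y) hy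
  have smooth₂ := fun y hy =>
    H.symm.mem_smoothLocus_iff s G.inc₂.over_base (D₂.tail_section t₂) (y := y) hy
  have tail₁ := fun t => fibreMap_fibrePoint G.inc₁.over_base s (D₁.tail_section t.1)
    (D.tail_section (Sum.inl t)) (G.tail₁ t)
  have tail₂ := fun t => fibreMap_fibrePoint G.inc₂.over_base s (D₂.tail_section t.1)
    (D.tail_section (Sum.inr t)) (G.tail₂ t)
  have node₁ := fun e => fibreMap_fibrePoint G.inc₁.over_base s (D₁.node_section e)
    (D.node_section (Sum.inl (Sum.inl e))) (G.node₁ e)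
  have node₂ := fun e => fibreMap_fibrePoint G.inc₂.over_base s (D₂.node_section e)
    (D.node_section (Sum.inl (Sum.inr e))) (G.node₂ e)
  have new₁ := fibreMap_fibrePoint G.inc₁.over_base s (D₁.tail_section t₁)
    (D.node_section (Sum.inr ())) G.node
  have new₂ := fibreMap_fibrePoint G.inc₂.over_base s (D₂.tail_section t₂)
    (D.node_section (Sum.inr ())) (G.node.trans H.comm)
  have inj₁ : Function.Injective (fibreMap G.inc₁.over_base s) :=
    (fibreMap G.inc₁.over_base s).isClosedEmbedding.injective
  have inj₂ : Function.Injective (fibreMap G.inc₂.over_base s) :=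
    (fibreMap G.inc₂.over_base s).isClosedEmbedding.injective
  obtain ⟨hd₁, hf₁⟩ := D₁.isDomain_and_not_isField_stalk s (D₁.tail_section t₁) (hΦ₁.tail_smooth t₁)
  obtain ⟨hd₂, hf₂⟩ := D₂.isDomain_and_not_isField_stalk s (D₂.tail_section t₂) (hΦ₂.tail_smooth t₂)
  obtain ⟨e, he₁, he₂⟩ := exists_equiv_irreducibleComponents
    (fibreMap G.inc₁.over_base s).isClosedEmbedding (fibreMap G.inc₂.over_base s).isClosedEmbedding
    cover meet (singleton_notMem_irreducibleComponents hd₁ hf₁)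
    (singleton_notMem_irreducibleComponents hd₂ hf₂)
  -- The special points of the pieces other than the glued tails do not lie on the other piece.
  have tail_ne₁ : ∀ t : {t // t ≠ t₁}, fibrePoint (D₁.tail_section t.1) s ≠
      fibrePoint (D₁.tail_section t₁) s := fun t h => t.2 (hΦ₁.tail_injective h)
  have tail_ne₂ : ∀ t : {t // t ≠ t₂}, fibrePoint (D₂.tail_section t.1) s ≠
      fibrePoint (D₂.tail_section t₂) s := fun t h => t.2 (hΦ₂.tail_injective h)
  have node_ne₁ : ∀ e, fibrePoint (D₁.node_section e) s ≠ fibrePoint (D₁.tail_section t₁) s :=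
    fun e h => (hΦ₁.node_range _).2 ⟨e, rfl⟩ (h ▸ hΦ₁.tail_smooth t₁)
  have node_ne₂ : ∀ e, fibrePoint (D₂.node_section e) s ≠ fibrePoint (D₂.tail_section t₂) s :=
    fun e h => (hΦ₂.node_range _).2 ⟨e, rfl⟩ (h ▸ hΦ₂.tail_smooth t₂)
  let Φ : τ₁.V ⊕ τ₂.V ≃ irreducibleComponents ↥(pullback D.c s) := (Equiv.sumCongr Φ₁ Φ₂).trans e
  have hl : ∀ v, (Φ (Sum.inl v) : Set _) = fibreMap G.inc₁.over_base s '' (Φ₁ v : Set _) :=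
    fun v => he₁ (Φ₁ v)
  have hr : ∀ v, (Φ (Sum.inr v) : Set _) = fibreMap G.inc₂.over_base s '' (Φ₂ v : Set _) :=
    fun v => he₂ (Φ₂ v)
  have mem_ll : ∀ y v, fibreMap G.inc₁.over_base s y ∈ (Φ (Sum.inl v) : Set _) ↔ y ∈ (Φ₁ v : Set _) :=
    fun y v => by rw [hl]; exact inj₁.mem_set_image
  have mem_rr : ∀ y v, fibreMap G.inc₂.over_base s y ∈ (Φ (Sum.inr v) : Set _) ↔ y ∈ (Φ₂ v : Set _) :=
    fun y v => by rw [hr]; exact inj₂.mem_set_image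
  have mem_lr : ∀ y v, y ≠ fibrePoint (D₁.tail_section t₁) s →
      fibreMap G.inc₁.over_base s y ∉ (Φ (Sum.inr v) : Set _) := by
    intro y v hy
    rw [hr]
    rintro ⟨y₂, -, hy₂⟩
    exact hy (meet _ _ hy₂.symm).1
  have mem_rl : ∀ y v, y ≠ fibrePoint (D₂.tail_section t₂) s →
      fibreMap G.inc₂.over_base s y ∉ (Φ (Sum.inl v) : Set _) := by
    intro y v hy
    rw [hl]
    rintro ⟨y₁, -, hy₁⟩
    exact hy (meet _ _ hy₁).2
  -- The new node lies on two components, but a smooth point lies on only one.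
  have new_notMem : fibrePoint (D.node_section (Sum.inr ())) s ∉ (pullback.snd D.c s).smoothLocus := by
    intro h
    have hd := (D.isDomain_and_not_isField_stalk s _ h).1
    have hv₁ : fibrePoint (D.node_section (Sum.inr ())) s ∈ (Φ (Sum.inl (τ₁.root t₁)) : Set _) := by
      rw [← new₁, mem_ll, hΦ₁.tail_mem]
    have hv₂ : fibrePoint (D.node_section (Sum.inr ())) s ∈ (Φ (Sum.inr (τ₂.root t₂)) : Set _) := by
      rw [← new₂, mem_rr, hΦ₂.tail_mem]
    have heq := eq_of_isDomain_stalk hd (Φ (Sum.inl (τ₁.root t₁))).2 (Φ (Sum.inr (τ₂.root t₂))).2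
      hv₁ hv₂
    exact Sum.inl_ne_inr (Φ.injective (Subtype.ext heq))
  refine ⟨Φ, ⟨?_, ?_, ?_, fun z => ⟨fun hz => ?_, ?_⟩, ?_, ?_⟩, hl, hr⟩
  · rintro (t | t)
    · rw [← tail₁ t]
      exact (smooth₁ _ (tail_ne₁ t)).1 (hΦ₁.tail_smooth _)
    · rw [← tail₂ t]
      exact (smooth₂ _ (tail_ne₂ t)).1 (hΦ₂.tail_smooth _)
  · rintro (t | t) (t' | t') h
    · have h' := (tail₁ t).trans (h.trans (tail₁ t').symm)
      exact congrArg Sum.inl (Subtype.ext (hΦ₁.tail_injective (inj₁ h')))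
    · have h' := (tail₁ t).trans (h.trans (tail₂ t').symm)
      exact absurd (meet _ _ h').1 (tail_ne₁ t)
    · have h' := (tail₁ t').trans (h.symm.trans (tail₂ t).symm)
      exact absurd (meet _ _ h').1 (tail_ne₁ t')
    · have h' := (tail₂ t).trans (h.trans (tail₂ t').symm)
      exact congrArg Sum.inr (Subtype.ext (hΦ₂.tail_injective (inj₂ h')))
  · rintro ((e | e) | ⟨⟩) ((e' | e') | ⟨⟩) h
    · have h' := (node₁ e).trans (h.trans (node₁ e').symm)
      exact congrArg (Sum.inl ∘ Sum.inl) (hΦ₁.node_injective (inj₁ h'))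
    · have h' := (node₁ e).trans (h.trans (node₂ e').symm)
      exact absurd (meet _ _ h').1 (node_ne₁ e)
    · have h' := (node₁ e).trans (h.trans new₁.symm)
      exact absurd (inj₁ h') (node_ne₁ e)
    · have h' := (node₁ e').trans (h.symm.trans (node₂ e).symm)
      exact absurd (meet _ _ h').1 (node_ne₁ e')
    · have h' := (node₂ e).trans (h.trans (node₂ e').symm)
      exact congrArg (Sum.inl ∘ Sum.inr) (hΦ₂.node_injective (inj₂ h'))
    · have h' := (node₂ e).trans (h.trans new₂.symm)
      exact absurd (inj₂ h') (node_ne₂ e)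
    · have h' := (node₁ e').trans (h.symm.trans new₁.symm)
      exact absurd (inj₁ h') (node_ne₁ e')
    · have h' := (node₂ e').trans (h.symm.trans new₂.symm)
      exact absurd (inj₂ h') (node_ne₂ e')
    · rfl
  · obtain ⟨y, rfl⟩ | ⟨y, rfl⟩ := cover z
    · by_cases hy : y = fibrePoint (D₁.tail_section t₁) s
      · exact ⟨Sum.inr (), by rw [hy, new₁]⟩
      · obtain ⟨e, rfl⟩ := (hΦ₁.node_range y).1 fun h => hz ((smooth₁ y hy).1 h)
        exact ⟨Sum.inl (Sum.inl e), (node₁ e).symm⟩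
    · by_cases hy : y = fibrePoint (D₂.tail_section t₂) s
      · exact ⟨Sum.inr (), by rw [hy, new₂]⟩
      · obtain ⟨e, rfl⟩ := (hΦ₂.node_range y).1 fun h => hz ((smooth₂ y hy).1 h)
        exact ⟨Sum.inl (Sum.inr e), (node₂ e).symm⟩
  · rintro ⟨(e | e) | ⟨⟩, rfl⟩
    · rw [← node₁ e, ← smooth₁ _ (node_ne₁ e)]
      exact (hΦ₁.node_range _).2 ⟨e, rfl⟩
    · rw [← node₂ e, ← smooth₂ _ (node_ne₂ e)]
      exact (hΦ₂.node_range _).2 ⟨e, rfl⟩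
    · exact new_notMem
  · rintro (t | t) (v | v)
    · rw [← tail₁ t]
      exact (mem_ll _ v).trans ((hΦ₁.tail_mem _ v).trans Sum.inl_injective.eq_iff.symm)
    · rw [← tail₁ t]
      exact iff_of_false (mem_lr _ v (tail_ne₁ t)) Sum.inl_ne_inr
    · rw [← tail₂ t]
      exact iff_of_false (mem_rl _ v (tail_ne₂ t)) Sum.inr_ne_inl
    · rw [← tail₂ t]
      exact (mem_rr _ v).trans ((hΦ₂.tail_mem _ v).trans Sum.inr_injective.eq_iff.symm)
  · rintro ((e | e) | ⟨⟩) (v | v)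
    · rw [← node₁ e]
      exact (mem_ll _ v).trans ((hΦ₁.node_mem _ v).trans inl_mem_map_inl_iff.symm)
    · rw [← node₁ e]
      exact iff_of_false (mem_lr _ v (node_ne₁ e)) inr_notMem_map_inl
    · rw [← node₂ e]
      exact iff_of_false (mem_rl _ v (node_ne₂ e)) inl_notMem_map_inr
    · rw [← node₂ e]
      exact (mem_rr _ v).trans ((hΦ₂.node_mem _ v).trans inr_mem_map_inr_iff.symm)
    · rw [← new₁]
      exact (mem_ll _ v).trans ((hΦ₁.tail_mem _ v).trans inl_mem_mk_iff.symm)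
    · rw [← new₂]
      exact (mem_rr _ v).trans ((hΦ₂.tail_mem _ v).trans inr_mem_mk_iff.symm)

end DualTree

/-! ### Stability of a glued curve -/

section Stability

variable {B : Scheme.{0}} {τ₁ τ₂ : MarkedTree} {t₁ : τ₁.T} {t₂ : τ₂.T}

lemma SpinGluing.isStableOfType {D₁ : SpinCurve B τ₁.T τ₁.E} {D₂ : SpinCurve B τ₂.T τ₂.E}
    {D : SpinCurve B (τ₁.graft t₁ τ₂ t₂).T (τ₁.graft t₁ τ₂ t₂).E} (G : SpinGluing D₁ t₁ D₂ t₂ D)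
    (h₁ : D₁.IsStableOfType) (h₂ : D₂.IsStableOfType) : D.IsStableOfType := by
  refine ⟨?_, fun K _ _ s => ?_⟩
  · rintro (v | v)
    · rw [MarkedTree.valence_graft_inl]
      exact h₁.1 v
    · rw [MarkedTree.valence_graft_inr]
      exact h₂.1 v
  · obtain ⟨Φ₁, hΦ₁⟩ := h₁.2 K s
    obtain ⟨Φ₂, hΦ₂⟩ := h₂.2 K s
    obtain ⟨Φ, hΦ, -⟩ := G.exists_isDualTree s hΦ₁ hΦ₂
    exact ⟨Φ, hΦ⟩

variable {X S : Scheme.{0}} {b : B ⟶ S} {x : X ⟶ S} {β₁ : τ₁.V → CurveClass X}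
  {β₂ : τ₂.V → CurveClass X} {Φ₁ : SpinMap b x τ₁.T τ₁.E} {Φ₂ : SpinMap b x τ₂.T τ₂.E}

lemma SpinGluing.isStableOfType_map
    {Φ : SpinMap b x (τ₁.graft t₁ τ₂ t₂).T (τ₁.graft t₁ τ₂ t₂).E}
    (G : SpinGluing Φ₁.toSpinCurve t₁ Φ₂.toSpinCurve t₂ Φ.toSpinCurve)
    (hφ₁ : G.inc₁.i ≫ Φ.φ = Φ₁.φ) (hφ₂ : G.inc₂.i ≫ Φ.φ = Φ₂.φ)
    (h₁ : Φ₁.IsStableOfType β₁) (h₂ : Φ₂.IsStableOfType β₂) :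
    Φ.IsStableOfType (τ := τ₁.graft t₁ τ₂ t₂) (Sum.elim β₁ β₂) := by
  have := G.glued.closed₁
  have := G.glued.closed₂
  refine ⟨?_, fun K _ _ s => ?_⟩
  · rintro (v | v) hv
    · rw [MarkedTree.valence_graft_inl]
      exact h₁.1 v hv
    · rw [MarkedTree.valence_graft_inr]
      exact h₂.1 v hv
  · obtain ⟨Ψ₁, hΨ₁, hβ₁⟩ := h₁.2 K s
    obtain ⟨Ψ₂, hΨ₂, hβ₂⟩ := h₂.2 K s
    obtain ⟨Ψ, hΨ, hl, hr⟩ := G.exists_isDualTree s hΨ₁ hΨ₂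
    have hc₁ := isClosedImmersion_fibreMap G.inc₁.over_base s
    have hc₂ := isClosedImmersion_fibreMap G.inc₂.over_base s
    refine ⟨Ψ, hΨ, ?_⟩
    rintro (v | v)
    · rw [hl]
      exact (hβ₁ v).image (fibreMap G.inc₁.over_base s) (fibreMap_snd _ s)
        (by rw [← Category.assoc, fibreMap_fst, Category.assoc, hφ₁])
    · rw [hr]
      exact (hβ₂ v).image (fibreMap G.inc₂.over_base s) (fibreMap_snd _ s)
        (by rw [← Category.assoc, fibreMap_fst, Category.assoc, hφ₂])

end Stability

end SUSY

end

theorem mainTheorem10 {B : Scheme.{0}} (b : B ⟶ Spec (CommRingCat.of ℂ)) :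
    (∀ (τ₁ τ₂ : SUSY.MarkedTree) (t₁ : τ₁.T) (t₂ : τ₂.T)
      (C₁ : SUSY.SpinCurve B τ₁.T τ₁.E) (C₂ : SUSY.SpinCurve B τ₂.T τ₂.E)
      (C : SUSY.SpinCurve B (τ₁.graft t₁ τ₂ t₂).T (τ₁.graft t₁ τ₂ t₂).E)
      (_G : SUSY.SpinGluing C₁ t₁ C₂ t₂ C),
      C₁.IsStableOfType → C₂.IsStableOfType →
        C.IsStableOfType ∧
          Nonempty (C.normalBundle ≅ C₁.normalBundle ⊞ C₂.normalBundle)) ∧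
    (∀ (X : Scheme.{0}) (x : X ⟶ Spec (CommRingCat.of ℂ)), SUSY.IsSmoothProjective x →
      ∀ (τ₁ τ₂ : SUSY.MarkedTree) (t₁ : τ₁.T) (t₂ : τ₂.T)
      (β₁ : τ₁.V → SUSY.CurveClass X) (β₂ : τ₂.V → SUSY.CurveClass X)
      (Φ₁ : SUSY.SpinMap b x τ₁.T τ₁.E) (Φ₂ : SUSY.SpinMap b x τ₂.T τ₂.E)
      (C : SUSY.SpinCurve B (τ₁.graft t₁ τ₂ t₂).T (τ₁.graft t₁ τ₂ t₂).E)
      (G : SUSY.SpinGluing Φ₁.toSpinCurve t₁ Φ₂.toSpinCurve t₂ C),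
      Φ₁.IsStableOfType β₁ → Φ₂.IsStableOfType β₂ →
      Φ₁.tail t₁ ≫ Φ₁.φ = Φ₂.tail t₂ ≫ Φ₂.φ →
        (∃! φ : C.C ⟶ X, G.inc₁.i ≫ φ = Φ₁.φ ∧ G.inc₂.i ≫ φ = Φ₂.φ) ∧
        ∀ φ : C.C ⟶ X, G.inc₁.i ≫ φ = Φ₁.φ → G.inc₂.i ≫ φ = Φ₂.φ →
          ∃ h : φ ≫ x = C.c ≫ b,
            (SUSY.SpinMap.mk (b := b) (x := x) C φ h).IsStableOfType
              (τ := τ₁.graft t₁ τ₂ t₂) (Sum.elim β₁ β₂) ∧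
            Nonempty ((SUSY.SpinMap.mk (b := b) (x := x) C φ h).normalBundle ≅
              Φ₁.normalBundle ⊞ Φ₂.normalBundle)) := by
  refine ⟨?_, ?_⟩
  · intro τ₁ τ₂ t₁ t₂ C₁ C₂ C G h₁ h₂
    exact ⟨G.isStableOfType h₁ h₂, G.nonempty_normalBundle_iso
      (SUSY.SpinCurve.avoids_of_isDualTree h₁.2 _) (SUSY.SpinCurve.avoids_of_isDualTree h₂.2 _)⟩
  · intro X x _ τ₁ τ₂ t₁ t₂ β₁ β₂ Φ₁ Φ₂ C G h₁ h₂ h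
    refine ⟨G.glued.existsUnique_hom h, fun φ hφ₁ hφ₂ => ?_⟩
    have hx : φ ≫ x = C.c ≫ b := by
      apply G.glued.hom_ext
      · rw [← Category.assoc, hφ₁, Φ₁.φ_comp, ← Category.assoc, G.inc₁.over_base]
      · rw [← Category.assoc, hφ₂, Φ₂.φ_comp, ← Category.assoc, G.inc₂.over_base]
    refine ⟨hx, SUSY.SpinGluing.isStableOfType_map (Φ := SUSY.SpinMap.mk C φ hx) G hφ₁ hφ₂ h₁ h₂,
      SUSY.SpinGluing.nonempty_map_normalBundle_iso (Φ := SUSY.SpinMap.mk C φ hx) G hφ₁ hφ₂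
        (SUSY.SpinCurve.avoids_of_isDualTree (fun K _ _ s => ?_) _)
        (SUSY.SpinCurve.avoids_of_isDualTree (fun K _ _ s => ?_) _)⟩
    · obtain ⟨Ψ, hΨ, -⟩ := h₁.2 K s
      exact ⟨Ψ, hΨ⟩
    · obtain ⟨Ψ, hΨ, -⟩ := h₂.2 K s
      exact ⟨Ψ, hΨ⟩
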